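/- \textbf{Setting.} Let $R_s\ge 0$ and $\phi=2^{R_s}$. \emph{RF links} ($j\in\{R,\mathcal E\}$). Given $L_j\in\mathbb N_{\ge1}$ and $\kappa_j,\mu_j,\alpha_j,D_j,\varrho_j,\bar\gamma_j>0$, let $\gamma_j=\sum_{l=1}^{L_j}\varrho_j|h_{jl}|^2q_j^{-\alpha_j}\bar\gamma_j$. Here the $|h_{jl}|$ are i.i.d. with the $\kappa$-$\mu$ density $A\,x^{\mu}e^{-Bx^2}I_{\mu-1}(Mx)$ on $(0,\infty)$, where $\mu=\mu_j$, $\kappa=\kappa_j$, $A=\frac{2\mu(1+\kappa)^{(\mu+1)/2}}{\kappa^{(\mu-1)/2}e^{\mu\kappa}}$, $B=\mu(1+\kappa)$, $M=2\mu\sqrt{\kappa(1+\kappa)}$. The distance $q_j$ is independent of them, with density $\sum_{i=1}^3 \frac{C_i}{D_j^{\beta_i+1}}q^{\beta_i}$ on $[0,D_j]$, $C=\frac1{72}(735,-1190,455)$, $\beta=(2,4,6)$. For $p\ge1$ let $V(k,p,v)=\frac{\Gamma(p+k)\,p^{1-2k}}{\Gamma(k+1)\Gamma(p-k+1)\Gamma(v+k+1)}$.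 Let $f^{(p)}_{\gamma_j}$ be the approximate density of $\gamma_j$ (with $F^{(p)}_{\gamma_j}(x)=\int_0^x f^{(p)}_{\gamma_j}$) obtained by treating the combiner output as a single $\kappa$-$\mu$ branch with parameters $\kappa_j$, $L_j\mu_j$ and average SNR $L_j\bar\gamma_j$, and replacing $I_v(x)$ in its power density by $\sum_{k=0}^pV(k,p,v)(x/2)^{v+2k}$. \emph{Optical links} ($n\in\{\mathcal D,\tilde{\mathcal E}\}$). Let $r_n\in\{1,2\}$, $\mathcal N_n\in\mathbb N_{\ge1}$, $\eta_n,N_n>0$. Let $Y_n$ be the product of two independent hop gains, each a mixture Exponential-Generalized Gamma variable, with density $\frac{w}{\nu}e^{-x/\nu}+(1-w)\frac{c\,x^{ac-1}}{b^{ac}\Gamma(a)}e^{-(x/b)^c}$ on $(0,\infty)$, times an independent pointing loss with density $\xi^2x^{\xi^2-1}/J^{\xi^2}$ on $(0,J]$ (with $0<w<1$, other parameters positive, all depending on the hop). Put $\rho_n=\mathcal N_n\frac{E(Y_n)^2}{\mathrm{Var}(Y_n)}$, $w_n=\frac{\mathrm{Var}(Y_n)}{E(Y_n)}$, $\tau_n=\frac{(\eta_nE(Y_n))^{r_n}}{N_n}$,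 and model $\gamma_n=\tau_n(\chi_n/E(Y_n))^{r_n}$ with $\chi_n$ Gamma distributed of shape $\rho_n$ and scale $w_n$. The SNRs $\gamma_R,\gamma_{\mathcal E},\gamma_{\mathcal D},\gamma_{\tilde{\mathcal E}}$ are independent. \emph{Outage.} For distribution functions $F$ and densities $f$ of the SNRs, put $SOP_1=1-\int_0^\infty F_{\gamma_R}(\phi\gamma)f_{\gamma_{\mathcal E}}(\gamma)\,d\gamma$, $SOP_2=1-\int_0^\infty F_{\gamma_{\mathcal D}}(\phi\gamma)f_{\gamma_{\tilde{\mathcal E}}}(\gamma)\,d\gamma$ and $SOP_L=1-SOP_1\,SOP_2$. Write $SOP_1^{(p)}$, $SOP_L^{(p)}$ when $f^{(p)}_{\gamma_j}$, $F^{(p)}_{\gamma_j}$ are used for $j\in\{R,\mathcal E\}$. \emph{Notation.} $\Psi_{i_j}=\frac{\beta_i+1}{\alpha_j}$, $K_{1_j}(i,k)=\frac{C_i\,V(k,p,L_j\mu_j-1)(L_j\mu_j\kappa_j)^k}{\alpha_je^{L_j\mu_j\kappa_j}}$, $K_{2_j}=\frac{L_j\mu_j(1+\kappa_j)D_j^{\alpha_j}}{\varrho_jL_j\bar\gamma_j}$;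 $\Upsilon_{1_n}=\frac{E(Y_n)^{\rho_n}}{r_n\Gamma(\rho_n)w_n^{\rho_n}\tau_n^{\rho_n/r_n}}$, $\Upsilon_{2_n}=\frac{E(Y_n)}{w_n\tau_n^{1/r_n}}$, $\Upsilon_{3_n}=\frac{E(Y_n)^{\rho_n}}{\sqrt{r_n}\Gamma(\rho_n)w_n^{\rho_n}\tau_n^{\rho_n/r_n}(2\pi)^{(r_n-1)/2}}$, $\Upsilon_{4_n}=\frac{E(Y_n)^{r_n}}{r_n^{r_n}w_n^{r_n}\tau_n}$, $\zeta=\frac{\rho_{\mathcal D}}{r_{\mathcal D}}+\frac{\rho_{\tilde{\mathcal E}}}{r_{\tilde{\mathcal E}}}$. $G^{m,n}_{p,q}$ is Meijer's function, $\frac1{2\pi i}\int\frac{\prod_{j\le m}\Gamma(b_j-s)\prod_{j\le n}\Gamma(1-a_j+s)}{\prod_{j>m}\Gamma(1-b_j+s)\prod_{j>n}\Gamma(a_j-s)}z^s\,ds$ along a vertical line separating the poles of the $\Gamma(b_j-s)$ (on the right) from those of the $\Gamma(1-a_j+s)$ (on the left). \textbf{Theorem.} All G-functions below are well defined: a separating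 vertical line exists, and along each one the integral converges absolutely to the same value. All the integrals defining $SOP_1$, $SOP_2$, $SOP_1^{(p)}$ converge. (i) For every $p\ge1$, $$SOP_1^{(p)}=1-\sum_{i=1}^{3}\sum_{k=0}^{p}K_{1_R}(i,k)\sum_{i'=1}^{3}\sum_{k'=0}^{p}K_{1_{\mathcal E}}(i',k')\;G^{3,2}_{4,4}\!\left[\frac{K_{2_{\mathcal E}}}{\phi K_{2_R}}\,\middle|\,\begin{matrix}1-\Psi_{i'_{\mathcal E}},\,1-L_R\mu_R-k,\,1,\,1+\Psi_{i_R}\\ L_{\mathcal E}\mu_{\mathcal E}+k',\,\Psi_{i_R},\,0,\,-\Psi_{i'_{\mathcal E}}\end{matrix}\right].$$ (ii) $$SOP_2=1-\phi^{\rho_{\mathcal D}/r_{\mathcal D}}\Upsilon_{3_{\mathcal D}}\Upsilon_{1_{\tilde{\mathcal E}}}\frac{r_{\tilde{\mathcal E}}^{1/2}(\phi\Upsilon_{4_{\mathcal D}})^{-\zeta}}{(2\pi)^{(r_{\tilde{\mathcal E}}-1)/2}}\;G^{r_{\tilde{\mathcal E}}+1,\,r_{\mathcal D}}_{r_{\mathcal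 D}+1,\,r_{\tilde{\mathcal E}}+1}\!\left[\frac{\Upsilon_{2_{\tilde{\mathcal E}}}^{r_{\tilde{\mathcal E}}}r_{\tilde{\mathcal E}}^{-r_{\tilde{\mathcal E}}}}{\phi\Upsilon_{4_{\mathcal D}}}\,\middle|\,\begin{matrix}\big(1-\zeta-\tfrac{k}{r_{\mathcal D}}\big)_{0\le k<r_{\mathcal D}},\;1-\tfrac{\rho_{\tilde{\mathcal E}}}{r_{\tilde{\mathcal E}}}\\ \big(\tfrac{k}{r_{\tilde{\mathcal E}}}\big)_{0\le k<r_{\tilde{\mathcal E}}},\;-\tfrac{\rho_{\tilde{\mathcal E}}}{r_{\tilde{\mathcal E}}}\end{matrix}\right].$$ (iii) Consequently $SOP_L^{(p)}=1-SOP_1^{(p)}SOP_2$ equals $1$ minus the product of the two closed forms. (iv) In the exact model, $SOP_L=1-SOP_1SOP_2=\Pr(\gamma_R\le\phi\gamma_{\mathcal E}\text{ or }\gamma_{\mathcal D}\le\phi\gamma_{\tilde{\mathcal E}})$. This is a lower bound of the outage probability $\Pr(\gamma_R\le\phi+\phi\gamma_{\mathcal E}-1\text{ or }\gamma_{\mathcal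 D}\le\phi+\phi\gamma_{\tilde{\mathcal E}}-1)$. As $p\to\infty$, the closed form in (i) tends to $SOP_1$, and the closed form in (iii) tends to $SOP_L$. -/

import Mathlib

open MeasureTheory ProbabilityTheory

/-! ### Meijer's G-function -/

/-- The Mellin--Barnes integrand of `G^{m,n}_{p,q}[z | a ; b]`, where `p`, `q` are the lengths of
the lists `a`, `b`:
`∏_{j ≤ m} Γ(b_j - s) ∏_{j ≤ n} Γ(1 - a_j + s) /
  (∏_{j > m} Γ(1 - b_j + s) ∏_{j > n} Γ(a_j - s)) * z ^ s`. -/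
noncomputable def meijerIntegrand (m n : ℕ) (a b : List ℝ) (z : ℝ) (s : ℂ) : ℂ :=
  ((b.take m).map fun x : ℝ => Complex.Gamma ((x : ℂ) - s)).prod *
    ((a.take n).map fun x : ℝ => Complex.Gamma (1 - (x : ℂ) + s)).prod /
    (((b.drop m).map fun x : ℝ => Complex.Gamma (1 - (x : ℂ) + s)).prod *
      ((a.drop n).map fun x : ℝ => Complex.Gamma ((x : ℂ) - s)).prod) *
    (z : ℂ) ^ s

/-- The line `Re s = c` has all poles of `Γ(b_j - s)`, `j ≤ m`, on its right and all poles of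
`Γ(1 - a_j + s)`, `j ≤ n`, on its left. -/
def MeijerSeparates (m n : ℕ) (a b : List ℝ) (c : ℝ) : Prop :=
  (∀ x ∈ b.take m, c < x) ∧ ∀ x ∈ a.take n, x - 1 < c

/-- `(1 / 2πi) ∫ ds` of the Mellin--Barnes integrand along the upward line `Re s = c`. -/
noncomputable def meijerLineIntegral (m n : ℕ) (a b : List ℝ) (z c : ℝ) : ℂ :=
  (1 / (2 * Real.pi) : ℂ) *
    ∫ t : ℝ, meijerIntegrand m n a b z ((c : ℂ) + (t : ℂ) * Complex.I)

open Classical in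
/-- Meijer's `G^{m,n}_{p,q}[z | a ; b]` with real parameters, by its Mellin--Barnes integral along a
vertical line separating the two families of poles (a junk value if there is no such line). -/
noncomputable def meijerG (m n : ℕ) (a b : List ℝ) (z : ℝ) : ℂ :=
  if h : ∃ c, MeijerSeparates m n a b c then meijerLineIntegral m n a b z h.choose else 0

/-- The value `meijerG m n a b z` is a genuine one: a separating vertical line exists, and along each
of them the Mellin--Barnes integral converges absolutely, to that same value. -/
def MeijerGConverges (m n : ℕ) (a b : List ℝ) (z : ℝ) : Prop :=
  (∃ c, MeijerSeparates m n a b c) ∧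
    ∀ c, MeijerSeparates m n a b c →
      Integrable (fun t : ℝ => meijerIntegrand m n a b z ((c : ℂ) + (t : ℂ) * Complex.I)) ∧
        meijerLineIntegral m n a b z c = meijerG m n a b z

/-! ### The RF links -/

/-- Parameters of an RF link from the UAV to a receiver with `L` antennas: fading parameters `κ`,
`μ`, path loss exponent `α`, radius `D` of the random waypoint ball, gain factor `ϱ`, average SNR
`γbar` of one branch. -/
structure RFLink where
  L : ℕ
  κ : ℝ
  μ : ℝ
  α : ℝ
  D : ℝ
  ϱ : ℝ
  γbar : ℝ
  L_pos : 0 < L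
  κ_pos : 0 < κ
  μ_pos : 0 < μ
  α_pos : 0 < α
  D_pos : 0 < D
  ϱ_pos : 0 < ϱ
  γbar_pos : 0 < γbar

/-- The coefficients `C_i` of the 3D random waypoint distance density. -/
noncomputable def rwpC : Fin 3 → ℝ := ![735 / 72, -1190 / 72, 455 / 72]

/-- The exponents `β_i` of the 3D random waypoint distance density. -/
noncomputable def rwpβ : Fin 3 → ℝ := ![2, 4, 6]

/-- Law of the distance `q`: density `∑ i, C_i q ^ β_i / D ^ (β_i + 1)` on `[0, D]`. -/
noncomputable def rwpLaw (D : ℝ) : Measure ℝ :=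
  (volume.restrict (Set.Icc 0 D)).withDensity fun q =>
    ENNReal.ofReal (∑ i, rwpC i / D ^ (rwpβ i + 1) * q ^ rwpβ i)

/-- The modified Bessel function of the first kind, `I_v(x)`, for `x > 0`. -/
noncomputable def besselI (v x : ℝ) : ℝ :=
  ∑' k : ℕ, (x / 2) ^ (v + 2 * k) / (k.factorial * Real.Gamma (v + k + 1))

/-- The coefficients `V(k, p, v)` of the polynomial approximation of `I_v`. -/
noncomputable def besselV (k p : ℕ) (v : ℝ) : ℝ :=
  Real.Gamma (p + k) * (p : ℝ) ^ (1 - 2 * (k : ℝ)) /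
    (Real.Gamma (k + 1) * Real.Gamma (p - k + 1) * Real.Gamma (v + k + 1))

/-- The `p`-th polynomial approximation `∑_{k ≤ p} V(k, p, v) (x / 2) ^ (v + 2 k)` of `I_v(x)`. -/
noncomputable def besselIApprox (p : ℕ) (v x : ℝ) : ℝ :=
  ∑ k ∈ Finset.range (p + 1), besselV k p v * (x / 2) ^ (v + 2 * k)

/-- `A = 2 μ (1 + κ) ^ ((μ + 1) / 2) / (κ ^ ((μ - 1) / 2) exp (μ κ))`. -/
noncomputable def kmA (κ μ : ℝ) : ℝ :=
  2 * μ * (1 + κ) ^ ((μ + 1) / 2) / (κ ^ ((μ - 1) / 2) * Real.exp (μ * κ))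

/-- `B = μ (1 + κ)`. -/
noncomputable def kmB (κ μ : ℝ) : ℝ := μ * (1 + κ)

/-- `M = 2 μ √(κ (1 + κ))`. -/
noncomputable def kmM (κ μ : ℝ) : ℝ := 2 * μ * Real.sqrt (κ * (1 + κ))

/-- The `κ-μ` law of an envelope `|h|`: density `A x ^ μ exp (-B x²) I_{μ-1}(M x)` on `(0, ∞)`. -/
noncomputable def kmEnvelopeLaw (κ μ : ℝ) : Measure ℝ :=
  (volume.restrict (Set.Ioi 0)).withDensity fun x =>
    ENNReal.ofReal
      (kmA κ μ * x ^ μ * Real.exp (-(kmB κ μ * x ^ 2)) * besselI (μ - 1) (kmM κ μ * x))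

/-- The measure whose density is the density `(A / 2) w ^ ((μ - 1) / 2) exp (-B w) I_{μ-1}(M √w)` of a
`κ-μ` power `|h|²`, with `I_{μ-1}` replaced by its `p`-th polynomial approximation. -/
noncomputable def kmPowerApprox (p : ℕ) (κ μ : ℝ) : Measure ℝ :=
  (volume.restrict (Set.Ioi 0)).withDensity fun w =>
    ENNReal.ofReal
      (kmA κ μ / 2 * w ^ ((μ - 1) / 2) * Real.exp (-(kmB κ μ * w)) *
        besselIApprox p (μ - 1) (kmM κ μ * Real.sqrt w))

namespace RFLink

variable (j : RFLink)

/-- Law of the SNR `γ = ∑_l ϱ |h_l|² q ^ (-α) γbar` at the output of the `L`-branch maximal ratio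
combiner: i.i.d. `κ-μ` envelopes, and an independent distance `q`. -/
noncomputable def snrLaw : Measure ℝ :=
  ((rwpLaw j.D).prod (Measure.pi fun _ : Fin j.L => kmEnvelopeLaw j.κ j.μ)).map fun x =>
    ∑ l, j.ϱ * x.2 l ^ 2 * x.1 ^ (-j.α) * j.γbar

/-- Approximate law of the SNR: the combiner output is treated as one `κ-μ` branch with parameters
`κ`, `L μ` and average SNR `L γbar`, and the Bessel function in its power density is replaced by the
`p`-th polynomial approximation. -/
noncomputable def snrApprox (p : ℕ) : Measure ℝ :=
  ((rwpLaw j.D).prod (kmPowerApprox p j.κ (j.L * j.μ))).map fun x =>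
    j.ϱ * x.2 * x.1 ^ (-j.α) * (j.L * j.γbar)

/-- `Ψ_i = (β_i + 1) / α`. -/
noncomputable def Ψ (i : Fin 3) : ℝ := 1 / j.α * (rwpβ i + 1)

/-- `K₁ = C_i V(k, p, L μ - 1) (L μ κ) ^ k / (α exp (L μ κ))`. -/
noncomputable def K₁ (p : ℕ) (i : Fin 3) (k : ℕ) : ℝ :=
  1 / (j.α * Real.exp (j.L * j.μ * j.κ)) * rwpC i * besselV k p (j.L * j.μ - 1) *
    (j.L * j.μ * j.κ) ^ k

/-- `K₂ = B D ^ α / (ϱ L γbar)`, with `B = L μ (1 + κ)` that of the combined branch. -/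
noncomputable def K₂ : ℝ := kmB j.κ (j.L * j.μ) * j.D ^ j.α / (j.ϱ * j.L * j.γbar)

end RFLink

/-! ### The optical links -/

/-- Parameters of one underwater optical hop: mixture Exponential-Generalized Gamma turbulence
(weight `w`, exponential scale `ν`, generalized Gamma parameters `a`, `b`, `c`) with pointing errors
(`ξ`, `J`). -/
structure OpticalHop where
  w : ℝ
  ν : ℝ
  a : ℝ
  b : ℝ
  c : ℝ
  ξ : ℝ
  J : ℝ
  w_pos : 0 < w
  w_lt : w < 1
  ν_pos : 0 < ν
  a_pos : 0 < a
  b_pos : 0 < b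
  c_pos : 0 < c
  ξ_pos : 0 < ξ
  J_pos : 0 < J

/-- The mixture Exponential-Generalized Gamma law. -/
noncomputable def OpticalHop.turbulenceLaw (h : OpticalHop) : Measure ℝ :=
  (volume.restrict (Set.Ioi 0)).withDensity fun x =>
    ENNReal.ofReal
      (h.w / h.ν * Real.exp (-(x / h.ν)) +
        (1 - h.w) * (h.c * x ^ (h.a * h.c - 1) / (h.b ^ (h.a * h.c) * Real.Gamma h.a)) *
          Real.exp (-(x / h.b) ^ h.c))

/-- The law of the pointing loss: density `ξ² x ^ (ξ² - 1) / J ^ ξ²` on `(0, J]`. -/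
noncomputable def OpticalHop.pointingLaw (h : OpticalHop) : Measure ℝ :=
  (volume.restrict (Set.Ioc 0 h.J)).withDensity fun x =>
    ENNReal.ofReal (h.ξ ^ 2 / h.J ^ (h.ξ ^ 2) * x ^ (h.ξ ^ 2 - 1))

/-- Law of the channel gain of a hop: turbulence times independent pointing loss. -/
noncomputable def OpticalHop.gainLaw (h : OpticalHop) : Measure ℝ :=
  (h.turbulenceLaw.prod h.pointingLaw).map fun x => x.1 * x.2

/-- Parameters of a link relay -- RIS -- receiver: the two hops, the number `N` of reflecting
elements, the detection type `r` (`1` heterodyne, `2` intensity modulation / direct detection), the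
conversion coefficient `η` and the noise power `N₀`. -/
structure OpticalLink where
  hopI : OpticalHop
  hopn : OpticalHop
  N : ℕ
  r : ℕ
  η : ℝ
  N₀ : ℝ
  N_pos : 0 < N
  r_eq : r = 1 ∨ r = 2
  η_pos : 0 < η
  N₀_pos : 0 < N₀

namespace OpticalLink

variable (n : OpticalLink)

/-- `E(Y)` for the cascaded gain `Y = α β` of one reflecting element, with independent hops. -/
noncomputable def meanY : ℝ := ∫ x, x.1 * x.2 ∂(n.hopI.gainLaw.prod n.hopn.gainLaw)

/-- `Var(Y)`. -/
noncomputable def varY : ℝ := Var[fun x => x.1 * x.2; n.hopI.gainLaw.prod n.hopn.gainLaw]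

/-- The shape `ρ = E(χ)² / Var(χ)`, with `χ` the sum of `N` i.i.d. copies of `Y`. -/
noncomputable def ρ : ℝ := (n.N * n.meanY) ^ 2 / (n.N * n.varY)

/-- The scale `w = Var(χ) / E(χ)`. -/
noncomputable def w : ℝ := n.N * n.varY / (n.N * n.meanY)

/-- The electrical SNR `τ = (η E(Y)) ^ r / N₀`. -/
noncomputable def τ : ℝ := (n.η * n.meanY) ^ n.r / n.N₀

/-- Law of the SNR `γ = τ (χ / E(Y)) ^ r`, with `χ` Gamma distributed with shape `ρ`, scale `w`. -/
noncomputable def snrLaw : Measure ℝ :=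
  (gammaMeasure n.ρ (1 / n.w)).map fun x => n.τ * (x / n.meanY) ^ n.r

noncomputable def Υ₁ : ℝ :=
  n.meanY ^ n.ρ / (n.r * Real.Gamma n.ρ * n.w ^ n.ρ * n.τ ^ (n.ρ / n.r))

noncomputable def Υ₂ : ℝ := n.meanY / (n.w * n.τ ^ (1 / (n.r : ℝ)))

noncomputable def Υ₃ : ℝ :=
  n.meanY ^ n.ρ / (Real.sqrt n.r * Real.Gamma n.ρ * n.w ^ n.ρ * n.τ ^ (n.ρ / n.r) *
    (2 * Real.pi) ^ (((n.r : ℝ) - 1) / 2))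

noncomputable def Υ₄ : ℝ := n.meanY ^ n.r / ((n.r : ℝ) ^ n.r * n.w ^ n.r * n.τ)

end OpticalLink

/-! ### Secrecy outage -/

/-- `1 - ∫ F(φ γ) dν(γ)`, where `F` is the distribution function of `μ`: for probability laws, the
probability that the legitimate SNR (law `μ`) exceeds `φ` times the eavesdropper's (law `ν`). -/
noncomputable def hopSOP (φ : ℝ) (μ ν : Measure ℝ) : ℝ := 1 - ∫ y, μ.real (Set.Iic (φ * y)) ∂ν

/-- The lower bound `1 - SOP₁ SOP₂`. -/
noncomputable def sopLower (φ : ℝ) (μR μE μD μE' : Measure ℝ) : ℝ :=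
  1 - hopSOP φ μR μE * hopSOP φ μD μE'

/-- Joint law of the independent SNRs `((γ_R, γ_E), (γ_D, γ_E'))`. -/
noncomputable def jointSNR (R E : RFLink) (D E' : OpticalLink) : Measure ((ℝ × ℝ) × (ℝ × ℝ)) :=
  (R.snrLaw.prod E.snrLaw).prod (D.snrLaw.prod E'.snrLaw)

/-- Parameters of the upper row of the G-function in `SOP₁`. -/
noncomputable def sop₁Upper (R E : RFLink) (i : Fin 3) (k : ℕ) (i' : Fin 3) : List ℝ :=
  [1 - E.Ψ i', 1 - R.L * R.μ - k, 1, 1 + R.Ψ i]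

/-- Parameters of the lower row of the G-function in `SOP₁`. -/
noncomputable def sop₁Lower (R E : RFLink) (i i' : Fin 3) (k' : ℕ) : List ℝ :=
  [E.L * E.μ + k', R.Ψ i, 0, -E.Ψ i']

/-- The closed form of `SOP₁`: here `(i, k)` belong to the relay, `(i', k')` to the eavesdropper. -/
noncomputable def sop₁Closed (φ : ℝ) (R E : RFLink) (p : ℕ) : ℂ :=
  1 - ∑ i : Fin 3, ∑ k ∈ Finset.range (p + 1), (R.K₁ p i k : ℂ) *
    ∑ i' : Fin 3, ∑ k' ∈ Finset.range (p + 1), (E.K₁ p i' k' : ℂ) *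
      meijerG 3 2 (sop₁Upper R E i k i') (sop₁Lower R E i i' k') (E.K₂ / (φ * R.K₂))

/-- `ζ = ρ_D / r_D + ρ_E' / r_E'`. -/
noncomputable def sopζ (D E' : OpticalLink) : ℝ := D.ρ / D.r + E'.ρ / E'.r

/-- Upper row of the G-function in `SOP₂`: `1 - ζ - k / r_D` for `k < r_D`, then
`1 - ρ_E' / r_E'`. -/
noncomputable def sop₂Upper (D E' : OpticalLink) : List ℝ :=
  (List.range D.r).map (fun k : ℕ => 1 - sopζ D E' - (k : ℝ) / D.r) ++ [1 - E'.ρ / E'.r]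

/-- Lower row of the G-function in `SOP₂`: `k / r_E'` for `k < r_E'`, then `-ρ_E' / r_E'`. -/
noncomputable def sop₂Lower (E' : OpticalLink) : List ℝ :=
  (List.range E'.r).map (fun k : ℕ => (k : ℝ) / E'.r) ++ [-(E'.ρ / E'.r)]

/-- The argument of the G-function in `SOP₂`. -/
noncomputable def sop₂Arg (φ : ℝ) (D E' : OpticalLink) : ℝ :=
  E'.Υ₂ ^ E'.r * ((E'.r : ℝ) ^ E'.r)⁻¹ / (φ * D.Υ₄)

/-- The closed form of `SOP₂`. -/
noncomputable def sop₂Closed (φ : ℝ) (D E' : OpticalLink) : ℂ :=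
  1 - ((D.Υ₃ * φ ^ (D.ρ / D.r) * E'.Υ₁ *
      (Real.sqrt E'.r * (φ * D.Υ₄) ^ (-sopζ D E') / (2 * Real.pi) ^ (((E'.r : ℝ) - 1) / 2)) : ℝ) :
      ℂ) *
    meijerG (E'.r + 1) D.r (sop₂Upper D E') (sop₂Lower E') (sop₂Arg φ D E')

/-! For independent positive `X`, `Y`, the integral of `F_X(φ y)` against the law of `Y` is the
measure of the event `X / (φ Y) ≤ 1`. Mellin inversion writes this measure as the integral of
`φ^(-s) E[X^s] E[Y^(-s)] / (-s)` along a line `Re s = c < 0` (`measureReal_le_one_eq_mellin`,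
`integral_measureReal_Iic_eq_mellin`). Both closed forms follow once the complex moments are known.
Total mass one plays no role there, which matters because the approximate RF laws are not
normalised.

RF links: replacing the Bessel function by a polynomial turns the power density into a finite
combination of Gamma densities, and the distance contributes simple fractions. The moments are then
sums of `Γ(Lμ + k + s) / (Ψ_i - s)` up to a scale. Writing `1 / w = Γ(w) / Γ(w + 1)`, every term of
the product of two such moments is a Meijer integrand (`meijerIntegrand_rf`). Optical links: the
moment is `Γ(ρ + r s) / Γ(ρ)` up to a scale. Gauss' multiplication formula and the shift of `s` by
`ρ_E / r_E` give the second G-function (`meijerIntegrand_sop₂`).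

The G-functions do not depend on the line, and no contour is ever moved: along each separating line
the integral equals one and the same integral of a distribution function. For a single RF term,
whose coefficient may be negative, the auxiliary laws `gammaRatioLaw` supply that integral. Absolute
convergence holds because Gamma is bounded on vertical lines in the right half plane, while two
simple fractions give decay of order `1 / t²` (`integrable_Gamma_mul_Gamma_line`).

For the exact model, a moment generating function computation and analytic continuation show that a
sum of `L` independent `κ-μ` powers is again a `κ-μ` power up to the factor `L`
(`map_sum_sq_kmEnvelopeLaw`). The exact and approximate SNR laws then differ only in the Bessel
function. The coefficient `V(k, p, v)` is the exact Bessel coefficient times a number in `[0, 1]`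
tending to `1`. Hence the approximate law is dominated by the exact one, its mass tends to `1`, and
all probabilities converge (`kmPowerApprox_le`, `tendsto_hopSOP_snrApprox`). -/

/-! ### Mellin inversion for distribution functions of ratios -/

theorem integrableOn_Ioc_cpow_sub_one {a : ℝ} (ha : 0 < a) {w : ℂ} (hw : 0 < w.re) :
    IntegrableOn (fun x : ℝ => (x : ℂ) ^ (w - 1)) (Set.Ioc 0 a) := by
  rw [← intervalIntegrable_iff_integrableOn_Ioc_of_le ha.le]
  exact intervalIntegral.intervalIntegrable_cpow' (by simpa using hw)

theorem integral_Ioc_cpow_sub_one {a : ℝ} (ha : 0 < a) {w : ℂ} (hw : 0 < w.re) :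
    ∫ x in Set.Ioc 0 a, (x : ℂ) ^ (w - 1) = (a : ℂ) ^ w / w := by
  rw [← intervalIntegral.integral_of_le ha.le, integral_cpow (Or.inl (by simpa using hw))]
  have : w ≠ 0 := by rintro rfl; simp at hw
  simp [Complex.zero_cpow this]

/-- This is Mellin inversion at `z = 1` for `f(z) = P(z X ≤ 1)`. For `Re s < 0` the integral of
`z^(-s-1)` over `0 < z ≤ 1 / X` is `X^s / (-s)`, so by Fubini the Mellin transform of `f` at `-s` is
`E[X^s] / (-s)`. -/
theorem measureReal_le_one_eq_mellin {Ω : Type*} [MeasurableSpace Ω] {P : Measure Ω}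
    [IsFiniteMeasure P] {X : Ω → ℝ} (hX : Measurable X) (hpos : ∀ᵐ ω ∂P, 0 < X ω)
    (h1 : P {ω | X ω = 1} = 0) {c : ℝ} (hc : c < 0) (hint : Integrable (fun ω => X ω ^ c) P)
    (hv : Integrable fun t : ℝ =>
      (∫ ω, (X ω : ℂ) ^ ((c : ℂ) + t * Complex.I) ∂P) / (-((c : ℂ) + t * Complex.I))) :
    ((P.real {ω | X ω ≤ 1} : ℝ) : ℂ) = (1 / (2 * Real.pi) : ℂ) * ∫ t : ℝ,
      (∫ ω, (X ω : ℂ) ^ ((c : ℂ) + t * Complex.I) ∂P) / (-((c : ℂ) + t * Complex.I)) := by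
  set f : ℝ → ℂ := fun z => (P.real {ω | z * X ω ≤ 1} : ℂ) with hf
  set K : ℂ → ℝ → Ω → ℂ := fun s z ω => if z * X ω ≤ 1 then (z : ℂ) ^ (-s - 1) else 0 with hK
  have hKm (s : ℂ) : Measurable (fun p : ℝ × Ω => K s p.1 p.2) := by
    refine Measurable.ite ?_ (by fun_prop) measurable_const
    exact measurableSet_le (f := fun p : ℝ × Ω => p.1 * X p.2) (by fun_prop) measurable_const
  have hKind (s : ℂ) (ω : Ω) (hω : 0 < X ω) (z : ℝ) (hz : z ∈ Set.Ioi (0 : ℝ)) :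
      K s z ω = (Set.Ioc 0 (1 / X ω)).indicator (fun z : ℝ => (z : ℂ) ^ (-s - 1)) z := by
    have h : z * X ω ≤ 1 ↔ z ∈ Set.Ioc 0 (1 / X ω) := by
      rw [Set.mem_Ioc, le_div_iff₀ hω]; exact ⟨fun h => ⟨hz, h⟩, fun h => h.2⟩
    simp only [hK, Set.indicator, h]
  have hKint (s : ℂ) (hs : s.re < 0) (ω : Ω) (hω : 0 < X ω) :
      IntegrableOn (fun z => K s z ω) (Set.Ioi 0) := by
    rw [integrableOn_congr_fun (fun z hz => hKind s ω hω z hz) measurableSet_Ioi]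
    exact ((integrableOn_Ioc_cpow_sub_one (by positivity) (by simpa using hs)).integrable_indicator
      measurableSet_Ioc).integrableOn
  have hKval (s : ℂ) (hs : s.re < 0) (ω : Ω) (hω : 0 < X ω) :
      ∫ z in Set.Ioi 0, K s z ω = (X ω : ℂ) ^ s / (-s) := by
    rw [setIntegral_congr_fun measurableSet_Ioi (fun z hz => hKind s ω hω z hz),
      setIntegral_indicator measurableSet_Ioc, Set.inter_eq_right.2 Set.Ioc_subset_Ioi_self,
      integral_Ioc_cpow_sub_one (by positivity) (by simpa using hs)]
    rw [Complex.cpow_neg, one_div, Complex.ofReal_inv, Complex.inv_cpow, inv_inv]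
    rw [Complex.arg_ofReal_of_nonneg hω.le]; exact Real.pi_pos.ne
  have hKnorm (s : ℂ) (ω : Ω) (z : ℝ) (hz : z ∈ Set.Ioi (0 : ℝ)) : ((‖K s z ω‖ : ℝ) : ℂ) = K s.re z ω := by
    have hz : 0 < z := hz
    simp only [hK]
    split_ifs
    · rw [Complex.norm_cpow_eq_rpow_re_of_pos hz, Complex.ofReal_cpow hz.le]
      simp
    · simp
  -- Fubini's hypothesis: the norm of the kernel at `s` is the kernel at `Re s = c`, whose integral
  -- in `z` is `X^c / (-c)`, integrable by `hint`.
  have hprod (s : ℂ) (hs : s.re = c) :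
      Integrable (fun p : ℝ × Ω => K s p.1 p.2) ((volume.restrict (Set.Ioi 0)).prod P) := by
    rw [integrable_prod_iff' (hKm s).aestronglyMeasurable]
    refine ⟨?_, ?_⟩
    · filter_upwards [hpos] with ω hω using hKint s (hs ▸ hc) ω hω
    · refine (hint.div_const (-c)).congr ?_
      filter_upwards [hpos] with ω hω
      apply Complex.ofReal_injective
      rw [← integral_complex_ofReal, setIntegral_congr_fun measurableSet_Ioi (hKnorm s ω),
        hKval _ (by simpa [hs] using hc) ω hω, hs]
      push_cast
      rw [Complex.ofReal_cpow hω.le]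
  have hKf (s : ℂ) (z : ℝ) : ∫ ω, K s z ω ∂P = (z : ℂ) ^ (-s - 1) • f z := by
    have hm : MeasurableSet {ω | z * X ω ≤ 1} := measurableSet_le (by fun_prop) measurable_const
    have : (fun ω => K s z ω) = Set.indicator {ω | z * X ω ≤ 1} (fun _ => (z : ℂ) ^ (-s - 1)) := by
      ext ω; simp [hK, Set.indicator]
    rw [this, integral_indicator_const _ hm, hf]
    simp [mul_comm]
  have hmellin (s : ℂ) (hs : s.re = c) :
      mellin f (-s) = (∫ ω, (X ω : ℂ) ^ s ∂P) / (-s) := by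
    rw [mellin, ← integral_div]
    simp_rw [← hKf]
    rw [integral_integral_swap (hprod s hs)]
    refine integral_congr_ae ?_
    filter_upwards [hpos] with ω hω using hKval s (hs ▸ hc) ω hω
  have hconv : MellinConvergent f (-c : ℝ) := by
    have := (hprod (c : ℂ) (by simp)).integral_prod_left
    refine this.congr (ae_of_all _ fun z => ?_)
    simp [hKf]
  -- The Mellin variable is `-s`, so the line becomes `Re = -c` and is run through in the opposite
  -- direction. The substitution `t ↦ -t` at the end undoes this.
  have hs_eq (y : ℝ) : (((-c : ℝ) : ℂ) + y * Complex.I) = -((c : ℂ) + ((-y : ℝ) : ℂ) * Complex.I) := by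
    push_cast; ring
  have hmell (y : ℝ) : mellin f (((-c : ℝ) : ℂ) + y * Complex.I) =
      (∫ ω, (X ω : ℂ) ^ ((c : ℂ) + ((-y : ℝ) : ℂ) * Complex.I) ∂P) /
        (-((c : ℂ) + ((-y : ℝ) : ℂ) * Complex.I)) := by
    rw [hs_eq, hmellin _ (by simp)]
  have hvert : Complex.VerticalIntegrable (mellin f) (-c) := by
    rw [Complex.VerticalIntegrable]
    simp_rw [hmell]
    exact hv.comp_neg
  -- The indicator of `z X ≤ 1` jumps only at `z = 1 / X`, and at `z = 1` this concerns only the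
  -- null event `X = 1`. Dominated convergence does the rest.
  have hcont : ContinuousAt f 1 := by
    have hfi : f = fun z => ((∫ ω, Set.indicator {ω | z * X ω ≤ 1} (fun _ => (1 : ℝ)) ω ∂P : ℝ) : ℂ) := by
      ext z
      rw [integral_indicator_const _ (measurableSet_le (by fun_prop) measurable_const)]
      simp [hf]
    rw [hfi]
    refine Complex.continuous_ofReal.continuousAt.comp ?_
    refine continuousAt_of_dominated (bound := fun _ => 1) ?_ ?_ (integrable_const _) ?_
    · exact Filter.Eventually.of_forall fun z => (measurable_const.indicator
        (measurableSet_le (by fun_prop) measurable_const)).aestronglyMeasurable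
    · refine Filter.Eventually.of_forall fun z => ae_of_all _ fun ω => ?_
      refine (norm_indicator_le_norm_self _ _).trans (by simp)
    · have h1' : ∀ᵐ ω ∂P, X ω ≠ 1 := by rw [ae_iff]; simpa using h1
      filter_upwards [h1'] with ω hω
      have hlim : Filter.Tendsto (fun z : ℝ => z * X ω) (nhds 1) (nhds (X ω)) := by
        have : Continuous fun z : ℝ => z * X ω := by fun_prop
        simpa using this.tendsto 1
      rcases lt_or_gt_of_ne hω with h | h
      · refine (continuousAt_const (y := (1 : ℝ))).congr ?_
        filter_upwards [hlim.eventually_lt_const h] with z hz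
        simp [Set.indicator, hz.le]
      · refine (continuousAt_const (y := (0 : ℝ))).congr ?_
        filter_upwards [hlim.eventually_const_lt h] with z hz
        simp [Set.indicator, hz]
  have key := mellinInv_mellin_eq (-c) f one_pos hconv hvert hcont
  have hf1 : f 1 = (P.real {ω | X ω ≤ 1} : ℂ) := by simp [hf]
  rw [← hf1, ← key, mellinInv]
  simp_rw [hmell]
  rw [← integral_neg_eq_self]
  simp

/-- The moment `∫ x ^ s dμ` of complex order `s`. -/
noncomputable def complexMoment (μ : Measure ℝ) (s : ℂ) : ℂ := ∫ x, (x : ℂ) ^ s ∂μ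

theorem measurableSet_le_mul (φ : ℝ) : MeasurableSet {q : ℝ × ℝ | q.1 ≤ φ * q.2} :=
  measurableSet_le (by fun_prop) (by fun_prop)

theorem measurable_measureReal_Iic_mul (μ : Measure ℝ) [IsFiniteMeasure μ] (φ : ℝ) :
    Measurable fun y => μ.real (Set.Iic (φ * y)) := by
  have : Monotone fun x => μ.real (Set.Iic x) := fun x y h =>
    measureReal_mono (Set.Iic_subset_Iic.2 h)
  exact this.measurable.comp (by fun_prop)

theorem integrable_measureReal_Iic_mul (μ ν : Measure ℝ) [IsFiniteMeasure μ] [IsFiniteMeasure ν]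
    (φ : ℝ) : Integrable (fun y => μ.real (Set.Iic (φ * y))) ν := by
  refine Integrable.of_bound (measurable_measureReal_Iic_mul μ φ).aestronglyMeasurable
    (μ.real Set.univ) (ae_of_all _ fun y => ?_)
  rw [Real.norm_of_nonneg measureReal_nonneg]
  exact measureReal_mono (Set.subset_univ _)

theorem integral_measureReal_Iic_mul (μ ν : Measure ℝ) [IsFiniteMeasure μ] [IsFiniteMeasure ν]
    (φ : ℝ) : ∫ y, μ.real (Set.Iic (φ * y)) ∂ν = (μ.prod ν).real {q | q.1 ≤ φ * q.2} := by
  rw [measureReal_def, Measure.prod_apply_symm (measurableSet_le_mul φ)]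
  have h : ∀ y : ℝ, (fun x : ℝ => (x, y)) ⁻¹' {q : ℝ × ℝ | q.1 ≤ φ * q.2} = Set.Iic (φ * y) :=
    fun y => rfl
  simp_rw [h]
  rw [integral_eq_lintegral_of_nonneg_ae (ae_of_all _ fun _ => measureReal_nonneg)
    (measurable_measureReal_Iic_mul μ φ).aestronglyMeasurable]
  simp [measureReal_def]

theorem ae_pos_prod {μ ν : Measure ℝ} [SFinite μ] [SFinite ν] (hμ : ∀ᵐ x ∂μ, 0 < x)
    (hν : ∀ᵐ x ∂ν, 0 < x) : ∀ᵐ q : ℝ × ℝ ∂μ.prod ν, 0 < q.1 ∧ 0 < q.2 :=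
  (Measure.quasiMeasurePreserving_fst.ae hμ).and (Measure.quasiMeasurePreserving_snd.ae hν)

/-- Inversion is applied to `x / (φ y)` on the product measure, where independence factors the
moment. Absence of atoms in `μ` makes the boundary event `x = φ y` null. -/
theorem integral_measureReal_Iic_eq_mellin {μ ν : Measure ℝ} [IsFiniteMeasure μ] [IsFiniteMeasure ν]
    (hμ : ∀ᵐ x ∂μ, 0 < x) (hν : ∀ᵐ x ∂ν, 0 < x) (hatom : ∀ a, 0 < a → μ {a} = 0)
    {φ c : ℝ} (hφ : 0 < φ) (hc : c < 0) (hμc : Integrable (fun x => x ^ c) μ)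
    (hνc : Integrable (fun x => x ^ (-c)) ν)
    (hv : Integrable fun t : ℝ => (φ : ℂ) ^ (-((c : ℂ) + t * Complex.I)) *
      (complexMoment μ ((c : ℂ) + t * Complex.I) * complexMoment ν (-((c : ℂ) + t * Complex.I))) /
        (-((c : ℂ) + t * Complex.I))) :
    ((∫ y, μ.real (Set.Iic (φ * y)) ∂ν : ℝ) : ℂ) = (1 / (2 * Real.pi) : ℂ) * ∫ t : ℝ,
      (φ : ℂ) ^ (-((c : ℂ) + t * Complex.I)) *
      (complexMoment μ ((c : ℂ) + t * Complex.I) * complexMoment ν (-((c : ℂ) + t * Complex.I))) /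
        (-((c : ℂ) + t * Complex.I)) := by
  have hpos := ae_pos_prod hμ hν
  have hmom (s : ℂ) : ∫ q : ℝ × ℝ, ((q.1 / (φ * q.2) : ℝ) : ℂ) ^ s ∂μ.prod ν =
      (φ : ℂ) ^ (-s) * (complexMoment μ s * complexMoment ν (-s)) := by
    rw [complexMoment, complexMoment, ← integral_prod_mul, ← integral_const_mul]
    refine integral_congr_ae ?_
    filter_upwards [hpos] with q hq
    have hinv : ∀ r : ℝ, 0 < r → ((r : ℂ)⁻¹) ^ s = (r : ℂ) ^ (-s) := fun r hr => by
      rw [Complex.cpow_neg, Complex.inv_cpow]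
      rw [Complex.arg_ofReal_of_nonneg hr.le]; exact Real.pi_pos.ne
    rw [div_eq_mul_inv, mul_inv, Complex.ofReal_mul,
      Complex.mul_cpow_ofReal_nonneg hq.1.le (by have := hq.2; positivity), Complex.ofReal_mul,
      Complex.mul_cpow_ofReal_nonneg (by positivity) (by have := hq.2; positivity),
      Complex.ofReal_inv, Complex.ofReal_inv, hinv _ hφ, hinv _ hq.2]
    ring
  have key := measureReal_le_one_eq_mellin (P := μ.prod ν) (X := fun q => q.1 / (φ * q.2))
    (by fun_prop) (by filter_upwards [hpos] with q hq using div_pos hq.1 (mul_pos hφ hq.2)) ?_ hc ?_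
    (by simpa only [hmom] using hv)
  · rw [integral_measureReal_Iic_mul]
    simp only [hmom] at key
    rw [← key]
    congr 1
    refine measureReal_congr ?_
    filter_upwards [hpos] with q hq
    have : (q.1 ≤ φ * q.2) = (q.1 / (φ * q.2) ≤ 1) := by
      rw [div_le_one (mul_pos hφ hq.2)]
    exact this
  · rw [Measure.prod_apply_symm (measurableSet_eq_fun (by fun_prop) measurable_const)]
    refine (lintegral_congr_ae (g := fun _ => 0) ?_).trans (by simp)
    filter_upwards [hν] with y hy
    refine measure_mono_null (fun x hx => ?_) (hatom (φ * y) (mul_pos hφ hy))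
    exact (div_eq_one_iff_eq (mul_pos hφ hy).ne').1 hx
  · refine ((hμc.mul_prod hνc).const_mul (φ ^ (-c))).congr ?_
    filter_upwards [hpos] with q hq
    rw [Real.div_rpow hq.1.le (by have := hq.2; positivity), Real.mul_rpow hφ.le hq.2.le,
      Real.rpow_neg hφ.le, Real.rpow_neg hq.2.le, div_eq_mul_inv, mul_inv]
    ring

/-! ### Absolute convergence along vertical lines -/

theorem integrable_inv_sq_add_sq {c : ℝ} (hc : c ≠ 0) :
    Integrable fun t : ℝ => (c ^ 2 + t ^ 2)⁻¹ := by
  refine ((integrable_inv_one_add_sq.comp_div hc).const_mul (c ^ 2)⁻¹).congr (ae_of_all _ fun t => ?_)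
  beta_reduce
  rw [← mul_inv]
  congr 1
  field_simp

theorem norm_Gamma_le_Gamma_re {s : ℂ} (hs : 0 < s.re) : ‖Complex.Gamma s‖ ≤ Real.Gamma s.re := by
  rw [Complex.Gamma_eq_integral hs, Real.Gamma_eq_integral hs, Complex.GammaIntegral]
  refine (norm_integral_le_integral_norm _).trans_eq
    (setIntegral_congr_fun measurableSet_Ioi fun x hx => ?_)
  rw [norm_mul, Complex.norm_cpow_eq_rpow_re_of_pos hx, Complex.norm_real,
    Real.norm_of_nonneg (Real.exp_pos _).le]
  simp

theorem continuous_Gamma_comp {f : ℝ → ℂ} (hf : Continuous f) (h : ∀ t, 0 < (f t).re) :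
    Continuous fun t => Complex.Gamma (f t) := by
  refine continuous_iff_continuousAt.2 fun t => ContinuousAt.comp ?_ hf.continuousAt
  refine Complex.continuousAt_Gamma _ fun m hm => ?_
  have := h t
  rw [hm] at this
  simp at this
  linarith [(Nat.cast_nonneg m : (0 : ℝ) ≤ m)]

theorem norm_inv_le_of_re_ne_zero {w : ℂ} {δ : ℝ} (h : w.re = δ) (hδ : δ ≠ 0) :
    ‖w⁻¹‖ ≤ |δ|⁻¹ := by
  rw [norm_inv]
  exact inv_anti₀ (abs_pos.2 hδ) (h ▸ Complex.abs_re_le_norm w)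

theorem continuous_inv_of_re_ne_zero {f : ℝ → ℂ} (hf : Continuous f) {δ : ℝ} (hδ : δ ≠ 0)
    (h : ∀ t, (f t).re = δ) : Continuous fun t => (f t)⁻¹ :=
  hf.inv₀ fun t h0 => hδ (by rw [← h t, h0]; simp)

/-- Both Gamma factors, the inverse of `d - s` and the power of `z` are bounded on the line; the
last two inverses provide the decay. The slopes `m`, `n` are `1` for RF links and the detection
types `r` for optical links. -/
theorem integrable_Gamma_mul_Gamma_line {a b d e m n z c : ℝ} (hz : 0 < z) (ha : 0 < a + m * c)
    (hb : 0 < b - n * c) (hc : c ≠ 0) (hd : d - c ≠ 0) (he : e + c ≠ 0) :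
    Integrable fun t : ℝ =>
      Complex.Gamma (a + m * ((c : ℂ) + t * Complex.I)) *
      Complex.Gamma (b - n * ((c : ℂ) + t * Complex.I)) *
      (d - ((c : ℂ) + t * Complex.I))⁻¹ * (z : ℂ) ^ ((c : ℂ) + t * Complex.I) *
      ((-((c : ℂ) + t * Complex.I))⁻¹ * (e + ((c : ℂ) + t * Complex.I))⁻¹) := by
  have hz' : (z : ℂ) ≠ 0 := by exact_mod_cast hz.ne'
  have hre1 (t : ℝ) : ((a : ℂ) + m * ((c : ℂ) + t * Complex.I)).re = a + m * c := by simp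
  have hre2 (t : ℝ) : ((b : ℂ) - n * ((c : ℂ) + t * Complex.I)).re = b - n * c := by simp
  have hre3 (t : ℝ) : ((d : ℂ) - ((c : ℂ) + t * Complex.I)).re = d - c := by simp
  have hre4 (t : ℝ) : (-((c : ℂ) + t * Complex.I)).re = -c := by simp
  have hre5 (t : ℝ) : ((e : ℂ) + ((c : ℂ) + t * Complex.I)).re = e + c := by simp
  have hc1 := continuous_Gamma_comp (f := fun t : ℝ => (a : ℂ) + m * ((c : ℂ) + t * Complex.I))
    (by fun_prop) (fun t => by rw [hre1]; exact ha)
  have hc2 := continuous_Gamma_comp (f := fun t : ℝ => (b : ℂ) - n * ((c : ℂ) + t * Complex.I))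
    (by fun_prop) (fun t => by rw [hre2]; exact hb)
  have hc3 := continuous_inv_of_re_ne_zero (f := fun t : ℝ => (d : ℂ) - ((c : ℂ) + t * Complex.I))
    (by fun_prop) hd hre3
  have hc4 := continuous_inv_of_re_ne_zero (f := fun t : ℝ => -((c : ℂ) + t * Complex.I))
    (by fun_prop) (neg_ne_zero.2 hc) hre4
  have hc5 := continuous_inv_of_re_ne_zero (f := fun t : ℝ => (e : ℂ) + ((c : ℂ) + t * Complex.I))
    (by fun_prop) he hre5
  have hc6 : Continuous fun t : ℝ => (z : ℂ) ^ ((c : ℂ) + t * Complex.I) :=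
    Continuous.const_cpow (by fun_prop) (Or.inl hz')
  refine Integrable.bdd_mul (c := Real.Gamma (a + m * c) * Real.Gamma (b - n * c) * |d - c|⁻¹ * z ^ c)
    ?_ (((hc1.mul hc2).mul hc3).mul hc6).aestronglyMeasurable (ae_of_all _ fun t => ?_)
  -- The bound is `|u v| ≤ (|u|² + |v|²) / 2` for the two inverse factors.
  · refine Integrable.mono' (g := fun t => (((-c) ^ 2 + t ^ 2)⁻¹ + ((e + c) ^ 2 + t ^ 2)⁻¹) / 2)
      (((integrable_inv_sq_add_sq (neg_ne_zero.2 hc)).add (integrable_inv_sq_add_sq he)).div_const 2)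
      (hc4.mul hc5).aestronglyMeasurable (ae_of_all _ fun t => ?_)
    have hsq (w : ℂ) : (w.re ^ 2 + w.im ^ 2)⁻¹ = ‖w⁻¹‖ ^ 2 := by
      rw [norm_inv, inv_pow, Complex.sq_norm, Complex.normSq_apply]; ring_nf
    have e4 := hsq (-((c : ℂ) + t * Complex.I))
    have e5 := hsq ((e : ℂ) + ((c : ℂ) + t * Complex.I))
    rw [hre4, show (-((c : ℂ) + t * Complex.I)).im ^ 2 = t ^ 2 by simp] at e4
    rw [hre5, show ((e : ℂ) + ((c : ℂ) + t * Complex.I)).im ^ 2 = t ^ 2 by simp] at e5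
    rw [e4, e5, norm_mul]
    nlinarith [sq_nonneg (‖(-((c : ℂ) + t * Complex.I))⁻¹‖ - ‖((e : ℂ) + ((c : ℂ) + t * Complex.I))⁻¹‖)]
  · rw [norm_mul, norm_mul, norm_mul]
    have g1 := norm_Gamma_le_Gamma_re (s := (a : ℂ) + m * ((c : ℂ) + t * Complex.I)) (by rw [hre1]; exact ha)
    have g2 := norm_Gamma_le_Gamma_re (s := (b : ℂ) - n * ((c : ℂ) + t * Complex.I)) (by rw [hre2]; exact hb)
    rw [hre1] at g1
    rw [hre2] at g2
    have g3 := norm_inv_le_of_re_ne_zero (hre3 t) hd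
    have g6 : ‖(z : ℂ) ^ ((c : ℂ) + t * Complex.I)‖ = z ^ c := by
      rw [Complex.norm_cpow_eq_rpow_re_of_pos hz]; simp
    rw [g6]
    gcongr

/-- The moment of complex order `s` of `μ` converges absolutely, to `v`. -/
def HasComplexMoment (μ : Measure ℝ) (s v : ℂ) : Prop :=
  Integrable (fun x : ℝ => (x : ℂ) ^ s) μ ∧ complexMoment μ s = v

/-! ### Complex moments of measures given by densities -/

theorem integrable_withDensity_ofReal_iff {α : Type*} [MeasurableSpace α] {μ : Measure α}
    {g : α → ℝ} (hg : Measurable g) (hg0 : ∀ᵐ x ∂μ, 0 ≤ g x) {f : α → ℂ} :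
    Integrable f (μ.withDensity fun x => ENNReal.ofReal (g x)) ↔
      Integrable (fun x => (g x : ℂ) * f x) μ := by
  rw [integrable_withDensity_iff_integrable_smul' hg.ennreal_ofReal (by simp)]
  refine integrable_congr ?_
  filter_upwards [hg0] with x hx
  simp [ENNReal.toReal_ofReal hx]

theorem integral_withDensity_ofReal {α : Type*} [MeasurableSpace α] {μ : Measure α}
    {g : α → ℝ} (hg : Measurable g) (hg0 : ∀ᵐ x ∂μ, 0 ≤ g x) (f : α → ℂ) :
    ∫ x, f x ∂(μ.withDensity fun x => ENNReal.ofReal (g x)) = ∫ x, (g x : ℂ) * f x ∂μ := by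
  rw [integral_withDensity_eq_integral_toReal_smul hg.ennreal_ofReal (by simp)]
  refine integral_congr_ae ?_
  filter_upwards [hg0] with x hx
  simp [ENNReal.toReal_ofReal hx]

/-- Nonnegativity is demanded of the whole sum only, because the random waypoint density has a
negative coefficient. -/
theorem hasComplexMoment_withDensity_sum {S : Set ℝ} (hS : MeasurableSet S) {ι : Type*}
    (F : Finset ι) (a : ι → ℝ) (h : ι → ℝ → ℝ) (v : ι → ℂ) {s : ℂ} (hm : ∀ i, Measurable (h i))
    (hnn : ∀ x ∈ S, 0 ≤ ∑ i ∈ F, a i * h i x)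
    (hint : ∀ i ∈ F, IntegrableOn (fun x : ℝ => (h i x : ℂ) * (x : ℂ) ^ s) S)
    (hval : ∀ i ∈ F, ∫ x in S, (h i x : ℂ) * (x : ℂ) ^ s = v i) :
    HasComplexMoment ((volume.restrict S).withDensity fun x =>
      ENNReal.ofReal (∑ i ∈ F, a i * h i x)) s (∑ i ∈ F, a i * v i) := by
  have hmeas : Measurable fun x => ∑ i ∈ F, a i * h i x :=
    Finset.measurable_sum _ fun i _ => (hm i).const_mul _
  have h0 : ∀ᵐ x ∂volume.restrict S, 0 ≤ ∑ i ∈ F, a i * h i x := by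
    filter_upwards [ae_restrict_mem hS] with x hx using hnn x hx
  have heq : (fun x : ℝ => ((∑ i ∈ F, a i * h i x : ℝ) : ℂ) * (x : ℂ) ^ s) =
      fun x : ℝ => ∑ i ∈ F, (a i : ℂ) * ((h i x : ℂ) * (x : ℂ) ^ s) := by
    ext x
    push_cast
    rw [Finset.sum_mul]
    simp_rw [mul_assoc]
  refine ⟨?_, ?_⟩
  · rw [integrable_withDensity_ofReal_iff hmeas h0, heq]
    exact integrable_finsetSum _ fun i hi => (hint i hi).const_mul _
  · rw [complexMoment, integral_withDensity_ofReal hmeas h0, heq,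
      integral_finsetSum _ fun i hi => (hint i hi).const_mul _]
    refine Finset.sum_congr rfl fun i hi => ?_
    rw [integral_const_mul, hval i hi]

theorem ofReal_rpow_mul_cpow {x : ℝ} (hx : 0 < x) (e : ℝ) (s : ℂ) :
    ((x ^ e : ℝ) : ℂ) * (x : ℂ) ^ s = (x : ℂ) ^ ((e : ℂ) + s) := by
  rw [Complex.cpow_add _ _ (by exact_mod_cast hx.ne'), Complex.ofReal_cpow hx.le]

theorem integrableOn_cpow_mul_exp_neg_mul_Ioi {w : ℂ} {b : ℝ} (hw : 0 < w.re) (hb : 0 < b) :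
    IntegrableOn (fun x : ℝ => (x : ℂ) ^ (w - 1) * Complex.exp (-(b * x))) (Set.Ioi 0) := by
  -- A non-integrable function has integral `0` by convention, so a known nonzero value forces
  -- integrability.
  refine not_imp_comm.1 integral_undef ?_
  rw [Complex.integral_cpow_mul_exp_neg_mul_Ioi hw (by simpa using hb)]
  refine mul_ne_zero ?_ (Complex.Gamma_ne_zero_of_re_pos hw)
  rw [Complex.cpow_def_of_ne_zero (by simpa using hb.ne')]
  exact Complex.exp_ne_zero _

theorem integrableOn_rpow_mul_exp_neg_mul_mul_cpow {e b : ℝ} {s : ℂ} (he : 0 < e + s.re)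
    (hb : 0 < b) : IntegrableOn (fun x : ℝ =>
      ((x ^ (e - 1) * Real.exp (-(b * x)) : ℝ) : ℂ) * (x : ℂ) ^ s) (Set.Ioi 0) := by
  refine (integrableOn_cpow_mul_exp_neg_mul_Ioi (w := e + s) (by simpa using he) hb).congr_fun
    (fun x hx => ?_) measurableSet_Ioi
  beta_reduce
  rw [show (e + s - 1 : ℂ) = ((e - 1 : ℝ) : ℂ) + s by push_cast; ring, ← ofReal_rpow_mul_cpow hx]
  push_cast
  ring

theorem integral_rpow_mul_exp_neg_mul_mul_cpow {e b : ℝ} {s : ℂ} (he : 0 < e + s.re)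
    (hb : 0 < b) : ∫ x in Set.Ioi (0 : ℝ),
      ((x ^ (e - 1) * Real.exp (-(b * x)) : ℝ) : ℂ) * (x : ℂ) ^ s =
      (b : ℂ) ^ (-((e : ℂ) + s)) * Complex.Gamma (e + s) := by
  have := Complex.integral_cpow_mul_exp_neg_mul_Ioi (a := e + s) (r := b) (by simpa using he)
    (by simpa using hb)
  rw [one_div, Complex.inv_cpow _ _ (by rw [Complex.arg_ofReal_of_nonneg hb.le]; exact Real.pi_pos.ne),
    ← Complex.cpow_neg] at this
  rw [← this]
  refine setIntegral_congr_fun measurableSet_Ioi fun x hx => ?_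
  rw [show (e + s - 1 : ℂ) = ((e - 1 : ℝ) : ℂ) + s by push_cast; ring, ← ofReal_rpow_mul_cpow hx]
  push_cast
  ring

theorem ae_pos_withDensity_Ioi (g : ℝ → ENNReal) :
    ∀ᵐ x ∂((volume.restrict (Set.Ioi 0)).withDensity g), 0 < x :=
  (withDensity_absolutelyContinuous _ _).ae_le (ae_restrict_mem measurableSet_Ioi)

/-! ### Random waypoint distance -/

/-- With `u = (q / D)²`, the polynomial `735 - 1190 u + 455 u²` factors as `(1 - u)(735 - 455 u)`,
and both factors are nonnegative for `u ≤ 1`. -/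
theorem rwp_density_nonneg {D q : ℝ} (hD : 0 < D) (hq : q ∈ Set.Ioc 0 D) :
    0 ≤ ∑ i, rwpC i / D ^ (rwpβ i + 1) * q ^ rwpβ i := by
  obtain ⟨hq0, hqD⟩ := hq
  have hu : (q / D) ^ 2 ≤ 1 := by
    rw [sq_le_one_iff_abs_le_one, abs_of_pos (by positivity)]
    exact (div_le_one hD).2 hqD
  have e : ∑ i, rwpC i / D ^ (rwpβ i + 1) * q ^ rwpβ i =
      (q / D) ^ 2 / (72 * D) * ((1 - (q / D) ^ 2) * (735 - 455 * (q / D) ^ 2)) := by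
    simp only [Fin.sum_univ_three, rwpC, rwpβ, Matrix.cons_val_zero, Matrix.cons_val_one,
      Matrix.cons_val]
    norm_num only
    rw [show (3 : ℝ) = (3 : ℕ) by norm_num, show (5 : ℝ) = (5 : ℕ) by norm_num,
      show (7 : ℝ) = (7 : ℕ) by norm_num, show (2 : ℝ) = (2 : ℕ) by norm_num,
      show (4 : ℝ) = (4 : ℕ) by norm_num, show (6 : ℝ) = (6 : ℕ) by norm_num]
    simp only [Real.rpow_natCast]
    field_simp
    ring
  rw [e]
  have : 0 ≤ 1 - (q / D) ^ 2 := by linarith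
  have : 0 ≤ 735 - 455 * (q / D) ^ 2 := by linarith
  positivity

theorem rwpβ_ge (i : Fin 3) : 2 ≤ rwpβ i := by
  fin_cases i <;> norm_num [rwpβ]

theorem rwpLaw_eq (D : ℝ) : rwpLaw D = (volume.restrict (Set.Ioc 0 D)).withDensity fun q =>
    ENNReal.ofReal (∑ i, rwpC i / D ^ (rwpβ i + 1) * q ^ rwpβ i) := by
  rw [rwpLaw, Measure.restrict_congr_set Ioc_ae_eq_Icc]

theorem ae_pos_rwpLaw (D : ℝ) : ∀ᵐ q ∂rwpLaw D, 0 < q := by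
  rw [rwpLaw_eq]
  refine (withDensity_absolutelyContinuous _ _).ae_le ?_
  filter_upwards [ae_restrict_mem measurableSet_Ioc] with q hq using hq.1

theorem integrableOn_rpow_mul_cpow {D e : ℝ} (hD : 0 < D) {s : ℂ} (he : 0 < e + 1 + s.re) :
    IntegrableOn (fun x : ℝ => ((x ^ e : ℝ) : ℂ) * (x : ℂ) ^ s) (Set.Ioc 0 D) := by
  refine (integrableOn_Ioc_cpow_sub_one hD (w := e + 1 + s) (by simpa using he)).congr_fun
    (fun x hx => ?_) measurableSet_Ioc
  beta_reduce
  rw [ofReal_rpow_mul_cpow hx.1]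
  congr 1
  ring

theorem integral_rpow_mul_cpow {D e : ℝ} (hD : 0 < D) {s : ℂ} (he : 0 < e + 1 + s.re) :
    ∫ x in Set.Ioc 0 D, ((x ^ e : ℝ) : ℂ) * (x : ℂ) ^ s = (D : ℂ) ^ (e + 1 + s) / (e + 1 + s) := by
  rw [← integral_Ioc_cpow_sub_one hD (by simpa using he)]
  refine setIntegral_congr_fun measurableSet_Ioc fun x hx => ?_
  rw [ofReal_rpow_mul_cpow hx.1]
  congr 1
  ring

/-- The bound `-3` is `-(β_i + 1)` for the smallest exponent `β_i = 2`. -/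
theorem hasComplexMoment_rwpLaw {D : ℝ} (hD : 0 < D) {s : ℂ} (hs : -3 < s.re) :
    HasComplexMoment (rwpLaw D) s (∑ i, rwpC i * ((D : ℂ) ^ s / (rwpβ i + 1 + s))) := by
  rw [rwpLaw_eq]
  have hre (i : Fin 3) : 0 < rwpβ i + 1 + s.re := by linarith [rwpβ_ge i]
  convert hasComplexMoment_withDensity_sum (s := s) measurableSet_Ioc Finset.univ
    (fun i => rwpC i / D ^ (rwpβ i + 1)) (fun i q => q ^ rwpβ i)
    (fun i => (D : ℂ) ^ (rwpβ i + 1 + s) / (rwpβ i + 1 + s)) (fun i => by fun_prop)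
    (fun q hq => rwp_density_nonneg hD hq)
    (fun i _ => integrableOn_rpow_mul_cpow hD (hre i))
    (fun i _ => integral_rpow_mul_cpow hD (hre i)) using 1
  refine Finset.sum_congr rfl fun i _ => ?_
  have hp : ((D ^ (rwpβ i + 1) : ℝ) : ℂ) ≠ 0 := by
    exact_mod_cast (Real.rpow_pos_of_pos hD _).ne'
  have := ofReal_rpow_mul_cpow hD (rwpβ i + 1) s
  push_cast at this hp ⊢
  rw [← this]
  field_simp

theorem HasComplexMoment.measureReal_univ {μ : Measure ℝ} {v : ℂ} (h : HasComplexMoment μ 0 v) :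
    IsFiniteMeasure μ ∧ (μ.real Set.univ : ℂ) = v := by
  obtain ⟨h1, h2⟩ := h
  have hone : (fun x : ℝ => (x : ℂ) ^ (0 : ℂ)) = fun _ => 1 := by ext; simp
  rw [hone] at h1
  refine ⟨(integrable_const_iff_isFiniteMeasure one_ne_zero).1 h1, ?_⟩
  rw [complexMoment, hone] at h2
  simpa using h2

theorem isProbabilityMeasure_rwpLaw {D : ℝ} (hD : 0 < D) : IsProbabilityMeasure (rwpLaw D) := by
  obtain ⟨h1, h2⟩ := (hasComplexMoment_rwpLaw hD (s := 0) (by simp)).measureReal_univ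
  have : (rwpLaw D).real Set.univ = 1 := by
    apply Complex.ofReal_injective
    rw [h2]
    simp only [Fin.sum_univ_three, rwpC, rwpβ, Matrix.cons_val_zero, Matrix.cons_val_one,
      Matrix.cons_val]
    norm_num
  constructor
  rw [← ENNReal.toReal_eq_one_iff]
  exact this

/-! ### The approximate `κ-μ` power -/

theorem kmB_pos {κ μ : ℝ} (hκ : 0 < κ) (hμ : 0 < μ) : 0 < kmB κ μ := by
  unfold kmB; positivity

theorem kmM_pos {κ μ : ℝ} (hκ : 0 < κ) (hμ : 0 < μ) : 0 < kmM κ μ := by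
  unfold kmM; positivity

/-- The mass `e^{-μκ} (μκ) ^ k` times the power `B ^ (μ + k)` of the rate. -/
noncomputable def kmCoeff (κ μ : ℝ) (k : ℕ) : ℝ :=
  Real.exp (-(μ * κ)) * (μ * κ) ^ k * kmB κ μ ^ (μ + k)

theorem kmCoeff_pos {κ μ : ℝ} (hκ : 0 < κ) (hμ : 0 < μ) (k : ℕ) : 0 < kmCoeff κ μ k := by
  have := kmB_pos hκ hμ
  unfold kmCoeff; positivity

theorem kmA_mul_kmM_rpow {κ μ : ℝ} (hκ : 0 < κ) (hμ : 0 < μ) (k : ℕ) :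
    kmA κ μ / 2 * (kmM κ μ / 2) ^ (μ - 1 + 2 * k) = kmCoeff κ μ k := by
  have hM : kmM κ μ / 2 = μ * Real.sqrt (κ * (1 + κ)) := by unfold kmM; ring
  have hA : kmA κ μ / 2 =
      μ * (1 + κ) ^ ((μ + 1) / 2) / (κ ^ ((μ - 1) / 2) * Real.exp (μ * κ)) := by
    unfold kmA; ring
  have h1 : 0 < 1 + κ := by linarith
  rw [hM, hA]
  unfold kmCoeff kmB
  -- Both sides are positive products of powers. After taking logarithms the identity is linear in
  -- `log μ`, `log κ` and `log (1 + κ)`.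
  refine Real.log_injOn_pos (Set.mem_Ioi.2 (by positivity)) (Set.mem_Ioi.2 (by positivity)) ?_
  have p1 : 0 < (1 + κ) ^ ((μ + 1) / 2) := by positivity
  have p2 : 0 < κ ^ ((μ - 1) / 2) := by positivity
  have p3 : 0 < Real.sqrt (κ * (1 + κ)) := by positivity
  rw [Real.log_mul (by positivity) (by positivity), Real.log_div (by positivity) (by positivity),
    Real.log_mul (by positivity) (by positivity), Real.log_mul (by positivity) (by positivity),
    Real.log_rpow h1, Real.log_rpow hκ, Real.log_exp, Real.log_rpow (by positivity),
    Real.log_mul (by positivity) (by positivity), Real.log_sqrt (by positivity),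
    Real.log_mul (by positivity) (by positivity), Real.log_mul (by positivity) (by positivity),
    Real.log_mul (by positivity) (by positivity), Real.log_exp, Real.log_pow,
    Real.log_rpow (by positivity), Real.log_mul (by positivity) (by positivity),
    Real.log_mul (by positivity) (by positivity)]
  ring

/-- The exponents of `w` add up to `(μ - 1)/2 + (μ - 1 + 2k)/2 = μ + k - 1`, so the `k`-th Bessel
term is a multiple of a Gamma density of shape `μ + k` and rate `B`. With the exact coefficients the
power is a Poisson mixture, of parameter `μ κ`, of these Gamma laws. -/
theorem kmPower_term {κ μ w : ℝ} (hκ : 0 < κ) (hμ : 0 < μ) (hw : 0 < w) (k : ℕ) :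
    kmA κ μ / 2 * w ^ ((μ - 1) / 2) * Real.exp (-(kmB κ μ * w)) *
      (kmM κ μ * Real.sqrt w / 2) ^ (μ - 1 + 2 * k) =
    kmCoeff κ μ k * (w ^ (μ + k - 1) * Real.exp (-(kmB κ μ * w))) := by
  rw [← kmA_mul_kmM_rpow hκ hμ, show kmM κ μ * Real.sqrt w / 2 = kmM κ μ / 2 * Real.sqrt w by ring,
    Real.mul_rpow (by have := kmM_pos hκ hμ; positivity) (by positivity), Real.sqrt_eq_rpow,
    ← Real.rpow_mul hw.le,
    show μ + k - 1 = (μ - 1) / 2 + 1 / 2 * (μ - 1 + 2 * k) by ring, Real.rpow_add hw]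
  ring

theorem besselV_nonneg {k p : ℕ} {v : ℝ} (hp : 1 ≤ p) (hk : k ≤ p) (hv : 0 < v + 1) :
    0 ≤ besselV k p v := by
  have hp' : (1 : ℝ) ≤ p := by exact_mod_cast hp
  have hk' : (k : ℝ) ≤ p := by exact_mod_cast hk
  have hk0 : (0 : ℝ) ≤ k := by positivity
  unfold besselV
  have h1 := Real.Gamma_pos_of_pos (s := (p : ℝ) + k) (by linarith)
  have h2 := Real.Gamma_pos_of_pos (s := (k : ℝ) + 1) (by linarith)
  have h3 := Real.Gamma_pos_of_pos (s := (p : ℝ) - k + 1) (by linarith)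
  have h4 := Real.Gamma_pos_of_pos (s := v + k + 1) (by linarith)
  positivity

theorem kmPowerApprox_eq (p : ℕ) {κ μ : ℝ} (hκ : 0 < κ) (hμ : 0 < μ) :
    kmPowerApprox p κ μ = (volume.restrict (Set.Ioi 0)).withDensity fun w =>
      ENNReal.ofReal (∑ k ∈ Finset.range (p + 1), (besselV k p (μ - 1) * kmCoeff κ μ k) *
        (w ^ (μ + k - 1) * Real.exp (-(kmB κ μ * w)))) := by
  rw [kmPowerApprox]
  refine withDensity_congr_ae ?_
  filter_upwards [ae_restrict_mem measurableSet_Ioi] with w hw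
  congr 1
  rw [besselIApprox, Finset.mul_sum]
  refine Finset.sum_congr rfl fun k _ => ?_
  rw [mul_assoc (besselV k p (μ - 1)), ← kmPower_term hκ hμ hw]
  ring

theorem hasComplexMoment_kmPowerApprox {p : ℕ} (hp : 1 ≤ p) {κ μ : ℝ} (hκ : 0 < κ) (hμ : 0 < μ)
    {s : ℂ} (hs : -μ < s.re) :
    HasComplexMoment (kmPowerApprox p κ μ) s (∑ k ∈ Finset.range (p + 1),
      ((besselV k p (μ - 1) * (Real.exp (-(μ * κ)) * (μ * κ) ^ k) : ℝ) : ℂ) *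
        ((kmB κ μ : ℂ) ^ (-s) * Complex.Gamma (μ + k + s))) := by
  rw [kmPowerApprox_eq p hκ hμ]
  have hB := kmB_pos hκ hμ
  have hre (k : ℕ) : 0 < μ + k + s.re := by
    have : (0 : ℝ) ≤ k := by positivity
    linarith
  convert hasComplexMoment_withDensity_sum (s := s) measurableSet_Ioi (Finset.range (p + 1))
    (fun k => besselV k p (μ - 1) * kmCoeff κ μ k)
    (fun k w => w ^ (μ + k - 1) * Real.exp (-(kmB κ μ * w)))
    (fun k => (kmB κ μ : ℂ) ^ (-(((μ + k : ℝ) : ℂ) + s)) * Complex.Gamma (((μ + k : ℝ) : ℂ) + s))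
    (fun k => by fun_prop) (fun w hw => ?_)
    (fun k _ => integrableOn_rpow_mul_exp_neg_mul_mul_cpow (hre k) hB)
    (fun k _ => integral_rpow_mul_exp_neg_mul_mul_cpow (hre k) hB) using 1
  · refine Finset.sum_congr rfl fun k _ => ?_
    have hp' : (((kmB κ μ) ^ (μ + k) : ℝ) : ℂ) ≠ 0 := by
      exact_mod_cast (Real.rpow_pos_of_pos hB _).ne'
    rw [neg_add, Complex.cpow_add _ _ (by exact_mod_cast hB.ne'), Complex.cpow_neg _ ((μ + k : ℝ) : ℂ),
      ← Complex.ofReal_cpow hB.le, kmCoeff]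
    push_cast at hp' ⊢
    field_simp
  · refine Finset.sum_nonneg fun k hk => ?_
    have h1 := besselV_nonneg (v := μ - 1) hp (Nat.lt_succ_iff.1 (Finset.mem_range.1 hk))
      (by linarith)
    have h2 := kmCoeff_pos hκ hμ k
    have hw : (0 : ℝ) < w := hw
    positivity

/-! ### Products of independent variables -/

theorem cpow_ofReal_cpow {x : ℝ} (hx : 0 < x) (e : ℝ) (s : ℂ) :
    ((x : ℂ) ^ (e : ℂ)) ^ s = (x : ℂ) ^ ((e : ℂ) * s) := by
  have him : (Complex.log (x : ℂ) * (e : ℂ)).im = 0 := by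
    rw [← Complex.ofReal_log hx.le, ← Complex.ofReal_mul, Complex.ofReal_im]
  exact (Complex.cpow_mul _ (by rw [him]; linarith [Real.pi_pos])
    (by rw [him]; exact Real.pi_pos.le)).symm

/-- By independence the moment of `w q^(-α)` is the product of the moment of `w` at `s` and that of
`q` at `-α s`. The constants `k₁`, `k₂` stay apart to match the shape of the SNR. -/
theorem hasComplexMoment_map_prod {ρ W : Measure ℝ} [SFinite ρ] [SFinite W]
    (hρ : ∀ᵐ q ∂ρ, 0 < q) (hW : ∀ᵐ w ∂W, 0 < w) {k₁ k₂ α : ℝ} (h₁ : 0 < k₁) (h₂ : 0 < k₂)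
    {s u v : ℂ} (hu : HasComplexMoment ρ (-α * s) u) (hv : HasComplexMoment W s v) :
    HasComplexMoment ((ρ.prod W).map fun x => k₁ * x.2 * x.1 ^ (-α) * k₂) s
      ((k₁ * k₂ : ℂ) ^ s * (u * v)) := by
  have hmeas : Measurable fun x : ℝ × ℝ => k₁ * x.2 * x.1 ^ (-α) * k₂ := by fun_prop
  have hcm : Measurable fun x : ℝ => (x : ℂ) ^ s := by fun_prop
  have heq : (fun x : ℝ × ℝ => (k₁ * k₂ : ℂ) ^ s * ((x.1 : ℂ) ^ (-α * s) * (x.2 : ℂ) ^ s))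
      =ᵐ[ρ.prod W] fun x => ((k₁ * x.2 * x.1 ^ (-α) * k₂ : ℝ) : ℂ) ^ s := by
    filter_upwards [ae_pos_prod hρ hW] with x hx
    obtain ⟨hx1, hx2⟩ := hx
    have hk : 0 ≤ k₁ * k₂ := by positivity
    rw [show k₁ * x.2 * x.1 ^ (-α) * k₂ = (k₁ * k₂) * (x.1 ^ (-α) * x.2) by ring,
      Complex.ofReal_mul (k₁ * k₂), Complex.mul_cpow_ofReal_nonneg hk (by positivity),
      Complex.ofReal_mul (x.1 ^ (-α)), Complex.mul_cpow_ofReal_nonneg (by positivity) hx2.le,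
      Complex.ofReal_cpow hx1.le, Complex.ofReal_mul]
    rw [cpow_ofReal_cpow hx1]
    push_cast
    rfl
  refine ⟨?_, ?_⟩
  · rw [integrable_map_measure hcm.aestronglyMeasurable hmeas.aemeasurable]
    exact ((hu.1.mul_prod hv.1).const_mul _).congr heq
  · rw [complexMoment, integral_map hmeas.aemeasurable hcm.aestronglyMeasurable,
      ← integral_congr_ae heq, integral_const_mul, integral_prod_mul (fun x : ℝ => (x : ℂ) ^ (-α * s))
      (fun x : ℝ => (x : ℂ) ^ s), ← hu.2, ← hv.2]
    rfl

theorem ae_pos_map_prod {ρ W : Measure ℝ} [SFinite ρ] [SFinite W]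
    (hρ : ∀ᵐ q ∂ρ, 0 < q) (hW : ∀ᵐ w ∂W, 0 < w) {k₁ k₂ α : ℝ} (h₁ : 0 < k₁) (h₂ : 0 < k₂) :
    ∀ᵐ x ∂((ρ.prod W).map fun x => k₁ * x.2 * x.1 ^ (-α) * k₂), 0 < x := by
  rw [ae_map_iff (by fun_prop) measurableSet_Ioi]
  filter_upwards [ae_pos_prod hρ hW] with x hx
  obtain ⟨hx1, hx2⟩ := hx
  positivity

theorem map_prod_singleton {ρ W : Measure ℝ} [SFinite ρ] [SFinite W]
    (hρ : ∀ᵐ q ∂ρ, 0 < q) (hW : ∀ a, W {a} = 0) {k₁ k₂ α : ℝ} (h₁ : 0 < k₁) (h₂ : 0 < k₂) (a : ℝ) :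
    ((ρ.prod W).map fun x => k₁ * x.2 * x.1 ^ (-α) * k₂) {a} = 0 := by
  rw [Measure.map_apply (by fun_prop) (measurableSet_singleton a),
    Measure.prod_apply (measurableSet_preimage (by fun_prop) (measurableSet_singleton a))]
  refine (lintegral_congr_ae (g := fun _ => 0) ?_).trans (by simp)
  filter_upwards [hρ] with q hq
  refine measure_mono_null (fun w hw => ?_) (hW (a / (k₁ * q ^ (-α) * k₂)))
  have hw : k₁ * w * q ^ (-α) * k₂ = a := hw
  have : 0 < q ^ (-α) := by positivity
  rw [Set.mem_singleton_iff, eq_div_iff (by positivity), ← hw]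
  ring

theorem withDensity_restrict_singleton (S : Set ℝ) (g : ℝ → ENNReal) (a : ℝ) :
    ((volume.restrict S).withDensity g) {a} = 0 :=
  withDensity_absolutelyContinuous _ _ (by simp)

instance sFinite_rwpLaw (D : ℝ) : SFinite (rwpLaw D) := by unfold rwpLaw; infer_instance

instance sFinite_kmPowerApprox (p : ℕ) (κ μ : ℝ) : SFinite (kmPowerApprox p κ μ) := by
  unfold kmPowerApprox; infer_instance

namespace RFLink

variable (j : RFLink)

theorem L_mul_μ_pos : 0 < j.L * j.μ := mul_pos (Nat.cast_pos.2 j.L_pos) j.μ_pos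

theorem L_mul_γbar_pos : 0 < j.L * j.γbar := mul_pos (Nat.cast_pos.2 j.L_pos) j.γbar_pos

theorem K₂_pos : 0 < j.K₂ := by
  have := kmB_pos j.κ_pos j.L_mul_μ_pos
  have h1 := j.D_pos
  have h2 := j.ϱ_pos
  have h3 := j.L_mul_γbar_pos
  unfold K₂
  rw [mul_assoc j.ϱ]
  positivity

theorem Ψ_pos (i : Fin 3) : 0 < j.Ψ i := by
  have := j.α_pos
  have := rwpβ_ge i
  unfold Ψ
  positivity

theorem Ψ_ge (i : Fin 3) : 3 / j.α ≤ j.Ψ i := by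
  have := j.α_pos
  have := rwpβ_ge i
  unfold Ψ
  rw [div_eq_mul_one_div, mul_comm]
  gcongr
  linarith

theorem ae_pos_snrApprox (p : ℕ) : ∀ᵐ x ∂j.snrApprox p, 0 < x :=
  ae_pos_map_prod (ae_pos_rwpLaw _) (ae_pos_withDensity_Ioi _) j.ϱ_pos j.L_mul_γbar_pos

theorem snrApprox_singleton (p : ℕ) (a : ℝ) : j.snrApprox p {a} = 0 :=
  map_prod_singleton (ae_pos_rwpLaw _) (withDensity_restrict_singleton _ _) j.ϱ_pos
    j.L_mul_γbar_pos a

/-- The left edge of the strip comes from `Γ(Lμ + s)`; the right edge is where `q^(-α s)` stops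
being integrable at `q = 0`. The fractions arise from `β_i + 1 - α s = α (Ψ_i - s)`. -/
theorem hasComplexMoment_snrApprox {p : ℕ} (hp : 1 ≤ p) {s : ℂ} (h1 : -(j.L * j.μ) < s.re)
    (h2 : s.re < 3 / j.α) :
    HasComplexMoment (j.snrApprox p) s ((j.K₂ : ℂ) ^ (-s) * ∑ i, ∑ k ∈ Finset.range (p + 1),
      (j.K₁ p i k : ℂ) * (Complex.Gamma (j.L * j.μ + k + s) * (j.Ψ i - s)⁻¹)) := by
  have hα := j.α_pos
  have hre : -3 < (-(j.α : ℂ) * s).re := by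
    rw [lt_div_iff₀ hα] at h2
    simp only [neg_mul, Complex.neg_re, Complex.re_ofReal_mul]
    linarith
  have hB := kmB_pos j.κ_pos j.L_mul_μ_pos
  have hD := j.D_pos
  have hϱ := j.ϱ_pos
  have hLγ := j.L_mul_γbar_pos
  have key := hasComplexMoment_map_prod (ae_pos_rwpLaw _) (ae_pos_withDensity_Ioi _) hϱ hLγ
    (hasComplexMoment_rwpLaw hD hre) (hasComplexMoment_kmPowerApprox hp j.κ_pos j.L_mul_μ_pos h1)
  have hconst : (j.K₂ : ℂ) ^ (-s) =
      (((j.ϱ : ℂ) * ((j.L * j.γbar : ℝ) : ℂ)) ^ s) * (j.D : ℂ) ^ (-(j.α : ℂ) * s) *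
        (kmB j.κ (j.L * j.μ) : ℂ) ^ (-s) := by
    have hpos : 0 < j.D ^ j.α := by positivity
    have e : j.K₂ = kmB j.κ (j.L * j.μ) * (j.D ^ j.α * (j.ϱ * (j.L * j.γbar))⁻¹) := by
      unfold K₂; field_simp
    rw [e, Complex.ofReal_mul, Complex.mul_cpow_ofReal_nonneg hB.le (by positivity),
      Complex.ofReal_mul, Complex.mul_cpow_ofReal_nonneg (by positivity) (by positivity),
      Complex.ofReal_inv, Complex.inv_cpow _ _ (by
        rw [Complex.arg_ofReal_of_nonneg (by positivity)]; exact Real.pi_pos.ne),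
      ← Complex.cpow_neg, neg_neg, Complex.ofReal_cpow hD.le, Complex.ofReal_mul]
    rw [cpow_ofReal_cpow hD, mul_neg, neg_mul]
    ring
  refine ⟨key.1, key.2.trans ?_⟩
  rw [hconst, Finset.sum_mul_sum, Finset.mul_sum, Finset.mul_sum]
  refine Finset.sum_congr rfl fun i _ => ?_
  rw [Finset.mul_sum, Finset.mul_sum]
  refine Finset.sum_congr rfl fun k _ => ?_
  have hΨ : ((rwpβ i : ℂ) + 1 + -(j.α : ℂ) * s) = j.α * (j.Ψ i - s) := by
    unfold Ψ
    have : (j.α : ℂ) ≠ 0 := by exact_mod_cast hα.ne'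
    push_cast
    field_simp
    ring
  rw [hΨ, K₁, Real.exp_neg]
  push_cast
  rw [div_eq_mul_inv _ ((j.α : ℂ) * _), mul_inv, one_div, mul_inv]
  ring

theorem isFiniteMeasure_snrApprox {p : ℕ} (hp : 1 ≤ p) : IsFiniteMeasure (j.snrApprox p) :=
  (j.hasComplexMoment_snrApprox hp (s := 0) (by simpa using j.L_mul_μ_pos)
    (by simpa using j.α_pos)).measureReal_univ.1

end RFLink

/-! ### Tools for identifying G-functions -/

theorem HasComplexMoment.integrable_rpow {μ : Measure ℝ} (hμ : ∀ᵐ x ∂μ, 0 < x) {c : ℝ} {v : ℂ}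
    (h : HasComplexMoment μ c v) : Integrable (fun x => x ^ c) μ := by
  refine h.1.norm.congr ?_
  filter_upwards [hμ] with x hx
  rw [Complex.norm_cpow_eq_rpow_re_of_pos hx, Complex.ofReal_re]

/-- The line selected by choice in `meijerG` is one of the separating lines, so a value `V` common
to all of them is the value of `meijerG`. -/
theorem MeijerGConverges.of_eq {m n : ℕ} {a b : List ℝ} {z : ℝ} (V : ℂ)
    (hex : ∃ c, MeijerSeparates m n a b c)
    (h : ∀ c, MeijerSeparates m n a b c →
      Integrable (fun t : ℝ => meijerIntegrand m n a b z ((c : ℂ) + (t : ℂ) * Complex.I)) ∧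
        meijerLineIntegral m n a b z c = V) : MeijerGConverges m n a b z := by
  refine ⟨hex, fun c hc => ⟨(h c hc).1, ?_⟩⟩
  rw [(h c hc).2, meijerG, dif_pos hex, (h _ hex.choose_spec).2]

theorem Gamma_div_Gamma_add_one {w : ℂ} (hw : 0 < w.re) :
    Complex.Gamma w / Complex.Gamma (w + 1) = w⁻¹ := by
  have h0 : w ≠ 0 := by rintro rfl; simp at hw
  rw [Complex.Gamma_add_one w h0]
  have := Complex.Gamma_ne_zero_of_re_pos hw
  field_simp

/-! ### One term of the first closed form -/

/-- Of the eight Gamma factors six pair up as `Γ(w) / Γ(w + 1) = 1 / w`, with `w = Ψ_R - s`, `Ψ_E +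
s` and `-s`. -/
theorem meijerIntegrand_rf {aR aE ΨR ΨE : ℝ} {z : ℝ} {s : ℂ} (h1 : s.re < 0) (h2 : s.re < ΨR)
    (h3 : -ΨE < s.re) :
    meijerIntegrand 3 2 [1 - ΨE, 1 - aR, 1, 1 + ΨR] [aE, ΨR, 0, -ΨE] z s =
      (z : ℂ) ^ s * ((Complex.Gamma (aR + s) * (ΨR - s)⁻¹) *
        (Complex.Gamma (aE - s) * (ΨE + s)⁻¹)) / (-s) := by
  have e1 := Gamma_div_Gamma_add_one (w := ΨR - s) (by simpa using h2)
  have e2 := Gamma_div_Gamma_add_one (w := ΨE + s) (by simpa using by linarith)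
  have e3 := Gamma_div_Gamma_add_one (w := -s) (by simpa using h1)
  rw [← e1, ← e2, div_eq_mul_inv _ (-s), ← e3]
  simp only [meijerIntegrand, List.take, List.drop, List.map, List.prod_cons, List.prod_nil, mul_one]
  push_cast
  rw [show (0 : ℂ) - s = -s by ring, show (1 : ℂ) - (1 - ΨE) + s = ΨE + s by ring,
    show (1 : ℂ) - (1 - aR) + s = aR + s by ring, show (1 : ℂ) - (-ΨE) + s = ΨE + s + 1 by ring,
    show (1 : ℂ) - s = -s + 1 by ring, show (1 : ℂ) + ΨR - s = ΨR - s + 1 by ring]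
  simp only [div_eq_mul_inv, mul_inv]
  ring

/-- Law of `x / u`, with unnormalised densities `x ^ (a - 1) e ^ (-x)` and `u ^ (Ψ - 1)`,
`0 < u ≤ 1`. -/
noncomputable def gammaRatioLaw (a Ψ : ℝ) : Measure ℝ :=
  (((volume.restrict (Set.Ioc 0 1)).withDensity fun u => ENNReal.ofReal (u ^ (Ψ - 1))).prod
    ((volume.restrict (Set.Ioi 0)).withDensity fun x =>
      ENNReal.ofReal (x ^ (a - 1) * Real.exp (-(1 * x))))).map
    fun x => 1 * x.2 * x.1 ^ (-1 : ℝ) * 1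

theorem ae_pos_withDensity_Ioc (g : ℝ → ENNReal) :
    ∀ᵐ x ∂((volume.restrict (Set.Ioc 0 1)).withDensity g), 0 < x := by
  refine (withDensity_absolutelyContinuous _ _).ae_le ?_
  filter_upwards [ae_restrict_mem measurableSet_Ioc] with q hq using hq.1

theorem ae_pos_gammaRatioLaw (a Ψ : ℝ) : ∀ᵐ x ∂gammaRatioLaw a Ψ, 0 < x :=
  ae_pos_map_prod (ae_pos_withDensity_Ioc _) (ae_pos_withDensity_Ioi _) one_pos one_pos

theorem gammaRatioLaw_singleton (a Ψ x : ℝ) : gammaRatioLaw a Ψ {x} = 0 :=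
  map_prod_singleton (ae_pos_withDensity_Ioc _) (withDensity_restrict_singleton _ _) one_pos
    one_pos x

theorem hasComplexMoment_gammaRatioLaw {a Ψ : ℝ} {s : ℂ} (h1 : -a < s.re) (h2 : s.re < Ψ) :
    HasComplexMoment (gammaRatioLaw a Ψ) s (Complex.Gamma (a + s) * (Ψ - s)⁻¹) := by
  have hΨ : 0 < Ψ - 1 + 1 + (-((1 : ℝ) : ℂ) * s).re := by simpa using h2
  have ha : 0 < a + s.re := by linarith
  have hu := hasComplexMoment_withDensity_sum (s := -((1 : ℝ) : ℂ) * s) (S := Set.Ioc 0 1)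
    measurableSet_Ioc (Finset.univ : Finset Unit) (fun _ => 1) (fun _ u => u ^ (Ψ - 1)) _
    (fun _ => by fun_prop) (fun u hu => by have := hu.1; simp; positivity)
    (fun _ _ => integrableOn_rpow_mul_cpow one_pos hΨ)
    (fun _ _ => integral_rpow_mul_cpow one_pos hΨ)
  have hx := hasComplexMoment_withDensity_sum (s := s) (S := Set.Ioi 0)
    measurableSet_Ioi (Finset.univ : Finset Unit) (fun _ => 1)
    (fun _ x => x ^ (a - 1) * Real.exp (-(1 * x))) _ (fun _ => by fun_prop)
    (fun x hx => by have hx : 0 < x := hx; simp; positivity)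
    (fun _ _ => integrableOn_rpow_mul_exp_neg_mul_mul_cpow ha one_pos)
    (fun _ _ => integral_rpow_mul_exp_neg_mul_mul_cpow ha one_pos)
  simp only [Finset.univ_unique, Finset.sum_singleton, one_mul] at hu hx
  have key := hasComplexMoment_map_prod (ae_pos_withDensity_Ioc _) (ae_pos_withDensity_Ioi _)
    one_pos one_pos hu hx
  rw [gammaRatioLaw]
  simp only [one_mul]
  simp only [one_mul] at key
  convert key using 1
  simp only [Complex.ofReal_one, Complex.one_cpow, Complex.ofReal_sub, one_mul]
  rw [show ((Ψ : ℂ) - 1 + 1 + -1 * s) = Ψ - s by ring]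
  ring

theorem isFiniteMeasure_gammaRatioLaw {a Ψ : ℝ} (ha : 0 < a) (hΨ : 0 < Ψ) :
    IsFiniteMeasure (gammaRatioLaw a Ψ) :=
  (hasComplexMoment_gammaRatioLaw (a := a) (Ψ := Ψ) (s := 0) (by simpa) (by simpa)).measureReal_univ.1

/-- The moments `Γ(a + s) / (Ψ - s)` of `gammaRatioLaw` are exactly the factors of the integrand, so
Mellin inversion with `φ = 1 / z` evaluates the line integral. The value does not involve `c`, which
is what independence of the line requires. -/
theorem rf_line {aR aE ΨR ΨE z c : ℝ} (hz : 0 < z) (haR : 0 < aR) (haE : 0 < aE)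
    (hΨR : 0 < ΨR) (hΨE : 0 < ΨE) (hc : c < 0) (hc1 : -ΨE < c) (hc2 : -aR < c) :
    Integrable (fun t : ℝ => meijerIntegrand 3 2 [1 - ΨE, 1 - aR, 1, 1 + ΨR] [aE, ΨR, 0, -ΨE] z
      ((c : ℂ) + (t : ℂ) * Complex.I)) ∧
    meijerLineIntegral 3 2 [1 - ΨE, 1 - aR, 1, 1 + ΨR] [aE, ΨR, 0, -ΨE] z c =
      ((∫ y, (gammaRatioLaw aR ΨR).real (Set.Iic (z⁻¹ * y)) ∂gammaRatioLaw aE ΨE : ℝ) : ℂ) := by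
  have hre (t : ℝ) : ((c : ℂ) + (t : ℂ) * Complex.I).re = c := by simp
  have hI (t : ℝ) := meijerIntegrand_rf (aR := aR) (aE := aE) (ΨR := ΨR) (ΨE := ΨE) (z := z)
    (s := (c : ℂ) + (t : ℂ) * Complex.I) (by rw [hre]; exact hc) (by rw [hre]; linarith)
    (by rw [hre]; exact hc1)
  have hint : Integrable (fun t : ℝ => meijerIntegrand 3 2 [1 - ΨE, 1 - aR, 1, 1 + ΨR]
      [aE, ΨR, 0, -ΨE] z ((c : ℂ) + (t : ℂ) * Complex.I)) := by
    simp_rw [hI]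
    refine (integrable_Gamma_mul_Gamma_line (a := aR) (b := aE) (d := ΨR) (e := ΨE) (m := 1) (n := 1)
      (z := z) (c := c) hz (by linarith) (by linarith) hc.ne (by linarith)
      (by linarith)).congr (ae_of_all _ fun t => ?_)
    simp only [Complex.ofReal_one, one_mul, div_eq_mul_inv]
    ring
  refine ⟨hint, ?_⟩
  have := isFiniteMeasure_gammaRatioLaw haR hΨR
  have := isFiniteMeasure_gammaRatioLaw haE hΨE
  have hmR (t : ℝ) := hasComplexMoment_gammaRatioLaw (a := aR) (Ψ := ΨR)
    (s := (c : ℂ) + (t : ℂ) * Complex.I) (by rw [hre]; exact hc2) (by rw [hre]; linarith)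
  have hmE (t : ℝ) := hasComplexMoment_gammaRatioLaw (a := aE) (Ψ := ΨE)
    (s := -((c : ℂ) + (t : ℂ) * Complex.I)) (by rw [Complex.neg_re, hre]; linarith)
    (by rw [Complex.neg_re, hre]; linarith)
  have hmul (t : ℝ) : ((z⁻¹ : ℝ) : ℂ) ^ (-((c : ℂ) + t * Complex.I)) *
      (complexMoment (gammaRatioLaw aR ΨR) ((c : ℂ) + t * Complex.I) *
        complexMoment (gammaRatioLaw aE ΨE) (-((c : ℂ) + t * Complex.I))) /
        (-((c : ℂ) + t * Complex.I)) = meijerIntegrand 3 2 [1 - ΨE, 1 - aR, 1, 1 + ΨR]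
      [aE, ΨR, 0, -ΨE] z ((c : ℂ) + (t : ℂ) * Complex.I) := by
    rw [(hmR t).2, (hmE t).2, hI, Complex.ofReal_inv, Complex.inv_cpow _ _ (by
        rw [Complex.arg_ofReal_of_nonneg hz.le]; exact Real.pi_pos.ne), ← Complex.cpow_neg, neg_neg,
        sub_neg_eq_add, ← sub_eq_add_neg]
  have key := integral_measureReal_Iic_eq_mellin (ae_pos_gammaRatioLaw aR ΨR)
    (ae_pos_gammaRatioLaw aE ΨE) (fun a _ => gammaRatioLaw_singleton _ _ a) (inv_pos.2 hz) hc
    ((hasComplexMoment_gammaRatioLaw (a := aR) (Ψ := ΨR) (s := (c : ℂ)) (by simpa using hc2)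
      (by simp; linarith)).integrable_rpow (ae_pos_gammaRatioLaw _ _))
    ((hasComplexMoment_gammaRatioLaw (a := aE) (Ψ := ΨE) (s := ((-c : ℝ) : ℂ)) (by simp; linarith)
      (by simp; linarith)).integrable_rpow (ae_pos_gammaRatioLaw _ _)) (by simpa only [hmul] using hint)
  rw [key, meijerLineIntegral]
  simp only [hmul]

theorem meijerSeparates_rf {aR aE ΨR ΨE c : ℝ} :
    MeijerSeparates 3 2 [1 - ΨE, 1 - aR, 1, 1 + ΨR] [aE, ΨR, 0, -ΨE] c ↔
      (c < aE ∧ c < ΨR ∧ c < 0) ∧ -ΨE < c ∧ -aR < c := by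
  simp [MeijerSeparates]

theorem meijerGConverges_rf {aR aE ΨR ΨE z : ℝ} (hz : 0 < z) (haR : 0 < aR) (haE : 0 < aE)
    (hΨR : 0 < ΨR) (hΨE : 0 < ΨE) :
    MeijerGConverges 3 2 [1 - ΨE, 1 - aR, 1, 1 + ΨR] [aE, ΨR, 0, -ΨE] z := by
  refine .of_eq
    ((∫ y, (gammaRatioLaw aR ΨR).real (Set.Iic (z⁻¹ * y)) ∂gammaRatioLaw aE ΨE : ℝ) : ℂ) ?_
    fun c hc => ?_
  · have := lt_min haR hΨE
    have := min_le_left aR ΨE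
    have := min_le_right aR ΨE
    refine ⟨-(min aR ΨE) / 2, meijerSeparates_rf.2 ⟨⟨?_, ?_, ?_⟩, ?_, ?_⟩⟩ <;> linarith
  · obtain ⟨⟨-, -, h0⟩, h1, h2⟩ := meijerSeparates_rf.1 hc
    exact rf_line hz haR haE hΨR hΨE h0 h1 h2

/-! ### The first closed form -/

theorem L_mul_μ_add_pos (j : RFLink) (k : ℕ) : 0 < j.L * j.μ + k :=
  add_pos_of_pos_of_nonneg j.L_mul_μ_pos (Nat.cast_nonneg k)

theorem sop₁Upper_eq (R E : RFLink) (i : Fin 3) (k : ℕ) (i' : Fin 3) :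
    sop₁Upper R E i k i' = [1 - E.Ψ i', 1 - (R.L * R.μ + k), 1, 1 + R.Ψ i] := by
  rw [sop₁Upper, sub_sub 1 (R.L * R.μ)]

theorem meijerGConverges_sop₁ (R E : RFLink) {φ : ℝ} (hφ : 0 < φ) (i i' : Fin 3) (k k' : ℕ) :
    MeijerGConverges 3 2 (sop₁Upper R E i k i') (sop₁Lower R E i i' k') (E.K₂ / (φ * R.K₂)) := by
  rw [sop₁Upper_eq]
  exact meijerGConverges_rf (div_pos E.K₂_pos (mul_pos hφ R.K₂_pos)) (L_mul_μ_add_pos R k)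
    (L_mul_μ_add_pos E k') (R.Ψ_pos i) (E.Ψ_pos i')

/-- A single line is needed for all terms at once, so that the finite sums can be taken out of one
integral. It exists because `Ψ_i ≥ 3 / α` for every `i` and `Lμ + k ≥ Lμ` for every `k`. -/
theorem exists_meijerSeparates_sop₁ (R E : RFLink) : ∃ c : ℝ, c < 0 ∧ -(R.L * R.μ) < c ∧
    -(3 / E.α) < c ∧ ∀ (i i' : Fin 3) (k k' : ℕ),
      MeijerSeparates 3 2 (sop₁Upper R E i k i') (sop₁Lower R E i i' k') c := by
  have h1 := R.L_mul_μ_pos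
  have h2 : 0 < 3 / E.α := div_pos three_pos E.α_pos
  have := lt_min h1 h2
  have := min_le_left (R.L * R.μ) (3 / E.α)
  have := min_le_right (R.L * R.μ) (3 / E.α)
  refine ⟨-(min (R.L * R.μ) (3 / E.α)) / 2, by linarith, by linarith, by linarith,
    fun i i' k k' => ?_⟩
  rw [sop₁Upper_eq]
  have := R.Ψ_pos i
  have := E.Ψ_ge i'
  have := L_mul_μ_add_pos E k'
  have : (0 : ℝ) ≤ k := Nat.cast_nonneg k
  refine meijerSeparates_rf.2 ⟨⟨?_, ?_, ?_⟩, ?_, ?_⟩ <;> linarith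

/-- Brings a product of two moments into the nesting of the sums in `sop₁Closed`. -/
theorem mul_sum_mul_sum_div {ι κ : Type*} (F : Finset ι) (K : Finset κ) (P P₁ P₂ q : ℂ)
    (a A b B : ι → κ → ℂ) :
    P * ((P₁ * ∑ i ∈ F, ∑ k ∈ K, a i k * A i k) * (P₂ * ∑ i ∈ F, ∑ k ∈ K, b i k * B i k)) / q =
      ∑ i ∈ F, ∑ k ∈ K, a i k * ∑ i' ∈ F, ∑ k' ∈ K,
        b i' k' * (P * (P₁ * P₂) * (A i k * B i' k') / q) := by
  have h (i : ι) (k : κ) : ∑ i' ∈ F, ∑ k' ∈ K, b i' k' * (P * (P₁ * P₂) * (A i k * B i' k') / q) =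
      A i k * (P * (P₁ * P₂) / q * ∑ i' ∈ F, ∑ k' ∈ K, b i' k' * B i' k') := by
    simp_rw [Finset.mul_sum]
    refine Finset.sum_congr rfl fun i' _ => Finset.sum_congr rfl fun k' _ => ?_
    ring
  simp_rw [h, ← mul_assoc, ← Finset.sum_mul]
  ring

theorem hopSOP_snrApprox (R E : RFLink) {φ : ℝ} (hφ : 0 < φ) {p : ℕ} (hp : 1 ≤ p) :
    (hopSOP φ (R.snrApprox p) (E.snrApprox p) : ℂ) = sop₁Closed φ R E p := by
  obtain ⟨c, hc, hcR, hcE, hsep⟩ := exists_meijerSeparates_sop₁ R E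
  have := R.isFiniteMeasure_snrApprox hp
  have := E.isFiniteMeasure_snrApprox hp
  have hRα : 0 < 3 / R.α := div_pos three_pos R.α_pos
  have hLE := E.L_mul_μ_pos
  have hre (t : ℝ) : ((c : ℂ) + (t : ℂ) * Complex.I).re = c := by simp
  set z := E.K₂ / (φ * R.K₂) with hz
  set G : Fin 3 → ℕ → Fin 3 → ℕ → ℝ → ℂ := fun i k i' k' t =>
    meijerIntegrand 3 2 (sop₁Upper R E i k i') (sop₁Lower R E i i' k') z
      ((c : ℂ) + (t : ℂ) * Complex.I) with hG
  have hconv (i i' : Fin 3) (k k' : ℕ) := (meijerGConverges_sop₁ R E hφ i i' k k').2 c (hsep i i' k k')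
  have hmR (t : ℝ) := (R.hasComplexMoment_snrApprox hp (s := (c : ℂ) + (t : ℂ) * Complex.I)
    (by rw [hre]; exact hcR) (by rw [hre]; linarith)).2
  have hmE (t : ℝ) := (E.hasComplexMoment_snrApprox hp (s := -((c : ℂ) + (t : ℂ) * Complex.I))
    (by rw [Complex.neg_re, hre]; linarith) (by rw [Complex.neg_re, hre]; linarith)).2
  -- The threshold and the scales of the two links merge into the argument of the G-function.
  have hzpow (s : ℂ) : (z : ℂ) ^ s = (φ : ℂ) ^ (-s) * ((R.K₂ : ℂ) ^ (-s) * (E.K₂ : ℂ) ^ s) := by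
    have hRK := R.K₂_pos
    have hEK := E.K₂_pos
    have hinv : ∀ r : ℝ, 0 < r → ((r : ℂ)⁻¹) ^ s = (r : ℂ) ^ (-s) := fun r hr => by
      rw [Complex.cpow_neg, Complex.inv_cpow]
      rw [Complex.arg_ofReal_of_nonneg hr.le]; exact Real.pi_pos.ne
    rw [hz, show E.K₂ / (φ * R.K₂) = φ⁻¹ * (R.K₂⁻¹ * E.K₂) by field_simp, Complex.ofReal_mul,
      Complex.mul_cpow_ofReal_nonneg (by positivity) (by positivity), Complex.ofReal_mul,
      Complex.mul_cpow_ofReal_nonneg (by positivity) (by positivity), Complex.ofReal_inv,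
      Complex.ofReal_inv, hinv _ hφ, hinv _ hRK]
  have hmul (t : ℝ) : (φ : ℂ) ^ (-((c : ℂ) + t * Complex.I)) *
      (complexMoment (R.snrApprox p) ((c : ℂ) + t * Complex.I) *
        complexMoment (E.snrApprox p) (-((c : ℂ) + t * Complex.I))) / (-((c : ℂ) + t * Complex.I)) =
      ∑ i : Fin 3, ∑ k ∈ Finset.range (p + 1), (R.K₁ p i k : ℂ) *
        ∑ i' : Fin 3, ∑ k' ∈ Finset.range (p + 1), (E.K₁ p i' k' : ℂ) * G i k i' k' t := by
    have hGt (i i' : Fin 3) (k k' : ℕ) : G i k i' k' t = (z : ℂ) ^ ((c : ℂ) + t * Complex.I) *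
        ((Complex.Gamma (R.L * R.μ + k + ((c : ℂ) + t * Complex.I)) *
            (R.Ψ i - ((c : ℂ) + t * Complex.I))⁻¹) *
          (Complex.Gamma (E.L * E.μ + k' + -((c : ℂ) + t * Complex.I)) *
            (E.Ψ i' - -((c : ℂ) + t * Complex.I))⁻¹)) / (-((c : ℂ) + t * Complex.I)) := by
      have := R.Ψ_pos i
      have := E.Ψ_ge i'
      simp only [hG]
      rw [sop₁Upper_eq, sop₁Lower, meijerIntegrand_rf (by rw [hre]; exact hc) (by rw [hre]; linarith)
        (by rw [hre]; linarith), sub_neg_eq_add, ← sub_eq_add_neg]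
      push_cast
      rfl
    rw [hmR, hmE]
    simp_rw [hGt, hzpow, neg_neg]
    exact mul_sum_mul_sum_div _ _ _ _ _ _ _ _ _ _
  have hGint (i i' : Fin 3) (k k' : ℕ) : Integrable (G i k i' k') := (hconv i i' k k').1
  have hsum1 (i : Fin 3) (k : ℕ) (i' : Fin 3) : Integrable (fun t =>
      ∑ k' ∈ Finset.range (p + 1), (E.K₁ p i' k' : ℂ) * G i k i' k' t) :=
    integrable_finsetSum _ fun k' _ => (hGint i i' k k').const_mul _
  have hsum2 (i : Fin 3) (k : ℕ) : Integrable (fun t => ∑ i' : Fin 3,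
      ∑ k' ∈ Finset.range (p + 1), (E.K₁ p i' k' : ℂ) * G i k i' k' t) :=
    integrable_finsetSum _ fun i' _ => hsum1 i k i'
  have hsum3 (i : Fin 3) : Integrable (fun t => ∑ k ∈ Finset.range (p + 1), (R.K₁ p i k : ℂ) *
        ∑ i' : Fin 3, ∑ k' ∈ Finset.range (p + 1), (E.K₁ p i' k' : ℂ) * G i k i' k' t) :=
    integrable_finsetSum _ fun k _ => (hsum2 i k).const_mul _
  have key := integral_measureReal_Iic_eq_mellin (R.ae_pos_snrApprox p) (E.ae_pos_snrApprox p)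
    (fun a _ => R.snrApprox_singleton p a) hφ hc
    ((R.hasComplexMoment_snrApprox hp (s := (c : ℂ)) (by simpa using hcR)
      (by simp; linarith)).integrable_rpow (R.ae_pos_snrApprox p))
    ((E.hasComplexMoment_snrApprox hp (s := ((-c : ℝ) : ℂ)) (by simp; linarith)
      (by simp; linarith)).integrable_rpow (E.ae_pos_snrApprox p))
    (by simpa only [hmul] using integrable_finsetSum _ fun i _ => hsum3 i)
  rw [hopSOP, sop₁Closed, Complex.ofReal_sub, Complex.ofReal_one, key]
  simp only [hmul]
  congr 1
  rw [integral_finsetSum _ fun i _ => hsum3 i, Finset.mul_sum]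
  refine Finset.sum_congr rfl fun i _ => ?_
  rw [integral_finsetSum _ fun k _ => (hsum2 i k).const_mul _, Finset.mul_sum]
  refine Finset.sum_congr rfl fun k _ => ?_
  rw [integral_const_mul, integral_finsetSum _ fun i' _ => hsum1 i k i', mul_left_comm,
    Finset.mul_sum]
  congr 1
  refine Finset.sum_congr rfl fun i' _ => ?_
  rw [integral_finsetSum _ fun k' _ => (hGint i i' k k').const_mul _, Finset.mul_sum]
  refine Finset.sum_congr rfl fun k' _ => ?_
  rw [integral_const_mul, ← (hconv i i' k k').2, meijerLineIntegral, mul_left_comm]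

/-! ### Moments of the optical gains -/

/-- Nonvanishing replaces normalisation for the optical gains: only positivity of the mean and
variance of `Y` is needed later. -/
theorem withDensity_restrict_ne_zero {S : Set ℝ} (hS : MeasurableSet S) (hS0 : volume S ≠ 0)
    {g : ℝ → ℝ} (hg : Measurable g) (hpos : ∀ x ∈ S, 0 < g x) :
    (volume.restrict S).withDensity (fun x => ENNReal.ofReal (g x)) ≠ 0 := by
  intro h
  have hac := withDensity_absolutelyContinuous' (μ := volume.restrict S)
    (f := fun x => ENNReal.ofReal (g x)) hg.ennreal_ofReal.aemeasurable (by
      filter_upwards [ae_restrict_mem hS] with x hx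
      simpa using hpos x hx)
  rw [h] at hac
  have := hac (s := Set.univ) (by simp)
  simp [hS0] at this

theorem integrable_pow_withDensity_ofReal {S : Set ℝ} (hS : MeasurableSet S) {g : ℝ → ℝ}
    (hg : Measurable g) (hpos : ∀ x ∈ S, 0 ≤ g x) (m : ℕ)
    (h : IntegrableOn (fun x => g x * x ^ m) S) :
    Integrable (fun x => x ^ m) ((volume.restrict S).withDensity fun x => ENNReal.ofReal (g x)) := by
  rw [integrable_withDensity_iff_integrable_smul' hg.ennreal_ofReal (by simp)]
  refine h.congr ?_
  filter_upwards [ae_restrict_mem hS] with x hx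
  simp [ENNReal.toReal_ofReal (hpos x hx)]

theorem integrableOn_rpow_mul_exp_neg_mul_rpow' {p q b : ℝ} (hp : 0 < p) (hq : -1 < q)
    (hb : 0 < b) : IntegrableOn (fun x : ℝ => x ^ q * Real.exp (-b * x ^ p)) (Set.Ioi 0) := by
  refine not_imp_comm.1 integral_undef ?_
  rw [integral_rpow_mul_exp_neg_mul_rpow hp hq hb]
  have := Real.Gamma_pos_of_pos (s := (q + 1) / p) (by apply div_pos <;> linarith)
  positivity

/-- A nonzero measure without atoms on the positive reals, with finite moments of orders
`0`, `1`, `2`. -/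
structure IsGainLaw (μ : Measure ℝ) : Prop where
  ne_zero : μ ≠ 0
  ae_pos : ∀ᵐ x ∂μ, 0 < x
  singleton : ∀ a, μ {a} = 0
  integrable_pow : ∀ m : ℕ, m ≤ 2 → Integrable (fun x => x ^ m) μ

theorem IsGainLaw.isFiniteMeasure {μ : Measure ℝ} (h : IsGainLaw μ) : IsFiniteMeasure μ := by
  have := h.integrable_pow 0 (by norm_num)
  simp only [pow_zero] at this
  exact (integrable_const_iff_isFiniteMeasure one_ne_zero).1 this

theorem OpticalHop.isGainLaw_turbulenceLaw (h : OpticalHop) : IsGainLaw h.turbulenceLaw := by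
  have hw := h.w_pos
  have hw1 : 0 < 1 - h.w := by linarith [h.w_lt]
  have hν := h.ν_pos
  have ha := h.a_pos
  have hb := h.b_pos
  have hc := h.c_pos
  have hG := Real.Gamma_pos_of_pos ha
  have hm : Measurable fun x => h.w / h.ν * Real.exp (-(x / h.ν)) +
        (1 - h.w) * (h.c * x ^ (h.a * h.c - 1) / (h.b ^ (h.a * h.c) * Real.Gamma h.a)) *
          Real.exp (-(x / h.b) ^ h.c) := by fun_prop
  have hpos : ∀ x ∈ Set.Ioi (0 : ℝ), 0 < h.w / h.ν * Real.exp (-(x / h.ν)) +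
        (1 - h.w) * (h.c * x ^ (h.a * h.c - 1) / (h.b ^ (h.a * h.c) * Real.Gamma h.a)) *
          Real.exp (-(x / h.b) ^ h.c) := by
    intro x hx
    have hx : 0 < x := hx
    positivity
  refine ⟨withDensity_restrict_ne_zero measurableSet_Ioi (by simp) hm hpos,
    ae_pos_withDensity_Ioi _, withDensity_restrict_singleton _ _, fun m _ =>
    integrable_pow_withDensity_ofReal measurableSet_Ioi hm (fun x hx => (hpos x hx).le) m ?_⟩
  have hm0 : (0 : ℝ) ≤ m := Nat.cast_nonneg m
  have hac : 0 < h.a * h.c := by positivity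
  have i1 := (integrableOn_rpow_mul_exp_neg_mul_rpow' (p := 1) (q := m) (b := h.ν⁻¹) one_pos
    (by linarith) (by positivity)).const_mul (h.w / h.ν)
  have i2 := (integrableOn_rpow_mul_exp_neg_mul_rpow' (p := h.c) (q := h.a * h.c - 1 + m)
    (b := (h.b ^ h.c)⁻¹) hc (by linarith) (by positivity)).const_mul
    ((1 - h.w) * (h.c / (h.b ^ (h.a * h.c) * Real.Gamma h.a)))
  refine (i1.add i2).congr ?_
  filter_upwards [ae_restrict_mem measurableSet_Ioi] with x hx
  have hx : 0 < x := hx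
  simp only [Pi.add_apply]
  rw [Real.rpow_one, Real.rpow_add hx, Real.rpow_natCast, Real.div_rpow hx.le hb.le]
  rw [show -h.ν⁻¹ * x = -(x / h.ν) by ring, show -(h.b ^ h.c)⁻¹ * x ^ h.c = -(x ^ h.c / h.b ^ h.c) by ring]
  ring

theorem OpticalHop.isGainLaw_pointingLaw (h : OpticalHop) : IsGainLaw h.pointingLaw := by
  have hξ := h.ξ_pos
  have hJ := h.J_pos
  have hm : Measurable fun x => h.ξ ^ 2 / h.J ^ (h.ξ ^ 2) * x ^ (h.ξ ^ 2 - 1) := by fun_prop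
  have hpos : ∀ x ∈ Set.Ioc (0 : ℝ) h.J, 0 < h.ξ ^ 2 / h.J ^ (h.ξ ^ 2) * x ^ (h.ξ ^ 2 - 1) := by
    intro x hx
    have hx := hx.1
    positivity
  refine ⟨withDensity_restrict_ne_zero measurableSet_Ioc (by simpa using hJ) hm hpos,
    ?_, withDensity_restrict_singleton _ _, fun m _ =>
    integrable_pow_withDensity_ofReal measurableSet_Ioc hm (fun x hx => (hpos x hx).le) m ?_⟩
  · refine (withDensity_absolutelyContinuous _ _).ae_le ?_
    filter_upwards [ae_restrict_mem measurableSet_Ioc] with q hq using hq.1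
  have i1 : IntegrableOn (fun x : ℝ => x ^ (h.ξ ^ 2 - 1 + m)) (Set.Ioc 0 h.J) := by
    rw [← intervalIntegrable_iff_integrableOn_Ioc_of_le hJ.le]
    have hm0 : (0 : ℝ) ≤ m := Nat.cast_nonneg m
    exact intervalIntegral.intervalIntegrable_rpow' (by nlinarith)
  refine (i1.const_mul (h.ξ ^ 2 / h.J ^ (h.ξ ^ 2))).congr ?_
  filter_upwards [ae_restrict_mem measurableSet_Ioc] with x hx
  rw [Real.rpow_add hx.1, Real.rpow_natCast]
  ring

theorem prod_mul_eq_null {μ ν : Measure ℝ} [SFinite ν] (hμ : ∀ᵐ x ∂μ, 0 < x)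
    (hν : ∀ a, ν {a} = 0) (a : ℝ) : (μ.prod ν) {x | x.1 * x.2 = a} = 0 := by
  rw [Measure.prod_apply (measurableSet_eq_fun (by fun_prop) measurable_const)]
  refine (lintegral_congr_ae (g := fun _ => 0) ?_).trans (by simp)
  filter_upwards [hμ] with x hx
  refine measure_mono_null (fun y hy => ?_) (hν (a / x))
  have hy : x * y = a := hy
  rw [Set.mem_singleton_iff, eq_div_iff hx.ne', ← hy, mul_comm]

theorem prod_ne_zero {μ ν : Measure ℝ} [SFinite ν] (hμ : μ ≠ 0) (hν : ν ≠ 0) :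
    μ.prod ν ≠ 0 := by
  intro h
  have h' : (μ.prod ν) (Set.univ ×ˢ Set.univ) = 0 := by rw [h]; rfl
  rw [Measure.prod_prod] at h'
  simp [hμ, hν] at h'

theorem IsGainLaw.map_mul {μ ν : Measure ℝ} (hμ : IsGainLaw μ) (hν : IsGainLaw ν) :
    IsGainLaw ((μ.prod ν).map fun x => x.1 * x.2) := by
  have := hμ.isFiniteMeasure
  have := hν.isFiniteMeasure
  have hmeas : Measurable fun x : ℝ × ℝ => x.1 * x.2 := by fun_prop
  refine ⟨?_, ?_, fun a => ?_, fun m hm => ?_⟩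
  · rw [Ne, Measure.map_eq_zero_iff hmeas.aemeasurable]
    exact prod_ne_zero hμ.ne_zero hν.ne_zero
  · rw [ae_map_iff hmeas.aemeasurable measurableSet_Ioi]
    filter_upwards [ae_pos_prod hμ.ae_pos hν.ae_pos] with x hx using mul_pos hx.1 hx.2
  · rw [Measure.map_apply hmeas (measurableSet_singleton a)]
    exact prod_mul_eq_null hμ.ae_pos hν.singleton a
  · rw [integrable_map_measure (by fun_prop) hmeas.aemeasurable]
    refine ((hμ.integrable_pow m hm).mul_prod (hν.integrable_pow m hm)).congr
      (ae_of_all _ fun x => ?_)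
    simp [mul_pow]

theorem OpticalHop.isGainLaw_gainLaw (h : OpticalHop) : IsGainLaw h.gainLaw :=
  h.isGainLaw_turbulenceLaw.map_mul h.isGainLaw_pointingLaw

namespace OpticalLink

variable (n : OpticalLink)

theorem meanY_pos : 0 < n.meanY := by
  have h1 := n.hopI.isGainLaw_gainLaw
  have h2 := n.hopn.isGainLaw_gainLaw
  have := h1.isFiniteMeasure
  have := h2.isFiniteMeasure
  have hpos := ae_pos_prod h1.ae_pos h2.ae_pos
  have hint : Integrable (fun x : ℝ × ℝ => x.1 * x.2) (n.hopI.gainLaw.prod n.hopn.gainLaw) := by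
    have i1 := h1.integrable_pow 1 (by norm_num)
    have i2 := h2.integrable_pow 1 (by norm_num)
    simp only [pow_one] at i1 i2
    exact i1.mul_prod i2
  rw [meanY, integral_pos_iff_support_of_nonneg_ae
    (by filter_upwards [hpos] with x hx using (mul_pos hx.1 hx.2).le) hint, pos_iff_ne_zero]
  intro h0
  have : ∀ᵐ x ∂(n.hopI.gainLaw.prod n.hopn.gainLaw), False := by
    have h0' : ∀ᵐ x ∂(n.hopI.gainLaw.prod n.hopn.gainLaw),
      x ∉ Function.support fun x : ℝ × ℝ => x.1 * x.2 := measure_eq_zero_iff_ae_notMem.1 h0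
    filter_upwards [hpos, h0'] with x hx hx'
    exact hx' (mul_pos hx.1 hx.2).ne'
  rw [Filter.eventually_false_iff_eq_bot, ae_eq_bot] at this
  exact prod_ne_zero h1.ne_zero h2.ne_zero this

/-- If the variance vanished, the product of the gains would be almost everywhere equal to its mean,
whereas its law is nonzero and has no atoms. -/
theorem varY_pos : 0 < n.varY := by
  have h1 := n.hopI.isGainLaw_gainLaw
  have h2 := n.hopn.isGainLaw_gainLaw
  have := h1.isFiniteMeasure
  have := h2.isFiniteMeasure
  have hmeas : Measurable fun x : ℝ × ℝ => x.1 * x.2 := by fun_prop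
  have hL2 : MemLp (fun x : ℝ × ℝ => x.1 * x.2) 2 (n.hopI.gainLaw.prod n.hopn.gainLaw) := by
    rw [memLp_two_iff_integrable_sq hmeas.aestronglyMeasurable]
    simp_rw [mul_pow]
    exact (h1.integrable_pow 2 le_rfl).mul_prod (h2.integrable_pow 2 le_rfl)
  rw [varY, variance, ENNReal.toReal_pos_iff]
  refine ⟨pos_iff_ne_zero.2 fun h0 => ?_, evariance_lt_top hL2⟩
  rw [evariance_eq_zero_iff hmeas.aemeasurable] at h0
  have hnull := prod_mul_eq_null h1.ae_pos h2.singleton n.meanY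
  have : ∀ᵐ x ∂(n.hopI.gainLaw.prod n.hopn.gainLaw), False := by
    have hnull' : ∀ᵐ x ∂(n.hopI.gainLaw.prod n.hopn.gainLaw), ¬ x.1 * x.2 = n.meanY := by
      rw [ae_iff]; simpa using hnull
    filter_upwards [h0, hnull'] with x hx hx' using hx' hx
  rw [Filter.eventually_false_iff_eq_bot, ae_eq_bot] at this
  exact prod_ne_zero h1.ne_zero h2.ne_zero this

theorem N_cast_pos : (0 : ℝ) < n.N := Nat.cast_pos.2 n.N_pos

theorem r_cast_pos : (0 : ℝ) < n.r := by
  rcases n.r_eq with h | h <;> simp [h]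

theorem ρ_pos : 0 < n.ρ := by
  have := n.meanY_pos
  have := n.varY_pos
  have := n.N_cast_pos
  unfold ρ; positivity

theorem w_pos : 0 < n.w := by
  have := n.meanY_pos
  have := n.varY_pos
  have := n.N_cast_pos
  unfold w; positivity

theorem τ_pos : 0 < n.τ := by
  have := n.meanY_pos
  have := n.η_pos
  have := n.N₀_pos
  unfold τ; positivity

/-- The scale `τ (w / E(Y)) ^ r` of the SNR. -/
noncomputable def snrScale : ℝ := n.τ * (n.w / n.meanY) ^ n.r

theorem snrScale_pos : 0 < n.snrScale := by
  have := n.meanY_pos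
  have := n.w_pos
  have := n.τ_pos
  unfold snrScale; positivity

end OpticalLink

/-! ### Moments of the optical SNR -/

theorem gammaMeasure_eq (a r : ℝ) : gammaMeasure a r =
    (volume.restrict (Set.Ioi 0)).withDensity fun x => ENNReal.ofReal
      (r ^ a / Real.Gamma a * (x ^ (a - 1) * Real.exp (-(r * x)))) := by
  rw [gammaMeasure, ← withDensity_indicator measurableSet_Ioi]
  refine withDensity_congr_ae ?_
  have : ∀ᵐ x : ℝ, x ≠ 0 := by simp [ae_iff]
  filter_upwards [this] with x hx
  rcases lt_or_gt_of_ne hx with h | h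
  · rw [gammaPDF_of_neg h, Set.indicator_of_notMem]
    simpa using h.le
  · rw [gammaPDF_of_nonneg h.le, Set.indicator_of_mem (by simpa using h), mul_assoc]

theorem hasComplexMoment_gammaMeasure {a r : ℝ} (ha : 0 < a) (hr : 0 < r) {s : ℂ}
    (hs : -a < s.re) : HasComplexMoment (gammaMeasure a r) s
      ((r : ℂ) ^ (-s) * (Complex.Gamma (a + s) / Real.Gamma a)) := by
  have has : 0 < a + s.re := by linarith
  have hG := Real.Gamma_pos_of_pos ha
  have hx := hasComplexMoment_withDensity_sum (s := s) (S := Set.Ioi 0)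
    measurableSet_Ioi (Finset.univ : Finset Unit) (fun _ => r ^ a / Real.Gamma a)
    (fun _ x => x ^ (a - 1) * Real.exp (-(r * x))) _ (fun _ => by fun_prop)
    (fun x hx => by have hx : 0 < x := hx; simp; positivity)
    (fun _ _ => integrableOn_rpow_mul_exp_neg_mul_mul_cpow has hr)
    (fun _ _ => integral_rpow_mul_exp_neg_mul_mul_cpow has hr)
  simp only [Finset.univ_unique, Finset.sum_singleton] at hx
  rw [gammaMeasure_eq]
  convert hx using 1
  have hp : ((r ^ a : ℝ) : ℂ) ≠ 0 := by exact_mod_cast (Real.rpow_pos_of_pos hr _).ne'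
  rw [neg_add, Complex.cpow_add _ _ (by exact_mod_cast hr.ne'), Complex.cpow_neg _ (a : ℂ),
    ← Complex.ofReal_cpow hr.le]
  push_cast at hp ⊢
  field_simp

namespace OpticalLink

variable (n : OpticalLink)

theorem measurable_snr : Measurable fun x : ℝ => n.τ * (x / n.meanY) ^ n.r := by fun_prop

theorem isProbabilityMeasure_snrLaw : IsProbabilityMeasure n.snrLaw := by
  have := isProbabilityMeasure_gammaMeasure n.ρ_pos (one_div_pos.2 n.w_pos)
  exact Measure.isProbabilityMeasure_map n.measurable_snr.aemeasurable

theorem ae_pos_gammaMeasure (a r : ℝ) : ∀ᵐ x ∂gammaMeasure a r, 0 < x := by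
  rw [gammaMeasure_eq]
  exact ae_pos_withDensity_Ioi _

theorem ae_pos_snrLaw : ∀ᵐ x ∂n.snrLaw, 0 < x := by
  rw [snrLaw, ae_map_iff n.measurable_snr.aemeasurable measurableSet_Ioi]
  have := n.meanY_pos
  have := n.τ_pos
  filter_upwards [ae_pos_gammaMeasure _ _] with x hx
  positivity

theorem snrLaw_singleton {a : ℝ} (_ : 0 < a) : n.snrLaw {a} = 0 := by
  have hm := n.meanY_pos
  have hτ := n.τ_pos
  have hr : (n.r : ℝ) ≠ 0 := n.r_cast_pos.ne'
  rw [snrLaw, Measure.map_apply n.measurable_snr (measurableSet_singleton a)]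
  -- On positive numbers the map to the SNR is injective, and this point is the only possible
  -- preimage of `a`.
  have h0 : gammaMeasure n.ρ (1 / n.w) {n.meanY * (a / n.τ) ^ (1 / (n.r : ℝ))} = 0 := by
    rw [gammaMeasure_eq]
    exact withDensity_restrict_singleton _ _ _
  have hpos : ∀ᵐ x ∂gammaMeasure n.ρ (1 / n.w), x ∉
      (fun x : ℝ => n.τ * (x / n.meanY) ^ n.r) ⁻¹' {a} := by
    have h0' : ∀ᵐ x ∂gammaMeasure n.ρ (1 / n.w), ¬ x = n.meanY * (a / n.τ) ^ (1 / (n.r : ℝ)) := by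
      rw [ae_iff]; simpa using h0
    filter_upwards [ae_pos_gammaMeasure _ _, h0'] with x hx hx' hxa
    apply hx'
    have hxa : n.τ * (x / n.meanY) ^ n.r = a := hxa
    rw [← hxa, mul_div_cancel_left₀ _ hτ.ne', ← Real.rpow_natCast, ← Real.rpow_mul (by positivity),
      mul_one_div_cancel hr, Real.rpow_one]
    field_simp
  exact measure_eq_zero_iff_ae_notMem.2 hpos

theorem hasComplexMoment_snrLaw {s : ℂ} (hs : -n.ρ < n.r * s.re) :
    HasComplexMoment n.snrLaw s
      ((n.snrScale : ℂ) ^ s * (Complex.Gamma (n.ρ + n.r * s) / Real.Gamma n.ρ)) := by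
  have hm := n.meanY_pos
  have hτ := n.τ_pos
  have hw := n.w_pos
  have hmom := hasComplexMoment_gammaMeasure n.ρ_pos (one_div_pos.2 hw) (s := n.r * s)
    (by simpa using hs)
  have hcm : Measurable fun x : ℝ => (x : ℂ) ^ s := by fun_prop
  have hpw (x : ℝ) (hx : 0 < x) : (((x ^ n.r : ℝ) : ℂ)) ^ s = (x : ℂ) ^ (n.r * s) := by
    rw [← Real.rpow_natCast, Complex.ofReal_cpow hx.le, cpow_ofReal_cpow hx]
    simp
  have hc : 0 < n.τ / n.meanY ^ n.r := by positivity
  have heq : (fun x : ℝ => ((n.τ / n.meanY ^ n.r : ℝ) : ℂ) ^ s * (x : ℂ) ^ (n.r * s))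
      =ᵐ[gammaMeasure n.ρ (1 / n.w)] fun x => ((n.τ * (x / n.meanY) ^ n.r : ℝ) : ℂ) ^ s := by
    filter_upwards [ae_pos_gammaMeasure _ _] with x hx
    rw [← hpw x hx, ← Complex.mul_cpow_ofReal_nonneg hc.le (by positivity), ← Complex.ofReal_mul]
    congr 2
    rw [div_pow]
    ring
  refine ⟨?_, ?_⟩
  · rw [snrLaw, integrable_map_measure hcm.aestronglyMeasurable n.measurable_snr.aemeasurable]
    exact (hmom.1.const_mul _).congr heq
  · rw [complexMoment, snrLaw, integral_map n.measurable_snr.aemeasurable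
      hcm.aestronglyMeasurable, ← integral_congr_ae heq, integral_const_mul,
      show ∫ x : ℝ, (x : ℂ) ^ (n.r * s) ∂gammaMeasure n.ρ (1 / n.w) = _ from hmom.2, ← mul_assoc]
    congr 1
    have hinv : (((1 / n.w : ℝ) : ℂ)) ^ (-(n.r * s)) = (n.w : ℂ) ^ (n.r * s) := by
      rw [one_div, Complex.ofReal_inv, Complex.inv_cpow _ _ (by
        rw [Complex.arg_ofReal_of_nonneg hw.le]; exact Real.pi_pos.ne), Complex.cpow_neg, inv_inv]
    rw [hinv, ← hpw _ hw, ← Complex.mul_cpow_ofReal_nonneg hc.le (by positivity),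
      ← Complex.ofReal_mul, snrScale]
    congr 2
    rw [div_pow]
    ring

end OpticalLink

theorem ofReal_cpow_eq_exp {x : ℝ} (hx : 0 < x) (s : ℂ) :
    (x : ℂ) ^ s = Complex.exp (Real.log x * s) := by
  rw [Complex.cpow_def_of_ne_zero (by exact_mod_cast hx.ne'), Complex.ofReal_log hx.le]

/-- Gauss' multiplication formula for `r = 1` and `r = 2`. -/
theorem prod_Gamma_add_div {r : ℕ} (hr : r = 1 ∨ r = 2) (w : ℂ) :
    ((List.range r).map fun k : ℕ => Complex.Gamma ((k : ℂ) / r + w)).prod =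
      (((2 * Real.pi) ^ (((r : ℝ) - 1) / 2) : ℝ) : ℂ) * (r : ℂ) ^ (1 / 2 - r * w) *
        Complex.Gamma (r * w) := by
  rcases hr with rfl | rfl
  · simp
  · have h := Complex.Gamma_mul_Gamma_add_half w
    simp only [List.range_succ, List.range_zero, List.nil_append, List.map_append, List.map_cons,
      List.map_nil, List.prod_append, List.prod_cons, List.prod_nil, mul_one]
    push_cast
    rw [zero_div, zero_add, add_comm (1 / 2 : ℂ), h, show (1 : ℂ) - 2 * w = 1 / 2 + (1 / 2 - 2 * w) by ring,
      Complex.cpow_add _ _ two_ne_zero]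
    have e : ((2 * Real.pi : ℝ)) ^ (((2 : ℝ) - 1) / 2) = (2 : ℝ) ^ (1 / 2 : ℝ) * Real.sqrt Real.pi := by
      rw [show ((2 : ℝ) - 1) / 2 = 1 / 2 by norm_num, Real.mul_rpow (by norm_num) Real.pi_pos.le,
        Real.sqrt_eq_rpow]
    have e' : (((2 : ℝ) ^ (1 / 2 : ℝ) : ℝ) : ℂ) = (2 : ℂ) ^ (1 / 2 : ℂ) := by
      rw [Complex.ofReal_cpow (by norm_num)]
      norm_num
    rw [e, Complex.ofReal_mul, e']
    ring

namespace OpticalLink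

variable (n : OpticalLink)

theorem log_snrScale : Real.log n.snrScale =
    Real.log n.τ + n.r * (Real.log n.w - Real.log n.meanY) := by
  have h1 := n.meanY_pos
  have h2 := n.w_pos
  have h3 := n.τ_pos
  rw [snrScale, Real.log_mul h3.ne' (by positivity), Real.log_pow, Real.log_div h2.ne' h1.ne']

theorem Υ₁_pos : 0 < n.Υ₁ := by
  have h1 := n.meanY_pos
  have h2 := n.w_pos
  have h3 := n.τ_pos
  have h4 := n.r_cast_pos
  have h5 := Real.Gamma_pos_of_pos n.ρ_pos
  unfold Υ₁; positivity

theorem log_Υ₁ : Real.log n.Υ₁ = n.ρ * Real.log n.meanY - (Real.log n.r +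
    Real.log (Real.Gamma n.ρ) + n.ρ * Real.log n.w + n.ρ / n.r * Real.log n.τ) := by
  have h1 := n.meanY_pos
  have h2 := n.w_pos
  have h3 := n.τ_pos
  have h4 := n.r_cast_pos
  have h5 := Real.Gamma_pos_of_pos n.ρ_pos
  rw [Υ₁, Real.log_div (by positivity) (by positivity), Real.log_mul (by positivity) (by positivity),
    Real.log_mul (by positivity) (by positivity), Real.log_mul (by positivity) (by positivity),
    Real.log_rpow h1, Real.log_rpow h2, Real.log_rpow h3]

theorem Υ₂_pos : 0 < n.Υ₂ := by
  have h1 := n.meanY_pos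
  have h2 := n.w_pos
  have h3 := n.τ_pos
  unfold Υ₂; positivity

theorem log_Υ₂ : Real.log n.Υ₂ = Real.log n.meanY -
    (Real.log n.w + 1 / n.r * Real.log n.τ) := by
  have h1 := n.meanY_pos
  have h2 := n.w_pos
  have h3 := n.τ_pos
  rw [Υ₂, Real.log_div (by positivity) (by positivity), Real.log_mul (by positivity) (by positivity),
    Real.log_rpow h3]

theorem Υ₃_pos : 0 < n.Υ₃ := by
  have h1 := n.meanY_pos
  have h2 := n.w_pos
  have h3 := n.τ_pos
  have h4 := n.r_cast_pos
  have h5 := Real.Gamma_pos_of_pos n.ρ_pos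
  unfold Υ₃; positivity

theorem log_Υ₃ : Real.log n.Υ₃ = n.ρ * Real.log n.meanY - (Real.log n.r / 2 +
    Real.log (Real.Gamma n.ρ) + n.ρ * Real.log n.w + n.ρ / n.r * Real.log n.τ +
    ((n.r : ℝ) - 1) / 2 * Real.log (2 * Real.pi)) := by
  have h1 := n.meanY_pos
  have h2 := n.w_pos
  have h3 := n.τ_pos
  have h4 := n.r_cast_pos
  have h5 := Real.Gamma_pos_of_pos n.ρ_pos
  have hpi : 0 < 2 * Real.pi := by positivity
  rw [Υ₃, Real.log_div (by positivity) (by positivity), Real.log_mul (by positivity) (by positivity),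
    Real.log_mul (by positivity) (by positivity), Real.log_mul (by positivity) (by positivity),
    Real.log_mul (by positivity) (by positivity),
    Real.log_rpow h1, Real.log_rpow h2, Real.log_rpow h3, Real.log_rpow hpi, Real.log_sqrt h4.le]

theorem Υ₄_pos : 0 < n.Υ₄ := by
  have h1 := n.meanY_pos
  have h2 := n.w_pos
  have h3 := n.τ_pos
  have h4 := n.r_cast_pos
  unfold Υ₄; positivity

theorem log_Υ₄ : Real.log n.Υ₄ = n.r * Real.log n.meanY -
    (n.r * Real.log n.r + n.r * Real.log n.w + Real.log n.τ) := by
  have h1 := n.meanY_pos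
  have h2 := n.w_pos
  have h3 := n.τ_pos
  have h4 := n.r_cast_pos
  rw [Υ₄, Real.log_div (by positivity) (by positivity), Real.log_mul (by positivity) (by positivity),
    Real.log_mul (by positivity) (by positivity), Real.log_pow, Real.log_pow, Real.log_pow]

end OpticalLink

/-! ### The second closed form -/

section

variable (φ : ℝ) (D E' : OpticalLink)

/-- The argument `S_D / (φ S_E)` of the Mellin--Barnes integral in terms of the scales `S` of the
SNRs. -/
noncomputable def sop₂Ratio : ℝ := φ⁻¹ * (D.snrScale * E'.snrScale⁻¹)

/-- The constant between the two Mellin--Barnes integrands. -/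
noncomputable def sop₂Const : ℝ :=
  (2 * Real.pi) ^ (((E'.r : ℝ) - 1) / 2) * (2 * Real.pi) ^ (((D.r : ℝ) - 1) / 2) *
    ((E'.r : ℝ) ^ (1 / 2 : ℝ) * (D.r : ℝ) ^ (1 / 2 - D.r * sopζ D E') *
      sop₂Ratio φ D E' ^ (-(E'.ρ / E'.r)))

variable {φ}

theorem sop₂Ratio_pos (hφ : 0 < φ) : 0 < sop₂Ratio φ D E' := by
  have := D.snrScale_pos
  have := E'.snrScale_pos
  unfold sop₂Ratio; positivity

theorem log_sop₂Ratio (hφ : 0 < φ) : Real.log (sop₂Ratio φ D E') =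
    -Real.log φ + (Real.log D.snrScale - Real.log E'.snrScale) := by
  have h1 := D.snrScale_pos
  have h2 := E'.snrScale_pos
  rw [sop₂Ratio, Real.log_mul (by positivity) (by positivity),
    Real.log_mul (by positivity) (by positivity), Real.log_inv, Real.log_inv]
  ring

theorem sop₂Arg_pos (hφ : 0 < φ) : 0 < sop₂Arg φ D E' := by
  have := D.Υ₄_pos
  have := E'.Υ₂_pos
  have := E'.r_cast_pos
  unfold sop₂Arg; positivity

/-- The two arguments differ by the factor `r_D^(r_D) / r_E^(r_E)`, which is what the powers of `r`
in Gauss' formula account for. -/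
theorem log_sop₂Arg (hφ : 0 < φ) : Real.log (sop₂Arg φ D E') =
    Real.log (sop₂Ratio φ D E') - E'.r * Real.log E'.r + D.r * Real.log D.r := by
  have h1 := D.Υ₄_pos
  have h2 := E'.Υ₂_pos
  have h3 := E'.r_cast_pos
  rw [log_sop₂Ratio D E' hφ, D.log_snrScale, E'.log_snrScale, sop₂Arg,
    Real.log_div (by positivity) (by positivity),
    Real.log_mul (by positivity) (by positivity), Real.log_mul (by positivity) (by positivity),
    Real.log_inv, Real.log_pow, Real.log_pow, E'.log_Υ₂, D.log_Υ₄]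
  field_simp
  ring

theorem sop₂Const_pos (hφ : 0 < φ) : 0 < sop₂Const φ D E' := by
  have := sop₂Ratio_pos D E' hφ
  have := D.r_cast_pos
  have := E'.r_cast_pos
  unfold sop₂Const; positivity

theorem coeff_mul_sop₂Const (hφ : 0 < φ) :
    D.Υ₃ * φ ^ (D.ρ / D.r) * E'.Υ₁ *
      (Real.sqrt E'.r * (φ * D.Υ₄) ^ (-sopζ D E') / (2 * Real.pi) ^ (((E'.r : ℝ) - 1) / 2)) *
      sop₂Const φ D E' = (Real.Gamma D.ρ * Real.Gamma E'.ρ)⁻¹ := by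
  have h1 := D.Υ₃_pos
  have h2 := E'.Υ₁_pos
  have h3 := D.Υ₄_pos
  have h4 := D.r_cast_pos
  have h5 := E'.r_cast_pos
  have h6 := sop₂Ratio_pos D E' hφ
  have h7 := Real.Gamma_pos_of_pos D.ρ_pos
  have h8 := Real.Gamma_pos_of_pos E'.ρ_pos
  have hpi : 0 < 2 * Real.pi := by positivity
  have hC := sop₂Const_pos D E' hφ
  have hΥ := D.log_Υ₃
  rw [sop₂Const] at hC ⊢
  -- The number `2π` is kept as one atom, so that expanding logarithms of products does not split
  -- it.
  generalize 2 * Real.pi = P at *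
  refine Real.log_injOn_pos (Set.mem_Ioi.2 (by positivity)) (Set.mem_Ioi.2 (by positivity)) ?_
  rw [Real.log_mul (by positivity) hC.ne', Real.log_mul (by positivity) (by positivity),
    Real.log_mul (by positivity) (by positivity), Real.log_mul (by positivity) (by positivity),
    Real.log_div (by positivity) (by positivity), Real.log_mul (by positivity) (by positivity),
    Real.log_rpow hφ, Real.log_mul (by positivity) (by positivity), Real.log_sqrt h5.le,
    Real.log_rpow (by positivity), Real.log_rpow hpi, Real.log_mul (by positivity) (by positivity),
    Real.log_mul (by positivity) (by positivity), Real.log_mul (by positivity) (by positivity),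
    Real.log_mul (by positivity) (by positivity),
    Real.log_rpow hpi, Real.log_rpow h5, Real.log_rpow h4, Real.log_rpow h6,
    Real.log_inv, Real.log_mul (by positivity) (by positivity), log_sop₂Ratio D E' hφ,
    D.log_snrScale, E'.log_snrScale, hΥ, E'.log_Υ₁, D.log_Υ₄, sopζ]
  simp only [Real.log_rpow hpi]
  field_simp
  ring

/-- Gauss' formula gathers the factors `Γ(k / r_E - s)` into `Γ(-r_E s)` and the factors `Γ(ζ + k /
r_D + s)` into `Γ(r_D (ζ + s))`. In terms of `u = s + ρ_E / r_E` these are `Γ(ρ_E - r_E u)` and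
`Γ(ρ_D + r_D u)`, and the remaining pair is `1 / (-u)`: the Mellin integrand of the outage in the
variable `u`. -/
theorem meijerIntegrand_sop₂ (hφ : 0 < φ) {s : ℂ} (hs : s.re < -(E'.ρ / E'.r)) :
    meijerIntegrand (E'.r + 1) D.r (sop₂Upper D E') (sop₂Lower E') (sop₂Arg φ D E') s =
      sop₂Const φ D E' * ((sop₂Ratio φ D E' : ℂ) ^ (s + (E'.ρ / E'.r : ℝ)) *
        (Complex.Gamma (D.ρ + D.r * (s + (E'.ρ / E'.r : ℝ))) *
          Complex.Gamma (E'.ρ - E'.r * (s + (E'.ρ / E'.r : ℝ)))) / (-(s + (E'.ρ / E'.r : ℝ)))) := by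
  have hD : (D.r : ℂ) ≠ 0 := by exact_mod_cast D.r_cast_pos.ne'
  have hE : (E'.r : ℂ) ≠ 0 := by exact_mod_cast E'.r_cast_pos.ne'
  have hlow : (sop₂Lower E').length = E'.r + 1 := by simp [sop₂Lower]
  have hup : (List.map (fun k : ℕ => 1 - sopζ D E' - (k : ℝ) / D.r) (List.range D.r)).length = D.r := by
    simp
  have e1 := prod_Gamma_add_div E'.r_eq (-s)
  have e2 := prod_Gamma_add_div D.r_eq (sopζ D E' + s)
  have e3 := Gamma_div_Gamma_add_one (w := -(s + (E'.ρ / E'.r : ℝ)))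
    (by simp only [Complex.neg_re, Complex.add_re, Complex.ofReal_re]; linarith)
  have hL : ((sop₂Lower E').map fun x : ℝ => Complex.Gamma ((x : ℂ) - s)).prod =
      (((List.range E'.r).map fun k : ℕ => Complex.Gamma ((k : ℂ) / E'.r + -s)).prod) *
        Complex.Gamma (-(s + (E'.ρ / E'.r : ℝ))) := by
    rw [sop₂Lower, List.map_append, List.prod_append, List.map_map]
    congr 2
    · refine List.map_congr_left fun k _ => ?_
      simp only [Function.comp]
      push_cast
      rw [sub_eq_add_neg]
    · simp only [List.map_cons, List.map_nil, List.prod_cons, List.prod_nil, mul_one]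
      push_cast
      congr 1
      ring
  have hU : (((sop₂Upper D E').take D.r).map fun x : ℝ => Complex.Gamma (1 - (x : ℂ) + s)).prod =
      ((List.range D.r).map fun k : ℕ => Complex.Gamma ((k : ℂ) / D.r + (sopζ D E' + s))).prod := by
    rw [sop₂Upper, List.take_left' hup, List.map_map]
    congr 1
    refine List.map_congr_left fun k _ => ?_
    simp only [Function.comp]
    push_cast
    congr 1
    ring
  rw [meijerIntegrand, List.take_of_length_le hlow.le, List.drop_of_length_le hlow.le, hL, hU, e1, e2,
    sop₂Upper, List.drop_left' hup]
  simp only [List.map_cons, List.map_nil, List.prod_cons, List.prod_nil, mul_one, one_mul]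
  rw [div_eq_mul_inv _ (-(s + _)), ← e3, show ((1 - E'.ρ / E'.r : ℝ) : ℂ) - s =
    -(s + (E'.ρ / E'.r : ℝ)) + 1 by push_cast; ring]
  have hζ : (D.r : ℂ) * (sopζ D E' + s) = D.ρ + D.r * (s + (E'.ρ / E'.r : ℝ)) := by
    rw [sopζ]; push_cast; field_simp; ring
  have hρ : (E'.r : ℂ) * -s = E'.ρ - E'.r * (s + (E'.ρ / E'.r : ℝ)) := by
    push_cast; field_simp; ring
  have hpow : (E'.r : ℂ) ^ (1 / 2 - E'.r * -s : ℂ) * (D.r : ℂ) ^ (1 / 2 - D.r * (sopζ D E' + s) : ℂ) *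
      (sop₂Arg φ D E' : ℂ) ^ s = (((E'.r : ℝ) ^ (1 / 2 : ℝ) * (D.r : ℝ) ^ (1 / 2 - D.r * sopζ D E') *
      sop₂Ratio φ D E' ^ (-(E'.ρ / E'.r)) : ℝ) : ℂ) *
        (sop₂Ratio φ D E' : ℂ) ^ (s + (E'.ρ / E'.r : ℝ)) := by
    have hl := log_sop₂Arg D E' hφ
    have a1 := D.r_cast_pos
    have a2 := E'.r_cast_pos
    have a3 := sop₂Ratio_pos D E' hφ
    rw [Complex.ofReal_mul, Complex.ofReal_mul, Complex.ofReal_cpow a1.le, Complex.ofReal_cpow a2.le,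
      Complex.ofReal_cpow a3.le, ← Complex.ofReal_natCast E'.r, ← Complex.ofReal_natCast D.r,
      ofReal_cpow_eq_exp a1, ofReal_cpow_eq_exp a1, ofReal_cpow_eq_exp a2, ofReal_cpow_eq_exp a2,
      ofReal_cpow_eq_exp a3, ofReal_cpow_eq_exp a3, ofReal_cpow_eq_exp (sop₂Arg_pos D E' hφ), hl]
    simp only [← Complex.exp_add]
    congr 1
    push_cast
    ring
  calc _ = (((2 * Real.pi) ^ (((E'.r : ℝ) - 1) / 2) : ℝ) : ℂ) *
        (((2 * Real.pi) ^ (((D.r : ℝ) - 1) / 2) : ℝ) : ℂ) *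
        ((E'.r : ℂ) ^ (1 / 2 - E'.r * -s : ℂ) * (D.r : ℂ) ^ (1 / 2 - D.r * (sopζ D E' + s) : ℂ) *
          (sop₂Arg φ D E' : ℂ) ^ s) * (Complex.Gamma (D.r * (sopζ D E' + s)) *
          Complex.Gamma (E'.r * -s)) * (Complex.Gamma (-(s + (E'.ρ / E'.r : ℝ))) /
            Complex.Gamma (-(s + (E'.ρ / E'.r : ℝ)) + 1)) := by ring
    _ = _ := by
      rw [hpow, hζ, hρ, sop₂Const]
      push_cast
      ring

/-- The binding parameters are the single negative lower one and the upper one with `k = 0`. -/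
theorem meijerSeparates_sop₂ {c : ℝ} :
    MeijerSeparates (E'.r + 1) D.r (sop₂Upper D E') (sop₂Lower E') c ↔
      c < -(E'.ρ / E'.r) ∧ -sopζ D E' < c := by
  have hlow : (sop₂Lower E').length = E'.r + 1 := by simp [sop₂Lower]
  have hup : (List.map (fun k : ℕ => 1 - sopζ D E' - (k : ℝ) / D.r) (List.range D.r)).length = D.r := by
    simp
  have hD := D.r_cast_pos
  have hE := E'.r_cast_pos
  have hρ := E'.ρ_pos
  have he : 0 < E'.ρ / E'.r := by positivity
  rw [MeijerSeparates, List.take_of_length_le hlow.le, sop₂Upper, List.take_left' hup, sop₂Lower]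
  simp only [List.mem_append, List.mem_map, List.mem_range, List.mem_singleton]
  constructor
  · rintro ⟨h1, h2⟩
    refine ⟨h1 _ (Or.inr rfl), ?_⟩
    have := h2 _ ⟨0, by exact_mod_cast hD, rfl⟩
    simp at this
    linarith
  · rintro ⟨h1, h2⟩
    refine ⟨?_, ?_⟩
    · rintro x (⟨k, -, rfl⟩ | rfl)
      · have : 0 ≤ (k : ℝ) / E'.r := by positivity
        linarith
      · exact h1
    · rintro x ⟨k, -, rfl⟩
      have : 0 ≤ (k : ℝ) / D.r := by positivity
      linarith

theorem optical_line (hφ : 0 < φ) {c : ℝ} (hc : c < -(E'.ρ / E'.r)) (hc' : -sopζ D E' < c) :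
    Integrable (fun t : ℝ => meijerIntegrand (E'.r + 1) D.r (sop₂Upper D E') (sop₂Lower E')
      (sop₂Arg φ D E') ((c : ℂ) + (t : ℂ) * Complex.I)) ∧
    meijerLineIntegral (E'.r + 1) D.r (sop₂Upper D E') (sop₂Lower E') (sop₂Arg φ D E') c =
      (sop₂Const φ D E' * (Real.Gamma D.ρ * Real.Gamma E'.ρ) : ℝ) *
        ((∫ y, D.snrLaw.real (Set.Iic (φ * y)) ∂E'.snrLaw : ℝ) : ℂ) := by
  have hrD := D.r_cast_pos
  have hrE := E'.r_cast_pos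
  have hρD := D.ρ_pos
  have hρE := E'.ρ_pos
  have hGD := Real.Gamma_pos_of_pos hρD
  have hGE := Real.Gamma_pos_of_pos hρE
  have hT := sop₂Ratio_pos D E' hφ
  set e := E'.ρ / E'.r with he
  have heE : E'.r * e = E'.ρ := by rw [he]; field_simp
  have he0 : 0 < e := by positivity
  -- The Mellin line is `Re u = c + e`, which lies between `-ρ_D / r_D` and `0`.
  have hcD : -D.ρ < D.r * (c + e) := by
    have : -(D.ρ / D.r) < c + e := by rw [sopζ] at hc'; linarith
    have h := mul_lt_mul_of_pos_left this hrD
    rwa [mul_neg, mul_div_cancel₀ _ hrD.ne'] at h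
  have hce : c + e < 0 := by linarith
  have hcE : 0 < E'.ρ - E'.r * (c + e) := by nlinarith
  have hre (t : ℝ) : (((c + e : ℝ) : ℂ) + (t : ℂ) * Complex.I).re = c + e := by simp
  have hs (t : ℝ) : (c : ℂ) + (t : ℂ) * Complex.I + (e : ℂ) =
    ((c + e : ℝ) : ℂ) + (t : ℂ) * Complex.I := by push_cast; ring
  have hI (t : ℝ) := meijerIntegrand_sop₂ D E' hφ (s := (c : ℂ) + (t : ℂ) * Complex.I)
    (by simpa using hc)
  rw [← he] at hI
  simp only [hs] at hI
  have hint : Integrable (fun t : ℝ => meijerIntegrand (E'.r + 1) D.r (sop₂Upper D E') (sop₂Lower E')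
      (sop₂Arg φ D E') ((c : ℂ) + (t : ℂ) * Complex.I)) := by
    simp_rw [hI]
    refine Integrable.const_mul ?_ _
    -- The integrand shows only one inverse factor. Raising both Gamma arguments by `1` through `Γ(w
    -- + 1) = w Γ(w)` produces the inverses of `D.ρ / D.r + u` and `e - u` that the decay estimate
    -- asks for.
    have := integrable_Gamma_mul_Gamma_line (a := D.ρ + 1) (b := E'.ρ + 1) (d := e) (e := D.ρ / D.r)
      (m := D.r) (n := E'.r) (z := sop₂Ratio φ D E') (c := c + e) hT (by linarith) (by linarith)
      hce.ne (by linarith) (by rw [sopζ] at hc'; linarith)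
    refine (this.const_mul ((D.r : ℂ)⁻¹ * (E'.r : ℂ)⁻¹)).congr (ae_of_all _ fun t => ?_)
    have g1 := Complex.Gamma_add_one (D.ρ + D.r * (((c + e : ℝ) : ℂ) + (t : ℂ) * Complex.I)) (by
      intro h0
      have := congrArg Complex.re h0
      simp at this
      linarith)
    have g2 := Complex.Gamma_add_one (E'.ρ - E'.r * (((c + e : ℝ) : ℂ) + (t : ℂ) * Complex.I)) (by
      intro h0
      have := congrArg Complex.re h0
      simp at this
      linarith)
    have n1 : (D.ρ / D.r : ℂ) + (((c + e : ℝ) : ℂ) + (t : ℂ) * Complex.I) ≠ 0 := by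
      intro h0
      have := congrArg Complex.re h0
      rw [← Complex.ofReal_natCast, ← Complex.ofReal_div, Complex.add_re, hre, Complex.ofReal_re] at this
      rw [sopζ] at hc'
      simp at this
      linarith
    have n2 : (e : ℂ) - (((c + e : ℝ) : ℂ) + (t : ℂ) * Complex.I) ≠ 0 := by
      intro h0
      have := congrArg Complex.re h0
      simp at this
      linarith
    have hD : (D.r : ℂ) ≠ 0 := by exact_mod_cast hrD.ne'
    have hE : (E'.r : ℂ) ≠ 0 := by exact_mod_cast hrE.ne'
    have r1 : (D.ρ : ℂ) + D.r * (((c + e : ℝ) : ℂ) + (t : ℂ) * Complex.I) =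
      D.r * ((D.ρ / D.r : ℂ) + (((c + e : ℝ) : ℂ) + (t : ℂ) * Complex.I)) := by field_simp
    have r2 : (E'.ρ : ℂ) - E'.r * (((c + e : ℝ) : ℂ) + (t : ℂ) * Complex.I) =
      E'.r * ((e : ℂ) - (((c + e : ℝ) : ℂ) + (t : ℂ) * Complex.I)) := by
      rw [← heE]; push_cast; ring
    have p1 : ((D.ρ + 1 : ℝ) : ℂ) + ((D.r : ℝ) : ℂ) * (((c + e : ℝ) : ℂ) + (t : ℂ) * Complex.I) =
      D.ρ + D.r * (((c + e : ℝ) : ℂ) + (t : ℂ) * Complex.I) + 1 := by push_cast; ring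
    have p2 : ((E'.ρ + 1 : ℝ) : ℂ) - ((E'.r : ℝ) : ℂ) * (((c + e : ℝ) : ℂ) + (t : ℂ) * Complex.I) =
      E'.ρ - E'.r * (((c + e : ℝ) : ℂ) + (t : ℂ) * Complex.I) + 1 := by push_cast; ring
    beta_reduce
    rw [p1, p2, g1, g2]
    generalize Complex.Gamma _ = G₁
    generalize Complex.Gamma _ = G₂
    rw [r1, r2, Complex.ofReal_div D.ρ, Complex.ofReal_natCast]
    generalize (D.ρ / D.r : ℂ) + (((c + e : ℝ) : ℂ) + (t : ℂ) * Complex.I) = u at n1 ⊢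
    generalize (e : ℂ) - (((c + e : ℝ) : ℂ) + (t : ℂ) * Complex.I) = v at n2 ⊢
    field_simp
  refine ⟨hint, ?_⟩
  have := D.isProbabilityMeasure_snrLaw
  have := E'.isProbabilityMeasure_snrLaw
  have hmD (t : ℝ) := (D.hasComplexMoment_snrLaw (s := ((c + e : ℝ) : ℂ) + (t : ℂ) * Complex.I)
    (by rw [hre]; exact hcD)).2
  have hmE (t : ℝ) := (E'.hasComplexMoment_snrLaw (s := -(((c + e : ℝ) : ℂ) + (t : ℂ) * Complex.I))
    (by rw [Complex.neg_re, hre]; linarith)).2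
  have hmul (t : ℝ) : (φ : ℂ) ^ (-(((c + e : ℝ) : ℂ) + t * Complex.I)) *
      (complexMoment D.snrLaw (((c + e : ℝ) : ℂ) + t * Complex.I) *
        complexMoment E'.snrLaw (-(((c + e : ℝ) : ℂ) + t * Complex.I))) /
        (-(((c + e : ℝ) : ℂ) + t * Complex.I)) =
      (sop₂Const φ D E' * (Real.Gamma D.ρ * Real.Gamma E'.ρ) : ℝ)⁻¹ *
      meijerIntegrand (E'.r + 1) D.r (sop₂Upper D E') (sop₂Lower E')
        (sop₂Arg φ D E') ((c : ℂ) + (t : ℂ) * Complex.I) := by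
    have hTpow (s : ℂ) : (sop₂Ratio φ D E' : ℂ) ^ s = (φ : ℂ) ^ (-s) *
        ((D.snrScale : ℂ) ^ s * (E'.snrScale : ℂ) ^ (-s)) := by
      rw [ofReal_cpow_eq_exp hT, ofReal_cpow_eq_exp hφ, ofReal_cpow_eq_exp D.snrScale_pos,
        ofReal_cpow_eq_exp E'.snrScale_pos, log_sop₂Ratio D E' hφ, ← Complex.exp_add,
        ← Complex.exp_add]
      congr 1
      push_cast
      ring
    rw [hmD, hmE, hI, hTpow, mul_neg (E'.r : ℂ), ← sub_eq_add_neg]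
    have k1 : (sop₂Const φ D E' : ℂ) ≠ 0 := by exact_mod_cast (sop₂Const_pos D E' hφ).ne'
    have k2 : (Real.Gamma D.ρ : ℂ) ≠ 0 := by exact_mod_cast hGD.ne'
    have k3 : (Real.Gamma E'.ρ : ℂ) ≠ 0 := by exact_mod_cast hGE.ne'
    rw [Complex.ofReal_inv, Complex.ofReal_mul, Complex.ofReal_mul]
    simp only [div_eq_mul_inv, mul_inv]
    field_simp
  have key := integral_measureReal_Iic_eq_mellin D.ae_pos_snrLaw E'.ae_pos_snrLaw
    (fun a ha => D.snrLaw_singleton ha) hφ hce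
    ((D.hasComplexMoment_snrLaw (s := ((c + e : ℝ) : ℂ))
      (by rw [Complex.ofReal_re]; exact hcD)).integrable_rpow D.ae_pos_snrLaw)
    ((E'.hasComplexMoment_snrLaw (s := ((-(c + e) : ℝ) : ℂ))
      (by rw [Complex.ofReal_re]; linarith)).integrable_rpow E'.ae_pos_snrLaw)
    (by simpa only [hmul] using hint.const_mul _)
  rw [key, meijerLineIntegral]
  simp only [hmul]
  rw [integral_const_mul]
  have k1 : ((sop₂Const φ D E' * (Real.Gamma D.ρ * Real.Gamma E'.ρ) : ℝ) : ℂ) ≠ 0 := by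
    have := sop₂Const_pos D E' hφ
    exact_mod_cast (by positivity)
  rw [Complex.ofReal_inv, mul_left_comm (1 / (2 * Real.pi) : ℂ), mul_inv_cancel_left₀ k1]

theorem exists_meijerSeparates_sop₂ :
    ∃ c, MeijerSeparates (E'.r + 1) D.r (sop₂Upper D E') (sop₂Lower E') c := by
  have h : 0 < D.ρ / D.r := div_pos D.ρ_pos D.r_cast_pos
  refine ⟨-(E'.ρ / E'.r) - D.ρ / D.r / 2, (meijerSeparates_sop₂ D E').2 ⟨by linarith, ?_⟩⟩
  rw [sopζ]
  linarith

theorem meijerGConverges_sop₂ (hφ : 0 < φ) :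
    MeijerGConverges (E'.r + 1) D.r (sop₂Upper D E') (sop₂Lower E') (sop₂Arg φ D E') := by
  refine .of_eq ((sop₂Const φ D E' * (Real.Gamma D.ρ * Real.Gamma E'.ρ) : ℝ) *
    ((∫ y, D.snrLaw.real (Set.Iic (φ * y)) ∂E'.snrLaw : ℝ) : ℂ))
    (exists_meijerSeparates_sop₂ D E') fun c hc => ?_
  obtain ⟨h1, h2⟩ := (meijerSeparates_sop₂ D E').1 hc
  exact optical_line D E' hφ h1 h2

theorem hopSOP_optical (hφ : 0 < φ) :
    (hopSOP φ D.snrLaw E'.snrLaw : ℂ) = sop₂Closed φ D E' := by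
  obtain ⟨c, hc⟩ := exists_meijerSeparates_sop₂ D E'
  obtain ⟨h1, h2⟩ := (meijerSeparates_sop₂ D E').1 hc
  have hval := (optical_line D E' hφ h1 h2).2
  rw [((meijerGConverges_sop₂ D E' hφ).2 c hc).2] at hval
  rw [sop₂Closed, hval, ← mul_assoc, ← Complex.ofReal_mul, ← mul_assoc (_ * _) (sop₂Const φ D E'),
    coeff_mul_sop₂Const D E' hφ, inv_mul_cancel₀, hopSOP]
  · push_cast
    ring
  · have := Real.Gamma_pos_of_pos D.ρ_pos
    have := Real.Gamma_pos_of_pos E'.ρ_pos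
    positivity

end

/-! ### The exact `κ-μ` power -/

/-- The ratio of consecutive terms is of order `1 / k²`. Summability is what keeps the `tsum` in
`besselI` from being the default value `0`. -/
theorem summable_besselI {v x : ℝ} (hv : 0 < v + 1) (hx : 0 < x) :
    Summable fun k : ℕ => (x / 2) ^ (v + 2 * k) / (k.factorial * Real.Gamma (v + k + 1)) := by
  have hG (k : ℕ) : 0 < Real.Gamma (v + k + 1) := by
    have : (0 : ℝ) ≤ k := Nat.cast_nonneg k
    exact Real.Gamma_pos_of_pos (by linarith)
  have hpos (k : ℕ) : 0 < (x / 2) ^ (v + 2 * k) / (k.factorial * Real.Gamma (v + k + 1)) := by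
    have := hG k
    positivity
  refine summable_of_ratio_test_tendsto_lt_one (l := 0) one_pos
    (Filter.Eventually.of_forall fun k => (hpos k).ne') ?_
  have hratio (k : ℕ) : ‖(x / 2) ^ (v + 2 * (k + 1 : ℕ)) /
      ((k + 1).factorial * Real.Gamma (v + (k + 1 : ℕ) + 1))‖ /
      ‖(x / 2) ^ (v + 2 * k) / (k.factorial * Real.Gamma (v + k + 1))‖ =
      (x / 2) ^ 2 / (v + k + 1) * (1 / ((k : ℝ) + 1)) := by
    have h0 : (0 : ℝ) ≤ k := Nat.cast_nonneg k
    have h1 : 0 < v + k + 1 := by linarith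
    have h2 := hG k
    rw [Real.norm_of_nonneg (hpos _).le, Real.norm_of_nonneg (hpos _).le, Nat.factorial_succ]
    push_cast
    rw [show v + 2 * ((k : ℝ) + 1) = v + 2 * k + (2 : ℕ) by push_cast; ring,
      Real.rpow_add (by positivity), Real.rpow_natCast,
      show v + ((k : ℝ) + 1) + 1 = v + k + 1 + 1 by ring, Real.Gamma_add_one h1.ne']
    have : 0 < (x / 2) ^ (v + 2 * k) := by positivity
    field_simp
  simp_rw [hratio]
  have h1 : Filter.Tendsto (fun k : ℕ => (x / 2) ^ 2 / (v + k + 1)) Filter.atTop (nhds 0) := by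
    refine Filter.Tendsto.const_div_atTop ?_ _
    exact Filter.tendsto_atTop_add_const_right _ _
      (Filter.tendsto_atTop_add_const_left _ _ tendsto_natCast_atTop_atTop)
  simpa using h1.mul tendsto_one_div_add_atTop_nhds_zero_nat

/-- The exact law of a `κ-μ` power. -/
noncomputable def kmPowerLaw (κ μ : ℝ) : Measure ℝ :=
  (volume.restrict (Set.Ioi 0)).withDensity fun w =>
    ENNReal.ofReal (kmA κ μ / 2 * w ^ ((μ - 1) / 2) * Real.exp (-(kmB κ μ * w)) *
        besselI (μ - 1) (kmM κ μ * Real.sqrt w))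

/-- The coefficient of `w ^ (μ + k - 1) e ^ (-B w)` in the density of the `κ-μ` power. -/
noncomputable def kmSeriesCoeff (κ μ : ℝ) (k : ℕ) : ℝ :=
  (k.factorial * Real.Gamma (μ + k))⁻¹ * kmCoeff κ μ k

section

variable {κ μ : ℝ}

theorem kmSeriesCoeff_pos (hκ : 0 < κ) (hμ : 0 < μ) (k : ℕ) : 0 < kmSeriesCoeff κ μ k := by
  have := kmCoeff_pos hκ hμ k
  have := Real.Gamma_pos_of_pos (s := μ + k) (by positivity)
  unfold kmSeriesCoeff; positivity

theorem hasSum_kmPower_density (hκ : 0 < κ) (hμ : 0 < μ) {w : ℝ} (hw : 0 < w) :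
    HasSum (fun k : ℕ => kmSeriesCoeff κ μ k * (w ^ (μ + k - 1) * Real.exp (-(kmB κ μ * w))))
      (kmA κ μ / 2 * w ^ ((μ - 1) / 2) * Real.exp (-(kmB κ μ * w)) *
        besselI (μ - 1) (kmM κ μ * Real.sqrt w)) := by
  have hM := kmM_pos hκ hμ
  have hs := (summable_besselI (v := μ - 1) (x := kmM κ μ * Real.sqrt w) (by linarith)
    (by positivity)).hasSum.mul_left (kmA κ μ / 2 * w ^ ((μ - 1) / 2) * Real.exp (-(kmB κ μ * w)))
  refine hs.congr_fun fun k => ?_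
  rw [kmSeriesCoeff, mul_assoc, ← kmPower_term hκ hμ hw, show μ - 1 + k + 1 = μ + k by ring]
  ring

theorem kmPowerLaw_eq (hκ : 0 < κ) (hμ : 0 < μ) :
    kmPowerLaw κ μ = (volume.restrict (Set.Ioi 0)).withDensity fun w => ∑' k : ℕ,
      ENNReal.ofReal (kmSeriesCoeff κ μ k * (w ^ (μ + k - 1) * Real.exp (-(kmB κ μ * w)))) := by
  refine withDensity_congr_ae ?_
  filter_upwards [ae_restrict_mem measurableSet_Ioi] with w hw
  have h := hasSum_kmPower_density hκ hμ hw
  rw [← h.tsum_eq, ENNReal.ofReal_tsum_of_nonneg (fun k => ?_) h.summable]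
  have := kmSeriesCoeff_pos hκ hμ k
  have hw : 0 < w := hw
  positivity

/-- Substitution `w = x²`: the Jacobian `2 x` accounts for the factor `A / 2` and for the exponent
`(μ - 1) / 2` in place of `μ`. -/
theorem map_sq_kmEnvelopeLaw (κ μ : ℝ) :
    (kmEnvelopeLaw κ μ).map (fun x => x ^ 2) = kmPowerLaw κ μ := by
  ext s hs
  have hmeas : Measurable fun x : ℝ => x ^ 2 := by fun_prop
  have himg : (fun x : ℝ => x ^ 2) '' ((fun x : ℝ => x ^ 2) ⁻¹' s ∩ Set.Ioi 0) = s ∩ Set.Ioi 0 := by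
    ext w
    constructor
    · rintro ⟨x, ⟨hx, hx0⟩, rfl⟩
      exact ⟨hx, pow_pos (Set.mem_Ioi.1 hx0) 2⟩
    · rintro ⟨hw, hw0⟩
      have hw0 : 0 < w := hw0
      exact ⟨Real.sqrt w, ⟨by simpa [Real.sq_sqrt hw0.le] using hw, Real.sqrt_pos.2 hw0⟩,
        Real.sq_sqrt hw0.le⟩
  rw [Measure.map_apply hmeas hs, kmEnvelopeLaw, kmPowerLaw, withDensity_apply _ (hmeas hs),
    withDensity_apply _ hs, Measure.restrict_restrict (hmeas hs), Measure.restrict_restrict hs,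
    ← himg, lintegral_image_eq_lintegral_abs_deriv_mul ((hmeas hs).inter measurableSet_Ioi)
      (f' := fun x => 2 * x) (fun x _ => by simpa using (hasDerivAt_pow 2 x).hasDerivWithinAt)
      (fun x hx y hy h => (pow_left_inj₀ (le_of_lt hx.2) (le_of_lt hy.2) two_ne_zero).1 h)]
  refine setLIntegral_congr_fun ((hmeas hs).inter measurableSet_Ioi) fun x hx => ?_
  have hx0 : 0 < x := hx.2
  rw [← ENNReal.ofReal_mul (by positivity), abs_of_pos (by positivity), Real.sqrt_sq hx0.le,
    ← Real.rpow_natCast x 2, ← Real.rpow_mul hx0.le,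
    show ((2 : ℕ) : ℝ) * ((μ - 1) / 2) = μ - 1 by push_cast; ring, Real.rpow_sub_one hx0.ne']
  congr 1
  field_simp

theorem lintegral_rpow_mul_exp_neg_mul {a b : ℝ} (ha : 0 < a) (hb : 0 < b) :
    ∫⁻ w in Set.Ioi (0 : ℝ), ENNReal.ofReal (w ^ (a - 1) * Real.exp (-(b * w))) =
      ENNReal.ofReal ((1 / b) ^ a * Real.Gamma a) := by
  have hval := Real.integral_rpow_mul_exp_neg_mul_Ioi ha hb
  have hG := Real.Gamma_pos_of_pos ha
  rw [← hval, ofReal_integral_eq_lintegral_ofReal]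
  · refine not_imp_comm.1 integral_undef ?_
    rw [hval]
    positivity
  · filter_upwards [ae_restrict_mem measurableSet_Ioi] with w hw
    have hw : 0 < w := hw
    positivity

theorem hasSum_pow_div_factorial (x : ℝ) :
    HasSum (fun k : ℕ => x ^ k / k.factorial) (Real.exp x) := by
  rw [Real.exp_eq_exp_ℝ]
  exact NormedSpace.expSeries_div_hasSum_exp x

/-- With `r = B / (B - t)`, the `k`-th Gamma term contributes its Poisson weight times `r^(μ + k)`,
and the exponential series sums these. The case `t = 0` shows that the law has mass one. -/
theorem lintegral_exp_kmPowerLaw (hκ : 0 < κ) (hμ : 0 < μ) {t : ℝ} (ht : t < kmB κ μ) :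
    ∫⁻ w, ENNReal.ofReal (Real.exp (t * w)) ∂kmPowerLaw κ μ = ENNReal.ofReal
      ((kmB κ μ / (kmB κ μ - t)) ^ μ * Real.exp (μ * κ * (kmB κ μ / (kmB κ μ - t) - 1))) := by
  have hB := kmB_pos hκ hμ
  have hBt : 0 < kmB κ μ - t := by linarith
  have hm (k : ℕ) : Measurable fun w : ℝ => ENNReal.ofReal
      (kmSeriesCoeff κ μ k * (w ^ (μ + k - 1) * Real.exp (-(kmB κ μ * w)))) := by fun_prop
  rw [kmPowerLaw_eq hκ hμ, lintegral_withDensity_eq_lintegral_mul _ (Measurable.tsum hm)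
    (by fun_prop)]
  simp only [Pi.mul_apply, ← ENNReal.tsum_mul_right]
  rw [lintegral_tsum fun k => by fun_prop]
  set r := kmB κ μ / (kmB κ μ - t) with hr
  have hr0 : 0 < r := by positivity
  have hterm (k : ℕ) : ∫⁻ w in Set.Ioi (0 : ℝ), ENNReal.ofReal
      (kmSeriesCoeff κ μ k * (w ^ (μ + k - 1) * Real.exp (-(kmB κ μ * w)))) *
        ENNReal.ofReal (Real.exp (t * w)) = ENNReal.ofReal
      (Real.exp (-(μ * κ)) * r ^ μ * ((μ * κ * r) ^ k / k.factorial)) := by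
    have hc := kmSeriesCoeff_pos hκ hμ k
    have hk : 0 < μ + k := by positivity
    have hG := Real.Gamma_pos_of_pos hk
    have : ∀ w ∈ Set.Ioi (0 : ℝ), ENNReal.ofReal
      (kmSeriesCoeff κ μ k * (w ^ (μ + k - 1) * Real.exp (-(kmB κ μ * w)))) *
        ENNReal.ofReal (Real.exp (t * w)) = ENNReal.ofReal (kmSeriesCoeff κ μ k) *
        ENNReal.ofReal (w ^ (μ + k - 1) * Real.exp (-((kmB κ μ - t) * w))) := by
      intro w hw
      have hw : 0 < w := hw
      rw [← ENNReal.ofReal_mul (by positivity), ← ENNReal.ofReal_mul hc.le,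
        show -((kmB κ μ - t) * w) = -(kmB κ μ * w) + t * w by ring, Real.exp_add]
      congr 1
      ring
    rw [setLIntegral_congr_fun measurableSet_Ioi this, lintegral_const_mul _ (by fun_prop),
      lintegral_rpow_mul_exp_neg_mul hk hBt, ← ENNReal.ofReal_mul hc.le]
    congr 1
    have e : r ^ (μ + k) = kmB κ μ ^ (μ + k) * (1 / (kmB κ μ - t)) ^ (μ + k) := by
      rw [← Real.mul_rpow hB.le (by positivity), hr]
      congr 1
      ring
    rw [Real.rpow_add hr0, Real.rpow_natCast] at e
    calc _ = (k.factorial : ℝ)⁻¹ * (Real.exp (-(μ * κ)) * (μ * κ) ^ k) *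
          (kmB κ μ ^ (μ + k) * (1 / (kmB κ μ - t)) ^ (μ + k)) := by
          rw [kmSeriesCoeff, kmCoeff]
          field_simp
      _ = _ := by
          rw [← e, mul_pow]
          ring
  simp_rw [hterm]
  have hexp := (hasSum_pow_div_factorial (μ * κ * r)).mul_left (Real.exp (-(μ * κ)) * r ^ μ)
  rw [← ENNReal.ofReal_tsum_of_nonneg (fun k => by positivity) hexp.summable, hexp.tsum_eq,
    show μ * κ * (r - 1) = -(μ * κ) + μ * κ * r by ring, Real.exp_add]
  congr 1
  ring

theorem isProbabilityMeasure_kmPowerLaw (hκ : 0 < κ) (hμ : 0 < μ) :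
    IsProbabilityMeasure (kmPowerLaw κ μ) := by
  have h := lintegral_exp_kmPowerLaw hκ hμ (t := 0) (kmB_pos hκ hμ)
  constructor
  simpa [(kmB_pos hκ hμ).ne'] using h

theorem isProbabilityMeasure_kmEnvelopeLaw (hκ : 0 < κ) (hμ : 0 < μ) :
    IsProbabilityMeasure (kmEnvelopeLaw κ μ) := by
  have h := (isProbabilityMeasure_kmPowerLaw hκ hμ).measure_univ
  constructor
  rw [← map_sq_kmEnvelopeLaw, Measure.map_apply (by fun_prop) MeasurableSet.univ] at h
  simpa using h

theorem integrable_exp_kmPowerLaw (hκ : 0 < κ) (hμ : 0 < μ) {t : ℝ} (ht : t < kmB κ μ) :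
    Integrable (fun w => Real.exp (t * w)) (kmPowerLaw κ μ) := by
  have hm : Measurable fun w => Real.exp (t * w) := by fun_prop
  refine ⟨hm.aestronglyMeasurable, ?_⟩
  rw [hasFiniteIntegral_iff_ofReal (ae_of_all _ fun w => (Real.exp_pos _).le),
    lintegral_exp_kmPowerLaw hκ hμ ht]
  exact ENNReal.ofReal_lt_top

theorem integral_exp_kmPowerLaw (hκ : 0 < κ) (hμ : 0 < μ) {t : ℝ} (ht : t < kmB κ μ) :
    ∫ w, Real.exp (t * w) ∂kmPowerLaw κ μ = (kmB κ μ / (kmB κ μ - t)) ^ μ *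
      Real.exp (μ * κ * (kmB κ μ / (kmB κ μ - t) - 1)) := by
  have hm : Measurable fun w => Real.exp (t * w) := by fun_prop
  have hB := kmB_pos hκ hμ
  have hBt : 0 < kmB κ μ - t := by linarith
  rw [integral_eq_lintegral_of_nonneg_ae (ae_of_all _ fun w => (Real.exp_pos _).le)
    hm.aestronglyMeasurable, lintegral_exp_kmPowerLaw hκ hμ ht, ENNReal.toReal_ofReal (by positivity)]

end

/-! ### Laws with the same moment generating function near `0` -/

/-- Both complex moment generating functions are analytic on the strip `|Re z| < δ` and agree on a
real interval, hence on the strip. On the imaginary axis they are the characteristic functions,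
which determine the laws. -/
theorem map_eq_map_of_mgf_eq {Ω Ω' : Type*} [MeasurableSpace Ω] [MeasurableSpace Ω']
    {P : Measure Ω} {P' : Measure Ω'} [IsProbabilityMeasure P] [IsProbabilityMeasure P']
    {X : Ω → ℝ} {Y : Ω' → ℝ} (hX : Measurable X) (hY : Measurable Y) {δ : ℝ} (hδ : 0 < δ)
    (hXi : ∀ t ∈ Set.Ioo (-δ) δ, Integrable (fun ω => Real.exp (t * X ω)) P)
    (hYi : ∀ t ∈ Set.Ioo (-δ) δ, Integrable (fun ω => Real.exp (t * Y ω)) P')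
    (h : ∀ t ∈ Set.Ioo (-δ) δ, mgf X P t = mgf Y P' t) : P.map X = P'.map Y := by
  have := Measure.isProbabilityMeasure_map hX.aemeasurable (μ := P)
  have := Measure.isProbabilityMeasure_map hY.aemeasurable (μ := P')
  set S : Set ℂ := {z | z.re ∈ Set.Ioo (-δ) δ} with hS
  have hXa : AnalyticOnNhd ℂ (complexMGF X P) S := analyticOnNhd_complexMGF.mono fun z hz =>
    interior_maximal (s := integrableExpSet X P) (fun t ht => hXi t ht) isOpen_Ioo hz
  have hYa : AnalyticOnNhd ℂ (complexMGF Y P') S := analyticOnNhd_complexMGF.mono fun z hz =>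
    interior_maximal (s := integrableExpSet Y P') (fun t ht => hYi t ht) isOpen_Ioo hz
  have h0 : (0 : ℂ) ∈ S := by simp [hS, hδ]
  have heq : Set.EqOn (complexMGF X P) (complexMGF Y P') S := by
    refine hXa.eqOn_of_preconnected_of_frequently_eq hYa
      ((convex_Ioo (-δ) δ).linear_preimage Complex.reLm).isPreconnected h0 ?_
    -- Real points accumulate at `0` within the strip, as the identity theorem requires.
    have hlim : Filter.Tendsto (fun x : ℝ => (x : ℂ)) (nhdsWithin 0 {0}ᶜ)
        (nhdsWithin (0 : ℂ) {0}ᶜ) := by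
      refine tendsto_nhdsWithin_of_tendsto_nhds_of_eventually_within _ ?_ ?_
      · exact (Complex.continuous_ofReal.tendsto' 0 0 (by simp)).mono_left nhdsWithin_le_nhds
      · filter_upwards [self_mem_nhdsWithin] with x hx
        simpa using hx
    refine hlim.frequently (Filter.Eventually.frequently ?_)
    filter_upwards [nhdsWithin_le_nhds (Ioo_mem_nhds (by linarith : -δ < 0) hδ)] with x hx
    rw [complexMGF_ofReal, complexMGF_ofReal, h x hx]
  refine Measure.ext_of_charFun ?_
  ext t
  have ht := heq (x := t * Complex.I) (by simp [hS, hδ])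
  rw [charFun_apply_real, charFun_apply_real, integral_map hX.aemeasurable (by fun_prop),
    integral_map hY.aemeasurable (by fun_prop)]
  simp only [complexMGF] at ht
  convert ht using 3 <;> ring_nf

/-- The `L`-th power of `r^μ exp(μκ(r - 1))` replaces `μ` by `L μ`. The rate becomes `L B` and the
right side evaluates at `L t`, so `r = B / (B - t)` is unchanged. -/
theorem map_sum_sq_kmEnvelopeLaw {κ μ : ℝ} (hκ : 0 < κ) (hμ : 0 < μ) {L : ℕ} (hL : 0 < L) :
    (Measure.pi fun _ : Fin L => kmEnvelopeLaw κ μ).map (fun x : Fin L → ℝ => ∑ l, x l ^ 2) =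
      (kmPowerLaw κ (L * μ)).map fun w : ℝ => (L : ℝ) * w := by
  have hL' : (0 : ℝ) < L := Nat.cast_pos.2 hL
  have hLμ : 0 < L * μ := by positivity
  have := isProbabilityMeasure_kmEnvelopeLaw hκ hμ
  have := isProbabilityMeasure_kmPowerLaw hκ hLμ
  have hB := kmB_pos hκ hμ
  have hBL : kmB κ (L * μ) = L * kmB κ μ := by unfold kmB; ring
  have hsq : Measurable fun x : ℝ => x ^ 2 := by fun_prop
  have hexp (t : ℝ) : (fun x : Fin L → ℝ => Real.exp (t * ∑ l, x l ^ 2)) =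
      fun x => ∏ l, Real.exp (t * x l ^ 2) := by
    ext x
    rw [Finset.mul_sum, Real.exp_sum]
  have henv (t : ℝ) (ht : t < kmB κ μ) :
      Integrable (fun x => Real.exp (t * x ^ 2)) (kmEnvelopeLaw κ μ) := by
    have h := integrable_exp_kmPowerLaw hκ hμ ht
    rw [← map_sq_kmEnvelopeLaw, integrable_map_measure (by fun_prop) hsq.aemeasurable] at h
    exact h
  have hpow (t : ℝ) (ht : t < kmB κ μ) : L * t < kmB κ (L * μ) := by
    rw [hBL]
    exact mul_lt_mul_of_pos_left ht hL'
  have hmul (t w : ℝ) : t * (L * w) = L * t * w := by ring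
  refine map_eq_map_of_mgf_eq (δ := kmB κ μ) (by fun_prop) (by fun_prop) hB (fun t ht => ?_)
    (fun t ht => ?_) fun t ht => ?_
  · rw [hexp]
    exact Integrable.fintype_prod fun _ => henv t ht.2
  · simp_rw [hmul]
    exact integrable_exp_kmPowerLaw hκ hLμ (hpow t ht.2)
  · rw [mgf, mgf, hexp, integral_fintype_prod_eq_pow (fun x : ℝ => Real.exp (t * x ^ 2))]
    simp_rw [hmul]
    rw [integral_exp_kmPowerLaw hκ hLμ (hpow t ht.2)]
    have h := integral_exp_kmPowerLaw hκ hμ ht.2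
    rw [← map_sq_kmEnvelopeLaw, integral_map hsq.aemeasurable (by fun_prop)] at h
    have hBt : 0 < kmB κ μ - t := by linarith [ht.2]
    rw [h, Fintype.card_fin, mul_pow, ← Real.rpow_natCast, ← Real.rpow_mul (by positivity),
      ← Real.exp_nat_mul, hBL, ← mul_sub, mul_div_mul_left _ _ hL'.ne', mul_comm μ (L : ℝ)]
    congr 2
    ring

/-- The combiner output is one `κ-μ` branch with parameters `κ`, `L μ` and average SNR `L γbar`. -/
theorem RFLink.snrLaw_eq (j : RFLink) :
    j.snrLaw = ((rwpLaw j.D).prod (kmPowerLaw j.κ (j.L * j.μ))).map fun x =>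
      j.ϱ * x.2 * x.1 ^ (-j.α) * (j.L * j.γbar) := by
  have := isProbabilityMeasure_kmEnvelopeLaw j.κ_pos j.μ_pos
  have := isProbabilityMeasure_kmPowerLaw j.κ_pos j.L_mul_μ_pos
  have hm : Measurable fun x : ℝ × ℝ => j.ϱ * x.2 * x.1 ^ (-j.α) * j.γbar := by fun_prop
  have hS : Measurable fun x : Fin j.L → ℝ => ∑ l, x l ^ 2 := by fun_prop
  have hmulL : Measurable fun w : ℝ => j.L * w := by fun_prop
  have h1 : j.snrLaw = ((rwpLaw j.D).prod ((Measure.pi fun _ : Fin j.L =>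
      kmEnvelopeLaw j.κ j.μ).map fun x => ∑ l, x l ^ 2)).map
        fun x => j.ϱ * x.2 * x.1 ^ (-j.α) * j.γbar := by
    rw [← Measure.map_id (μ := rwpLaw j.D), Measure.map_prod_map _ _ measurable_id hS,
      Measure.map_map hm (measurable_id.prodMap hS), snrLaw]
    congr 1
    ext x
    simp only [Function.comp, Prod.map, id, Finset.mul_sum, Finset.sum_mul]
  rw [h1, map_sum_sq_kmEnvelopeLaw j.κ_pos j.μ_pos j.L_pos, ← Measure.map_id (μ := rwpLaw j.D),
    Measure.map_prod_map _ _ measurable_id hmulL, Measure.map_map hm (measurable_id.prodMap hmulL),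
    Measure.map_id]
  congr 1
  ext x
  simp only [Function.comp, Prod.map, id]
  ring

theorem RFLink.isProbabilityMeasure_snrLaw (j : RFLink) : IsProbabilityMeasure j.snrLaw := by
  have := isProbabilityMeasure_rwpLaw j.D_pos
  have := isProbabilityMeasure_kmPowerLaw j.κ_pos j.L_mul_μ_pos
  rw [j.snrLaw_eq]
  exact Measure.isProbabilityMeasure_map (by fun_prop)

/-! ### Convergence of the approximations -/

/-- `V(k, p, v)` without the factor `1 / (k! Γ(v + k + 1))`. -/
noncomputable def besselRatio (p k : ℕ) : ℝ :=
  Real.Gamma (p + k) * (p : ℝ) ^ (1 - 2 * (k : ℝ)) / Real.Gamma (p - k + 1)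

theorem besselV_eq (k p : ℕ) (v : ℝ) :
    besselV k p v = besselRatio p k * (k.factorial * Real.Gamma (v + k + 1))⁻¹ := by
  rw [besselV, besselRatio, Real.Gamma_nat_eq_factorial]
  simp only [div_eq_mul_inv, mul_inv]
  ring

theorem besselRatio_zero {p : ℕ} (hp : 1 ≤ p) : besselRatio p 0 = 1 := by
  have hp' : (0 : ℝ) < p := by exact_mod_cast hp
  have := Real.Gamma_pos_of_pos hp'
  simp only [besselRatio, Nat.cast_zero, add_zero, mul_zero, sub_zero, Real.rpow_one]
  rw [Real.Gamma_add_one hp'.ne']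
  field_simp

/-- Iterating, the ratio is the product of `1 - (m / p)²` over `m < k`. This gives both the bounds
`[0, 1]` and the limit `1` for fixed `k`. -/
theorem besselRatio_succ {p k : ℕ} (hk : k + 1 ≤ p) :
    besselRatio p (k + 1) = besselRatio p k * (1 - ((k : ℝ) / p) ^ 2) := by
  have hk' : (k : ℝ) + 1 ≤ p := by exact_mod_cast hk
  have h0 : (0 : ℝ) ≤ k := Nat.cast_nonneg k
  have hp : (0 : ℝ) < p := by linarith
  have h1 : (p : ℝ) + k ≠ 0 := by linarith
  have h2 : 0 < (p : ℝ) - k := by linarith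
  have h3 := Real.Gamma_pos_of_pos h2
  rw [besselRatio, besselRatio]
  push_cast
  rw [← add_assoc, Real.Gamma_add_one h1, show (p : ℝ) - (k + 1) + 1 = p - k by ring,
    Real.Gamma_add_one h2.ne', show (1 : ℝ) - 2 * (k + 1) = 1 - 2 * k - (2 : ℕ) by push_cast; ring,
    Real.rpow_sub hp, Real.rpow_natCast]
  field_simp
  ring

theorem besselRatio_mem {p k : ℕ} (hp : 1 ≤ p) (hk : k ≤ p) :
    0 ≤ besselRatio p k ∧ besselRatio p k ≤ 1 := by
  induction k with
  | zero => simp [besselRatio_zero hp]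
  | succ k ih =>
    obtain ⟨h0, h1⟩ := ih (by omega)
    have hkp : (k : ℝ) / p ≤ 1 := by
      rw [div_le_one (by exact_mod_cast hp)]
      exact_mod_cast (by omega : k ≤ p)
    have hk0 : 0 ≤ (k : ℝ) / p := by positivity
    have h2 : ((k : ℝ) / p) ^ 2 ≤ 1 := pow_le_one₀ hk0 hkp
    rw [besselRatio_succ hk]
    refine ⟨mul_nonneg h0 (by linarith), mul_le_one₀ h1 (by linarith) (by nlinarith)⟩

theorem tendsto_besselRatio (k : ℕ) :
    Filter.Tendsto (fun p => besselRatio p k) Filter.atTop (nhds 1) := by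
  induction k with
  | zero =>
    refine tendsto_const_nhds.congr' ?_
    filter_upwards [Filter.eventually_ge_atTop 1] with p hp using (besselRatio_zero hp).symm
  | succ k ih =>
    have h : Filter.Tendsto (fun p : ℕ => besselRatio p k * (1 - ((k : ℝ) / p) ^ 2)) Filter.atTop
        (nhds (1 * (1 - 0 ^ 2))) :=
      ih.mul (tendsto_const_nhds.sub ((tendsto_const_div_atTop_nhds_zero_nat (k : ℝ)).pow 2))
    refine (h.congr' ?_).trans (by simp)
    filter_upwards [Filter.eventually_ge_atTop (k + 1)] with p hp using (besselRatio_succ hp).symm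

theorem besselV_mul_kmCoeff (p k : ℕ) (κ μ : ℝ) :
    besselV k p (μ - 1) * kmCoeff κ μ k = besselRatio p k * kmSeriesCoeff κ μ k := by
  rw [besselV_eq, kmSeriesCoeff, show μ - 1 + k + 1 = μ + k by ring, mul_assoc]

/-- Each retained term is multiplied by a factor at most `1` and the nonnegative tail is dropped.
Domination as measures then passes to images and products. -/
theorem kmPowerApprox_le {p : ℕ} (hp : 1 ≤ p) {κ μ : ℝ} (hκ : 0 < κ) (hμ : 0 < μ) :
    kmPowerApprox p κ μ ≤ kmPowerLaw κ μ := by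
  rw [kmPowerApprox_eq p hκ hμ, kmPowerLaw_eq hκ hμ]
  refine withDensity_mono ?_
  filter_upwards [ae_restrict_mem measurableSet_Ioi] with w hw
  have hw : 0 < w := hw
  have hterm (k : ℕ) : 0 ≤ kmSeriesCoeff κ μ k * (w ^ (μ + k - 1) * Real.exp (-(kmB κ μ * w))) := by
    have := kmSeriesCoeff_pos hκ hμ k
    positivity
  refine le_trans (ENNReal.ofReal_le_ofReal (Finset.sum_le_sum (g := fun k : ℕ =>
    kmSeriesCoeff κ μ k * (w ^ (μ + k - 1) * Real.exp (-(kmB κ μ * w)))) fun k hk => ?_)) ?_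
  · rw [besselV_mul_kmCoeff, mul_assoc]
    exact mul_le_of_le_one_left (hterm k)
      (besselRatio_mem hp (Nat.lt_succ_iff.1 (Finset.mem_range.1 hk))).2
  · rw [ENNReal.ofReal_sum_of_nonneg fun k _ => hterm k]
    exact ENNReal.sum_le_tsum _

/-- The mass is the sum over `k ≤ p` of the Poisson weights of parameter `μ κ` times `besselRatio p
k`. The weights themselves dominate and sum to `1`. -/
theorem tendsto_kmPowerApprox_univ {κ μ : ℝ} (hκ : 0 < κ) (hμ : 0 < μ) :
    Filter.Tendsto (fun p => (kmPowerApprox p κ μ).real Set.univ) Filter.atTop (nhds 1) := by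
  set g : ℕ → ℝ := fun k => Real.exp (-(μ * κ)) * ((μ * κ) ^ k / k.factorial) with hg
  have hg0 (k : ℕ) : 0 ≤ g k := by positivity
  have hgsum : HasSum g 1 := by
    have := (hasSum_pow_div_factorial (μ * κ)).mul_left (Real.exp (-(μ * κ)))
    rwa [← Real.exp_add, neg_add_cancel, Real.exp_zero] at this
  have hmass : ∀ p : ℕ, 1 ≤ p → (kmPowerApprox p κ μ).real Set.univ =
      ∑' k, if k ∈ Finset.range (p + 1) then besselRatio p k * g k else 0 := by
    intro p hp
    have h := (hasComplexMoment_kmPowerApprox hp hκ hμ (s := 0) (by simpa)).measureReal_univ.2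
    rw [tsum_eq_sum (s := Finset.range (p + 1)) fun k hk => if_neg hk,
      Finset.sum_congr rfl fun k hk => if_pos hk]
    apply Complex.ofReal_injective
    rw [h]
    push_cast
    refine Finset.sum_congr rfl fun k _ => ?_
    have hG := Real.Gamma_pos_of_pos (s := μ + k) (by positivity)
    have e : besselV k p (μ - 1) * (Real.exp (-(μ * κ)) * (μ * κ) ^ k) * Real.Gamma (μ + k) =
        besselRatio p k * g k := by
      rw [besselV_eq, show μ - 1 + k + 1 = μ + k by ring, hg]
      field_simp
    rw [neg_zero, Complex.cpow_zero, one_mul, add_zero, ← Complex.ofReal_natCast k,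
      ← Complex.ofReal_add, Complex.Gamma_ofReal]
    exact_mod_cast e
  have hlim : Filter.Tendsto (fun p : ℕ => ∑' k, if k ∈ Finset.range (p + 1) then
      besselRatio p k * g k else 0) Filter.atTop (nhds (∑' k, g k)) := by
    refine tendsto_tsum_of_dominated_convergence (bound := g) hgsum.summable (fun k => ?_) ?_
    · have h := (tendsto_besselRatio k).mul_const (g k)
      rw [one_mul] at h
      refine h.congr' ?_
      filter_upwards [Filter.eventually_ge_atTop k] with p hp
      rw [if_pos (Finset.mem_range.2 (by omega))]
    · filter_upwards [Filter.eventually_ge_atTop 1] with p hp k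
      split_ifs with hk
      · obtain ⟨h0, h1⟩ := besselRatio_mem hp (Nat.lt_succ_iff.1 (Finset.mem_range.1 hk))
        rw [Real.norm_of_nonneg (mul_nonneg h0 (hg0 k))]
        exact mul_le_of_le_one_left (hg0 k) h1
      · simpa using hg0 k
  rw [hgsum.tsum_eq] at hlim
  refine hlim.congr' ?_
  filter_upwards [Filter.eventually_ge_atTop 1] with p hp using (hmass p hp).symm

namespace RFLink

variable (j : RFLink)

theorem snrApprox_le {p : ℕ} (hp : 1 ≤ p) : j.snrApprox p ≤ j.snrLaw := by
  have := isProbabilityMeasure_kmPowerLaw j.κ_pos j.L_mul_μ_pos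
  rw [j.snrLaw_eq, snrApprox]
  exact Measure.map_mono (Measure.prod_mono le_rfl (kmPowerApprox_le hp j.κ_pos j.L_mul_μ_pos))
    (by fun_prop)

theorem tendsto_snrApprox_univ :
    Filter.Tendsto (fun p => (j.snrApprox p).real Set.univ) Filter.atTop (nhds 1) := by
  have := isProbabilityMeasure_rwpLaw j.D_pos
  refine (tendsto_kmPowerApprox_univ j.κ_pos j.L_mul_μ_pos).congr fun p => ?_
  rw [measureReal_def, measureReal_def, snrApprox, Measure.map_apply (by fun_prop) MeasurableSet.univ,
    Set.preimage_univ, ← Set.univ_prod_univ, Measure.prod_prod, measure_univ (μ := rwpLaw j.D), one_mul]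

end RFLink

/-- The deficit on `s` and the deficit on its complement are both nonnegative and add up to the
total deficit. -/
theorem measureReal_sub_le_of_le {α : Type*} [MeasurableSpace α] {P Q : Measure α}
    [IsFiniteMeasure Q] (h : P ≤ Q) {s : Set α} (hs : MeasurableSet s) :
    0 ≤ Q.real s - P.real s ∧ Q.real s - P.real s ≤ Q.real Set.univ - P.real Set.univ := by
  have : IsFiniteMeasure P := isFiniteMeasure_of_le Q h
  have hmono (t : Set α) : P.real t ≤ Q.real t :=
    ENNReal.toReal_mono (measure_ne_top _ _) (h t)
  have h1 := measureReal_add_measureReal_compl (μ := P) hs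
  have h2 := measureReal_add_measureReal_compl (μ := Q) hs
  have h3 := hmono s
  have h4 := hmono sᶜ
  exact ⟨by linarith, by linarith⟩

/-- The product of the approximate laws is dominated by the product of the exact ones, so the outage
error lies between `0` and the missing mass of the product, which tends to `0`. -/
theorem tendsto_hopSOP_snrApprox (R E : RFLink) (φ : ℝ) :
    Filter.Tendsto (fun p => hopSOP φ (R.snrApprox p) (E.snrApprox p)) Filter.atTop
      (nhds (hopSOP φ R.snrLaw E.snrLaw)) := by
  have := R.isProbabilityMeasure_snrLaw
  have := E.isProbabilityMeasure_snrLaw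
  have hsm := measurableSet_le_mul φ
  have hprod : Filter.Tendsto (fun p => 1 - (R.snrApprox p).real Set.univ *
      (E.snrApprox p).real Set.univ) Filter.atTop (nhds 0) := by
    have h := (R.tendsto_snrApprox_univ.mul E.tendsto_snrApprox_univ).const_sub 1
    simpa using h
  have key : ∀ p : ℕ, 1 ≤ p →
      0 ≤ hopSOP φ (R.snrApprox p) (E.snrApprox p) - hopSOP φ R.snrLaw E.snrLaw ∧
      hopSOP φ (R.snrApprox p) (E.snrApprox p) - hopSOP φ R.snrLaw E.snrLaw ≤
        1 - (R.snrApprox p).real Set.univ * (E.snrApprox p).real Set.univ := by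
    intro p hp
    have := R.isFiniteMeasure_snrApprox hp
    have := E.isFiniteMeasure_snrApprox hp
    have h := measureReal_sub_le_of_le
      (Measure.prod_mono (R.snrApprox_le hp) (E.snrApprox_le hp)) hsm
    have hu : ((R.snrApprox p).prod (E.snrApprox p)).real Set.univ =
        (R.snrApprox p).real Set.univ * (E.snrApprox p).real Set.univ := by
      rw [← Set.univ_prod_univ, measureReal_prod_prod]
    rw [hu, probReal_univ] at h
    rw [hopSOP, hopSOP, integral_measureReal_Iic_mul, integral_measureReal_Iic_mul]
    exact ⟨by linarith [h.1], by linarith [h.2]⟩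
  rw [← tendsto_sub_nhds_zero_iff]
  refine tendsto_of_tendsto_of_tendsto_of_le_of_le' tendsto_const_nhds hprod ?_ ?_
  · filter_upwards [Filter.eventually_ge_atTop 1] with p hp using (key p hp).1
  · filter_upwards [Filter.eventually_ge_atTop 1] with p hp using (key p hp).2

/-! ### The outage event -/

theorem sopLower_eq_measureReal (R E : RFLink) (D E' : OpticalLink) (φ : ℝ) :
    sopLower φ R.snrLaw E.snrLaw D.snrLaw E'.snrLaw =
      (jointSNR R E D E').real {x | x.1.1 ≤ φ * x.1.2 ∨ x.2.1 ≤ φ * x.2.2} := by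
  have := R.isProbabilityMeasure_snrLaw
  have := E.isProbabilityMeasure_snrLaw
  have := D.isProbabilityMeasure_snrLaw
  have := E'.isProbabilityMeasure_snrLaw
  have hsm := measurableSet_le_mul φ
  -- The complement of the outage event is the product of the two events of hop success, so
  -- independence gives its probability.
  have hset : {x : (ℝ × ℝ) × (ℝ × ℝ) | x.1.1 ≤ φ * x.1.2 ∨ x.2.1 ≤ φ * x.2.2} =
      ({q : ℝ × ℝ | q.1 ≤ φ * q.2}ᶜ ×ˢ {q : ℝ × ℝ | q.1 ≤ φ * q.2}ᶜ)ᶜ := by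
    ext x
    simp only [Set.mem_ofPred_eq, Set.mem_compl_iff, Set.mem_prod, not_and_or, not_not]
  rw [hset, jointSNR, probReal_compl_eq_one_sub (hsm.compl.prod hsm.compl), measureReal_prod_prod,
    probReal_compl_eq_one_sub hsm, probReal_compl_eq_one_sub hsm, sopLower, hopSOP, hopSOP,
    integral_measureReal_Iic_mul, integral_measureReal_Iic_mul]

theorem sopLower_le_measureReal (R E : RFLink) (D E' : OpticalLink) {φ : ℝ} (hφ : 1 ≤ φ) :
    sopLower φ R.snrLaw E.snrLaw D.snrLaw E'.snrLaw ≤ (jointSNR R E D E').real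
        {x | x.1.1 ≤ φ + φ * x.1.2 - 1 ∨ x.2.1 ≤ φ + φ * x.2.2 - 1} := by
  have := R.isProbabilityMeasure_snrLaw
  have := E.isProbabilityMeasure_snrLaw
  have := D.isProbabilityMeasure_snrLaw
  have := E'.isProbabilityMeasure_snrLaw
  have : IsProbabilityMeasure (jointSNR R E D E') := by unfold jointSNR; infer_instance
  rw [sopLower_eq_measureReal]
  -- Since `φ - 1 ≥ 0`, each threshold only increases and the outage event grows.
  refine measureReal_mono fun x hx => ?_
  rcases hx with hx | hx
  · exact Or.inl (by linarith)
  · exact Or.inr (by linarith)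

theorem mainTheorem7 (R E : RFLink) (D E' : OpticalLink)
    (Rs φ : ℝ) (hRs : 0 ≤ Rs) (hφ : φ = 2 ^ Rs) :
    -- the G-functions in the two closed forms are well defined
    (∀ (i i' : Fin 3) (k k' : ℕ),
      MeijerGConverges 3 2 (sop₁Upper R E i k i') (sop₁Lower R E i i' k')
        (E.K₂ / (φ * R.K₂))) ∧
    MeijerGConverges (E'.r + 1) D.r (sop₂Upper D E') (sop₂Lower E') (sop₂Arg φ D E') ∧
    -- the closed forms, with the Bessel functions replaced by their `p`-th approximations
    (∀ p : ℕ, 1 ≤ p →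
      Integrable (fun y => (R.snrApprox p).real (Set.Iic (φ * y))) (E.snrApprox p) ∧
      (hopSOP φ (R.snrApprox p) (E.snrApprox p) : ℂ) = sop₁Closed φ R E p ∧
      (sopLower φ (R.snrApprox p) (E.snrApprox p) D.snrLaw E'.snrLaw : ℂ) =
        1 - sop₁Closed φ R E p * sop₂Closed φ D E') ∧
    Integrable (fun y => D.snrLaw.real (Set.Iic (φ * y))) E'.snrLaw ∧
    (hopSOP φ D.snrLaw E'.snrLaw : ℂ) = sop₂Closed φ D E' ∧
    -- the exact `κ-μ` model: lower bound, its probabilistic meaning, and the limit of the closed forms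
    Integrable (fun y => R.snrLaw.real (Set.Iic (φ * y))) E.snrLaw ∧
    sopLower φ R.snrLaw E.snrLaw D.snrLaw E'.snrLaw =
      (jointSNR R E D E').real {x | x.1.1 ≤ φ * x.1.2 ∨ x.2.1 ≤ φ * x.2.2} ∧
    sopLower φ R.snrLaw E.snrLaw D.snrLaw E'.snrLaw ≤
      (jointSNR R E D E').real
        {x | x.1.1 ≤ φ + φ * x.1.2 - 1 ∨ x.2.1 ≤ φ + φ * x.2.2 - 1} ∧
    Filter.Tendsto (fun p => sop₁Closed φ R E p) Filter.atTop
      (nhds (hopSOP φ R.snrLaw E.snrLaw : ℂ)) ∧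
    Filter.Tendsto (fun p => 1 - sop₁Closed φ R E p * sop₂Closed φ D E') Filter.atTop
      (nhds (sopLower φ R.snrLaw E.snrLaw D.snrLaw E'.snrLaw : ℂ)) := by
  have hφ1 : 1 ≤ φ := hφ ▸ Real.one_le_rpow (by norm_num) hRs
  have hφ0 : 0 < φ := by linarith
  have := R.isProbabilityMeasure_snrLaw
  have := E.isProbabilityMeasure_snrLaw
  have := D.isProbabilityMeasure_snrLaw
  have := E'.isProbabilityMeasure_snrLaw
  have hopt := hopSOP_optical D E' hφ0
  have hlim : Filter.Tendsto (fun p => sop₁Closed φ R E p) Filter.atTop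
      (nhds (hopSOP φ R.snrLaw E.snrLaw : ℂ)) := by
    refine ((Complex.continuous_ofReal.tendsto _).comp
      (tendsto_hopSOP_snrApprox R E φ)).congr' ?_
    filter_upwards [Filter.eventually_ge_atTop 1] with p hp using hopSOP_snrApprox R E hφ0 hp
  refine ⟨meijerGConverges_sop₁ R E hφ0, meijerGConverges_sop₂ D E' hφ0, fun p hp => ?_,
    integrable_measureReal_Iic_mul _ _ φ, hopt, integrable_measureReal_Iic_mul _ _ φ,
    sopLower_eq_measureReal R E D E' φ, sopLower_le_measureReal R E D E' hφ1, hlim, ?_⟩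
  · have := R.isFiniteMeasure_snrApprox hp
    have := E.isFiniteMeasure_snrApprox hp
    have h1 := hopSOP_snrApprox R E hφ0 hp
    refine ⟨integrable_measureReal_Iic_mul _ _ φ, h1, ?_⟩
    rw [← h1, ← hopt, sopLower]
    push_cast
    rfl
  · rw [sopLower, Complex.ofReal_sub, Complex.ofReal_one, Complex.ofReal_mul, hopt]
    exact (hlim.mul_const _).const_sub 1
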